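/- **Setting.** Consider the exosystem $\dot w=s(w)$, $w\in\mathbb R^{n_w}$, and the plant with state $x=(x_0,\chi,\zeta)$, $x_0\in\mathbb R^{n_0}$, $\chi=(\chi^1,\dots,\chi^{n_e})$, $\chi^i\in\mathbb R^{n_\chi^i}$, $n_\chi^i\ge 1$, $\zeta\in\mathbb R^{n_e}$, input $u\in\mathbb R^{n_u}$, $n_u\ge n_e$, and regulation error $e\in\mathbb R^{n_e}$, $$\dot x_0=f_0(w,x)+b(w,x)u,\quad \dot\chi=F\chi+H\zeta,\quad \dot\zeta=q(w,x)+\Omega(w,x)u,\quad e=C\chi ,$$ where $s,f_0,b,q,\Omega$ are continuous, $F,H,C$ are block diagonal, $F_i$ is the $n_\chi^i\times n_\chi^i$ upper shift matrix, $H_i=(0,\dots,0,1)^\top$ and $C_i=(1,0,\dots,0)$. Solutions are defined on $[0,\infty)$, inputs are continuous, and $|v|_{[a,b)}=\sup_{s\in[a,b)}|v(s)|$. **A1.** There are $\beta_0\in\mathcal{KL}$, $\alpha_0>0$ and, for all solutions $w$ of the exosystem, all inputs $u$ and all corresponding solutions $x$ of the plant, functions $x_0^\star,u^\star$ on $[0,\infty)$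 such that, with $x^\star=(x_0^\star,0,0)$, $\dot x_0^\star=f_0(w,x^\star)+b(w,x^\star)u^\star$, $0=q(w,x^\star)+\Omega(w,x^\star)u^\star$, and $$|x_0(t)-x_0^\star(t)|\le\beta_0(|x_0(t_0)-x_0^\star(t_0)|,t-t_0)+\alpha_0|(\chi,\zeta)|_{[t_0,t)}\quad\text{for all } t\ge t_0\ge 0 .$$ From now on such an $(x_0^\star,u^\star)$ is fixed for every $(w,u,x)$. **A2.** $\mathcal L\in\mathbb R^{n_u\times n_e}$ is a full-rank matrix such that $\Omega\mathcal L$ is bounded, $\mathcal L^\top\Omega(w,x)^\top+\Omega(w,x)\mathcal L\ge I$ for all $(w,x)$, and $(\Omega\mathcal L)^{-1}q$ is Lipschitz. **Regulator.** Let $d\ge 1$, $\eta=(\eta_1,\dots,\eta_d)$ with $\eta_i,\xi_1,\xi_2\in\mathbb R^{n_e}$, and let $\varsigma$ range over a finite-dimensional normed space $\mathcal Z_\varsigma$. With control parameters $\rho,g,\kappa,\ell$, the regulator is $$\dot\eta=\Phi(\eta,\gamma(\varsigma))+Ge,\quad\dot\varsigma=\varphi(\varsigma,\xi_2,\eta),\quad\dot\xi_1=\xi_2-m_1\rho(\xi_1-\eta_d),\quad\dot\xi_2=\dot\psi(\xi_2,\eta,\varsigma)-m_2\rho^2(\xi_1-\eta_d),$$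 $$u=\mathcal L\big(\ell K(\kappa)\chi-\ell\zeta+K_\eta\eta_1+K_w\nu(x^\star,w)\big),\qquad K_\eta=\ell K(\kappa)C^\top .$$ Here $\Phi(\eta,\theta)=(\eta_2,\dots,\eta_d,\psi(\eta,\theta))$, $\theta\in\mathbb R^{n_\theta}$; $Ge$ has the blocks $g^ih_ie$ with $s^d+h_1s^{d-1}+\dots+h_d$ Hurwitz; $m_1,m_2>0$; $K(\kappa)$ is block diagonal with blocks $-(c^i_1\kappa^{n_\chi^i},c^i_2\kappa^{n_\chi^i-1},\dots,c^i_{n_\chi^i}\kappa)$, where the polynomials $s^{n_\chi^i}+c^i_{n_\chi^i}s^{n_\chi^i-1}+\dots+c^i_1$ are Hurwitz; $K_w$ is any matrix, possibly dependent on $(\kappa,\ell)$, and $\nu$ is continuous. All other data are independent of the control parameters. **Ideal signals.** Let $\eta_1^\star(t)=-\big(\Omega(w,x^\star)\mathcal LK_\eta\big)^{-1}\big(q(w,x^\star)+\Omega(w,x^\star)\mathcal LK_w\nu(x^\star,w)\big)$, evaluated along $(w(t),x^\star(t))$; let $\eta^\star_{i+1}=\frac{d}{dt}\eta^\star_i$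 for $i=1,\dots,d$, $\eta^\star=(\eta_1^\star,\dots,\eta_d^\star)$ and $\dot\eta_d^\star=\eta_{d+1}^\star$. These signals depend on $\kappa$ and $\ell$. For a signal $(\dot\eta_d^\star,\eta^\star)$ let $\varepsilon^\star(t,\theta)=\dot\eta_d^\star(t)-\psi(\eta^\star(t),\theta)$. **A3.** $\mathcal H^\star$ is a set of functions $\mathbb R_{\ge0}\to\mathbb R^{n_e}\times\mathbb R^{dn_e}$ and $H^\star$ is a compact set that contains all the values of all members of $\mathcal H^\star$; $\psi$ is Lipschitz and differentiable with locally Lipschitz derivative. **Identifier requirement.** Let $c_\varepsilon:\mathbb R_{\ge0}^3\to\mathbb R_{\ge0}$ and $c_r:\mathbb R^{n_\theta}\to\mathbb R_{\ge0}$ be such that $\mathcal J(t)(\theta)=\int_0^tc_\varepsilon(t,s,|\varepsilon^\star(s,\theta)|)\,ds+c_r(\theta)$ is well defined and continuous in $\theta$ for every signal in $\mathcal H^\star$. The map $\varphi$ is locally Lipschitz, $\gamma$ is Lipschitz and differentiable with locally Lipschitz derivative, and there are $\beta_\varsigma\in\mathcal{KL}$, $\alpha_\varsigma>0$, a compact set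 $S^\star\subset\mathcal Z_\varsigma$ and, for each $(\dot\eta_d^\star,\eta^\star)\in\mathcal H^\star$, a function $\varsigma^\star:\mathbb R_{\ge0}\to S^\star$ such that: for all locally integrable $\delta',\delta''$, all maximal (Carathéodory) solutions of $\dot\varsigma=\varphi(\varsigma,\dot\eta_d^\star+\delta',\eta^\star+\delta'')$ are complete and satisfy $$|\varsigma(t)-\varsigma^\star(t)|\le\beta_\varsigma(|\varsigma(t_0)-\varsigma^\star(t_0)|,t-t_0)+\alpha_\varsigma|(\delta',\delta'')|_{[t_0,t)}\quad\text{for all } t\ge t_0\ge0 ;$$ and $\theta^\star(t)=\gamma(\varsigma^\star(t))$ minimises $\mathcal J(t)$ over $\mathbb R^{n_\theta}$ for every $t\ge0$. Finally, $\dot\psi$ is any bounded, locally Lipschitz function with $\dot\psi(\xi_2,\eta,\varsigma)=\mathrm D\psi(\eta,\gamma(\varsigma))\,\mathrm{col}\big(\Phi(\eta,\gamma(\varsigma)),\mathrm D\gamma(\varsigma)\varphi(\varsigma,\xi_2,\eta)\big)$ for $((\xi_2,\eta),\varsigma)\in H^\star\times S^\star$. **Theorem.** Assume A1, A2, A3 and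 the identifier requirement, and suppose that, for all solutions $(w,u,x)$ of exosystem and plant and all $\kappa,\ell>1$, the signal $\eta_1^\star$ is $d$ times continuously differentiable and $(\dot\eta_d^\star,\eta^\star)\in\mathcal H^\star$. Then there are a constant $c>0$, not dependent on the control parameters, and thresholds $\rho^\star,\,g^\star(\rho),\,\kappa^\star(g),\,\ell^\star(g,\kappa)>0$ such that, for all $\rho\ge\rho^\star$, $g\ge g^\star(\rho)$, $\kappa\ge\kappa^\star(g)$ and $\ell\ge\ell^\star(g,\kappa)$, every solution of the closed-loop system of exosystem, plant and regulator satisfies $$\limsup_{t\to\infty}|e(t)|\le\frac{c}{g^d}\,\limsup_{t\to\infty}|\varepsilon^\star(t,\theta^\star(t))| .$$ -/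

import Mathlib

open Set Filter Topology MeasureTheory
open scoped NNReal ENNReal Matrix

noncomputable section

namespace OutReg

/-! ## Notation and generalities

Vectors carry the Euclidean norm.  Tuples of vectors carry the maximum of the norms of their
entries; this norm is equivalent to the Euclidean one, and all estimates below are up to constants
(or up to a comparison function) that are free. -/

/-- The Euclidean space of dimension `n`. -/
abbrev Vec (n : ℕ) := EuclideanSpace ℝ (Fin n)

/-- The space of `χ = col(χ¹, …, χ^{nₑ})`, with `χⁱ` of dimension `nχ i`. -/
abbrev ChainVec {ne : ℕ} (nχ : Fin ne → ℕ) := EuclideanSpace ℝ (Σ i, Fin (nχ i))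

/-- The space of the plant state `x = (x₀, χ, ζ)`. -/
abbrev State (n0 : ℕ) {ne : ℕ} (nχ : Fin ne → ℕ) := Vec n0 × ChainVec nχ × Vec ne

/-- The space of `η = (η₁, …, η_d)`; the index `i : Fin d` stands for `η_{i+1}`. -/
abbrev Stack (d ne : ℕ) := Fin d → Vec ne

/-- Signals `(η̇_d, η) : ℝ≥0 → ℝ^{nₑ} × ℝ^{d nₑ}`. -/
abbrev Signal (d ne : ℕ) := ℝ≥0 → Vec ne × Stack d ne

/-- The product of a matrix and a column vector. -/
def act {m n : Type*} [Fintype n] (M : Matrix m n ℝ) (v : EuclideanSpace ℝ n) :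
    EuclideanSpace ℝ m :=
  WithLp.toLp 2 (M *ᵥ v.ofLp)

/-- A comparison function of class `𝒦ℒ`. -/
structure IsKL (β : ℝ≥0 → ℝ≥0 → ℝ≥0) : Prop where
  continuous : ∀ t, Continuous fun s => β s t
  strictMono : ∀ t, StrictMono fun s => β s t
  zero : ∀ t, β 0 t = 0
  antitone : ∀ s, Antitone (β s)
  tendsto : ∀ s, Tendsto (β s) atTop (𝓝 0)

/-- `|f|_{[a,b)}`, the supremum of `|f(s)|` for `s ∈ [a,b)`, in `[0,∞]` (it is `0` if `b ≤ a`). -/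
def supNorm {V : Type*} [NormedAddCommGroup V] (f : ℝ → V) (a b : ℝ) : ℝ≥0∞ :=
  ⨆ s ∈ Ico a b, ‖f s‖ₑ

/-- A real polynomial is Hurwitz if all its complex roots have negative real part. -/
def IsHurwitz (p : Polynomial ℝ) : Prop :=
  ∀ z : ℂ, Polynomial.aeval z p = 0 → z.re < 0

/-- `v` solves `v' = F(t)` on `[0,∞)` (one-sided derivative at `0`). -/
def SolvesOn {V : Type*} [NormedAddCommGroup V] [NormedSpace ℝ V] (v F : ℝ → V) : Prop :=
  ∀ t, 0 ≤ t → HasDerivWithinAt v (F t) (Ici 0) t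

/-- Carathéodory solutions of `z' = F(t,z)` on an interval `I` that starts at `0`. -/
def IsCaraSol {V : Type*} [NormedAddCommGroup V] [NormedSpace ℝ V] (F : ℝ → V → V)
    (I : Set ℝ) (z : ℝ → V) : Prop :=
  ∀ t ∈ I, IntervalIntegrable (fun s => F s (z s)) volume 0 t ∧
    z t = z 0 + ∫ s in (0 : ℝ)..t, F s (z s)

/-! ## Chains of integrators -/

section Chains

variable {ne : ℕ} (nχ : Fin ne → ℕ)

/-- `F = blkdiag(F₁, …)`, every `Fᵢ` having ones right above the diagonal. -/
def chainF : Matrix (Σ i, Fin (nχ i)) (Σ i, Fin (nχ i)) ℝ :=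
  Matrix.blockDiagonal' fun i => Matrix.of fun j k : Fin (nχ i) =>
    if (k : ℕ) = (j : ℕ) + 1 then 1 else 0

/-- `H = blkdiag(H₁, …)`, with `Hᵢ` the last unit column vector. -/
def chainH : Matrix (Σ i, Fin (nχ i)) (Fin ne) ℝ :=
  Matrix.of fun p i => if p.1 = i ∧ (p.2 : ℕ) + 1 = nχ p.1 then 1 else 0

/-- `C = blkdiag(C₁, …)`, with `Cᵢ` the first unit row vector. -/
def chainC : Matrix (Fin ne) (Σ i, Fin (nχ i)) ℝ :=
  Matrix.of fun i p => if p.1 = i ∧ (p.2 : ℕ) = 0 then 1 else 0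

/-- `K(κ) = blkdiag(K¹(κ), …)`, `Kⁱ(κ) = -(c₁ⁱ κ^{n}, c₂ⁱ κ^{n-1}, …, cₙⁱ κ)` with `n = nχ i`; the
index `j : Fin (nχ i)` of the coefficients `a i j` stands for `c_{j+1}ⁱ`. -/
def chainK (a : ∀ i, Fin (nχ i) → ℝ) (κ : ℝ) : Matrix (Fin ne) (Σ i, Fin (nχ i)) ℝ :=
  Matrix.of fun i p => if p.1 = i then -(a p.1 p.2 * κ ^ (nχ p.1 - (p.2 : ℕ))) else 0

end Chains

/-! ## The plant and the exosystem -/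

/-- The data of the plant
`x₀' = f₀(w,x) + b(w,x) u`, `χ' = F χ + H ζ`, `ζ' = q(w,x) + Ω(w,x) u`, `e = C χ`
and of the exosystem `w' = s(w)`. -/
structure Plant (nw n0 nu ne : ℕ) (nχ : Fin ne → ℕ) where
  s : Vec nw → Vec nw
  f0 : Vec nw → State n0 nχ → Vec n0
  b : Vec nw → State n0 nχ → Matrix (Fin n0) (Fin nu) ℝ
  q : Vec nw → State n0 nχ → Vec ne
  Ω : Vec nw → State n0 nχ → Matrix (Fin ne) (Fin nu) ℝ
  chain_pos : ∀ i, 0 < nχ i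
  inputs_ge : ne ≤ nu
  s_cont : Continuous s
  f0_cont : Continuous fun p : Vec nw × State n0 nχ => f0 p.1 p.2
  b_cont : Continuous fun p : Vec nw × State n0 nχ => b p.1 p.2
  q_cont : Continuous fun p : Vec nw × State n0 nχ => q p.1 p.2
  Ω_cont : Continuous fun p : Vec nw × State n0 nχ => Ω p.1 p.2

section PlantDefs

variable {nw n0 nu ne : ℕ} {nχ : Fin ne → ℕ} (P : Plant nw n0 nu ne nχ)

/-- `w` solves the exosystem and `x` solves the plant for `(w,u)` on `[0,∞)`, `u` continuous. -/
structure IsPlantSol (w : ℝ → Vec nw) (u : ℝ → Vec nu) (x : ℝ → State n0 nχ) : Prop where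
  u_cont : ContinuousOn u (Ici 0)
  exo : SolvesOn w fun t => P.s (w t)
  x0 : SolvesOn (fun t => (x t).1) fun t => P.f0 (w t) (x t) + act (P.b (w t) (x t)) (u t)
  chi : SolvesOn (fun t => (x t).2.1) fun t =>
    act (chainF nχ) (x t).2.1 + act (chainH nχ) (x t).2.2
  zeta : SolvesOn (fun t => (x t).2.2) fun t => P.q (w t) (x t) + act (P.Ω (w t) (x t)) (u t)

/-- The ideal steady state `x⋆ = (x₀⋆, 0, 0)`. -/
def steady (nχ : Fin ne → ℕ) (x0s : ℝ → Vec n0) (t : ℝ) : State n0 nχ := (x0s t, 0, 0)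

/-- `(x₀⋆, u⋆)` fulfils the regulator equations along `w`, and `x₀⋆` is detectable from `(χ,ζ)` along
`x`, with comparison function `β₀` and gain `α₀`; as usual for input-to-state estimates, the bound
holds from every initial time `t₀`. -/
structure IsSteadyState (β0 : ℝ≥0 → ℝ≥0 → ℝ≥0) (α0 : ℝ≥0) (w : ℝ → Vec nw)
    (x : ℝ → State n0 nχ) (x0s : ℝ → Vec n0) (us : ℝ → Vec nu) : Prop where
  x0s_eq : SolvesOn x0s fun t => P.f0 (w t) (steady nχ x0s t) +
    act (P.b (w t) (steady nχ x0s t)) (us t)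
  reg : ∀ t, 0 ≤ t → 0 = P.q (w t) (steady nχ x0s t) + act (P.Ω (w t) (steady nχ x0s t)) (us t)
  detect : ∀ t₀ t : ℝ≥0, t₀ ≤ t →
    ‖(x t).1 - x0s t‖ₑ ≤ (β0 ‖(x t₀).1 - x0s t₀‖₊ (t - t₀) : ℝ≥0∞) +
      (α0 : ℝ≥0∞) * supNorm (fun τ => (x τ).2) t₀ t

/-- The first assumption.  `ss` names the pair `(x₀⋆, u⋆)` that belongs to `(w,u,x)`. -/
structure Assumption1 (β0 : ℝ≥0 → ℝ≥0 → ℝ≥0) (α0 : ℝ≥0)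
    (ss : (ℝ → Vec nw) → (ℝ → Vec nu) → (ℝ → State n0 nχ) → (ℝ → Vec n0) × (ℝ → Vec nu)) :
    Prop where
  kl : IsKL β0
  pos : 0 < α0
  steadyState : ∀ w u x, IsPlantSol P w u x →
    IsSteadyState P β0 α0 w x (ss w u x).1 (ss w u x).2

/-- The second assumption, on `ℒ`. -/
structure Assumption2 (L : Matrix (Fin nu) (Fin ne) ℝ) : Prop where
  full_rank : L.rank = ne
  bounded : ∃ M : ℝ, ∀ w x i j, |(P.Ω w x * L) i j| ≤ M
  positive : ∀ w x, (Lᵀ * (P.Ω w x)ᵀ + P.Ω w x * L - 1).PosSemidef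
  lipschitz : ∃ M : ℝ≥0, LipschitzWith M fun p : Vec nw × State n0 nχ =>
    act (P.Ω p.1 p.2 * L)⁻¹ (P.q p.1 p.2)

end PlantDefs

/-! ## The regulator -/

/-- The data of the regulator that are fixed before the control parameters `ρ, g, κ, ℓ`.  The matrix
`K_w` may depend on `(κ,ℓ)`. -/
structure Regulator (nw n0 nu : ℕ) {ne : ℕ} (nχ : Fin ne → ℕ) (d nθ nν : ℕ)
    (Z : Type*) [NormedAddCommGroup Z] [NormedSpace ℝ Z] where
  /-- `ℒ` -/
  L : Matrix (Fin nu) (Fin ne) ℝ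
  /-- the coefficients `c_jⁱ` -/
  a : ∀ i, Fin (nχ i) → ℝ
  Kw : ℝ → ℝ → Matrix (Fin ne) (Fin nν) ℝ
  ν : State n0 nχ → Vec nw → Vec nν
  /-- the coefficients `h_i` -/
  h : Fin d → ℝ
  m1 : ℝ
  m2 : ℝ
  ψ : Stack d ne × Vec nθ → Vec ne
  /-- `φ(ς, ξ₂, η)` -/
  φ : Z × Vec ne × Stack d ne → Z
  γ : Z → Vec nθ
  /-- the function called `ψ̇(ξ₂, η, ς)` -/
  ψdot : Vec ne × Stack d ne × Z → Vec ne
  d_pos : 0 < d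
  ν_cont : Continuous fun p : State n0 nχ × Vec nw => ν p.1 p.2
  a_hurwitz : ∀ i, IsHurwitz
    (Polynomial.X ^ nχ i + ∑ j : Fin (nχ i), Polynomial.C (a i j) * Polynomial.X ^ (j : ℕ))
  h_hurwitz : IsHurwitz
    (Polynomial.X ^ d + ∑ i : Fin d, Polynomial.C (h i) * Polynomial.X ^ (d - 1 - (i : ℕ)))
  m1_pos : 0 < m1
  m2_pos : 0 < m2

section RegulatorDefs

variable {nw n0 nu ne : ℕ} {nχ : Fin ne → ℕ} {d nθ nν : ℕ}
  {Z : Type*} [NormedAddCommGroup Z] [NormedSpace ℝ Z]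
  (P : Plant nw n0 nu ne nχ) (R : Regulator nw n0 nu nχ d nθ nν Z)

/-- The first block `η₁`. -/
def Regulator.fst (η : Stack d ne) : Vec ne := η ⟨0, R.d_pos⟩

/-- The last block `η_d`. -/
def Regulator.lst (η : Stack d ne) : Vec ne := η ⟨d - 1, Nat.sub_lt R.d_pos one_pos⟩

/-- `K_χ = ℓ K(κ)`; moreover `K_ζ = -ℓ I`. -/
def Regulator.Kχ (κ ℓ : ℝ) : Matrix (Fin ne) (Σ i, Fin (nχ i)) ℝ := ℓ • chainK nχ R.a κ

/-- `K_η = ℓ K(κ) Cᵀ`. -/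
def Regulator.Kη (κ ℓ : ℝ) : Matrix (Fin ne) (Fin ne) ℝ :=
  ℓ • (chainK nχ R.a κ * (chainC nχ)ᵀ)

/-- `Φ(η,θ) = (η₂, …, η_d, ψ(η,θ))`. -/
def Regulator.Phi (η : Stack d ne) (θ : Vec nθ) : Stack d ne := fun i =>
  if hi : (i : ℕ) + 1 < d then η ⟨(i : ℕ) + 1, hi⟩ else R.ψ (η, θ)

/-- `G e`, with blocks `g^i h_i e`, `i = 1, …, d`. -/
def Regulator.Gmul (g : ℝ) (e : Vec ne) : Stack d ne := fun i =>
  (g ^ ((i : ℕ) + 1) * R.h i) • e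

/-- The stabiliser `u = ℒ (K_χ χ + K_ζ ζ + K_η η₁ + K_w ν(x⋆,w))`. -/
def Regulator.control (κ ℓ : ℝ) (χ : ChainVec nχ) (ζ : Vec ne) (η1 : Vec ne)
    (xs : State n0 nχ) (w : Vec nw) : Vec nu :=
  act R.L (act (R.Kχ κ ℓ) χ + act (-ℓ • (1 : Matrix (Fin ne) (Fin ne) ℝ)) ζ +
    act (R.Kη κ ℓ) η1 + act (R.Kw κ ℓ) (R.ν xs w))

/-! ### The ideal steady-state signals of the internal model -/

/-- `Υ_{(ℓ,κ)}(w,x) = -(Ω(w,x) ℒ K_η)⁻¹ (q(w,x) + Ω(w,x) ℒ K_w ν(x,w))`. -/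
def Regulator.upsilon (κ ℓ : ℝ) (w : Vec nw) (x : State n0 nχ) : Vec ne :=
  -act (P.Ω w x * R.L * R.Kη κ ℓ)⁻¹
    (P.q w x + act (P.Ω w x * R.L * R.Kw κ ℓ) (R.ν x w))

/-- `η₁⋆(t) = Υ_{(ℓ,κ)}(w(t), x⋆(t))`. -/
def Regulator.etaOne (κ ℓ : ℝ) (w : ℝ → Vec nw) (x0s : ℝ → Vec n0) (t : ℝ) : Vec ne :=
  R.upsilon P κ ℓ (w t) (steady nχ x0s t)

/-- The signal `(η̇_d⋆, η⋆)`: `η_{i+1}⋆` is the `i`-th derivative of `η₁⋆` along the steady state, and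
`η̇_d⋆` is the `d`-th one. -/
def Regulator.idealSignal (κ ℓ : ℝ) (w : ℝ → Vec nw) (x0s : ℝ → Vec n0) : Signal d ne := fun t =>
  (iteratedDerivWithin d (R.etaOne P κ ℓ w x0s) (Ici 0) t,
    fun i => iteratedDerivWithin (i : ℕ) (R.etaOne P κ ℓ w x0s) (Ici 0) t)

/-- For all `κ, ℓ > 1`, the signals `η₁⋆, …, η_{d+1}⋆` are well defined (that is, `η₁⋆` is `d` times
continuously differentiable) and `(η̇_d⋆, η⋆)` belongs to the class `ℋ⋆`. -/
def Regulator.IdealInClass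
    (ss : (ℝ → Vec nw) → (ℝ → Vec nu) → (ℝ → State n0 nχ) → (ℝ → Vec n0) × (ℝ → Vec nu))
    (Hcl : Set (Signal d ne)) : Prop :=
  ∀ w u x, IsPlantSol P w u x → ∀ κ ℓ : ℝ, 1 < κ → 1 < ℓ →
    ContDiffOn ℝ d (R.etaOne P κ ℓ w (ss w u x).1) (Ici 0) ∧
      R.idealSignal P κ ℓ w (ss w u x).1 ∈ Hcl

/-- The third assumption: `ψ` is Lipschitz and differentiable with locally Lipschitz derivative, and
the signals of the class `ℋ⋆` take values in the compact set `H⋆`. -/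
structure Regulator.Assumption3 (Hcl : Set (Signal d ne)) (Hset : Set (Vec ne × Stack d ne)) :
    Prop where
  lipschitz : ∃ M : ℝ≥0, LipschitzWith M R.ψ
  differentiable : Differentiable ℝ R.ψ
  deriv_lipschitz : LocallyLipschitz (fderiv ℝ R.ψ)
  compact : IsCompact Hset
  mem : ∀ p ∈ Hcl, ∀ t, p t ∈ Hset

/-! ### The identifier -/

/-- The prediction error `ε⋆(t,θ) = η̇_d⋆(t) - ψ(η⋆(t),θ)` of the signal `p = (η̇_d⋆, η⋆)`. -/
def Regulator.predErr (p : Signal d ne) (t : ℝ≥0) (θ : Vec nθ) : Vec ne :=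
  (p t).1 - R.ψ ((p t).2, θ)

/-- The integrand `c_ε(t, s, |ε⋆(s,θ)|)` of the cost functional. -/
def Regulator.costDensity (cε : ℝ≥0 → ℝ≥0 → ℝ≥0 → ℝ≥0) (p : Signal d ne) (t : ℝ≥0)
    (θ : Vec nθ) (s : ℝ) : ℝ :=
  cε t s.toNNReal ‖R.predErr p s.toNNReal θ‖₊

/-- The cost functional `𝒥_p(t)(θ) = ∫₀ᵗ c_ε(t, s, |ε⋆(s,θ)|) ds + c_r(θ)`. -/
def Regulator.cost (cε : ℝ≥0 → ℝ≥0 → ℝ≥0 → ℝ≥0) (cr : Vec nθ → ℝ≥0) (p : Signal d ne)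
    (t : ℝ≥0) (θ : Vec nθ) : ℝ :=
  (∫ s in (0 : ℝ)..t, R.costDensity cε p t θ s) + cr θ

/-- The cost functional is a well-defined map from `ℝ≥0` to the continuous functions of `θ`. -/
def Regulator.CostWellDefined (cε : ℝ≥0 → ℝ≥0 → ℝ≥0 → ℝ≥0) (cr : Vec nθ → ℝ≥0)
    (Hcl : Set (Signal d ne)) : Prop :=
  ∀ p ∈ Hcl, ∀ t : ℝ≥0,
    (∀ θ, IntervalIntegrable (R.costDensity cε p t θ) volume 0 t) ∧
      Continuous (R.cost cε cr p t)

/-- The set `ϑ°_p(t)` of the minimisers of `𝒥_p(t)`. -/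
def Regulator.minimisers (cε : ℝ≥0 → ℝ≥0 → ℝ≥0 → ℝ≥0) (cr : Vec nθ → ℝ≥0) (p : Signal d ne)
    (t : ℝ≥0) : Set (Vec nθ) :=
  {θ | ∀ θ', R.cost cε cr p t θ ≤ R.cost cε cr p t θ'}

/-- The right-hand side of `ς' = φ(ς, η̇_d⋆ + δ', η⋆ + δ'')`, with `δ = (δ', δ'')`. -/
def Regulator.idField (p : Signal d ne) (δ : ℝ → Vec ne × Stack d ne) (t : ℝ) (ς : Z) : Z :=
  R.φ (ς, (p t.toNNReal).1 + (δ t).1, (p t.toNNReal).2 + (δ t).2)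

/-- The identifier requirement, relative to the class `ℋ⋆` and the cost functional given by
`(c_ε, c_r)`.  `ςs p` is the steady state `ς⋆ : ℝ≥0 → S⋆` that belongs to the signal `p`. -/
structure Regulator.IdentifierRequirement (Hcl : Set (Signal d ne))
    (cε : ℝ≥0 → ℝ≥0 → ℝ≥0 → ℝ≥0) (cr : Vec nθ → ℝ≥0)
    (βς : ℝ≥0 → ℝ≥0 → ℝ≥0) (ας : ℝ≥0) (S : Set Z) (ςs : Signal d ne → ℝ≥0 → Z) : Prop where
  φ_lipschitz : LocallyLipschitz R.φ
  γ_lipschitz : ∃ M : ℝ≥0, LipschitzWith M R.γ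
  γ_differentiable : Differentiable ℝ R.γ
  γ_deriv_lipschitz : LocallyLipschitz (fderiv ℝ R.γ)
  kl : IsKL βς
  gain_pos : 0 < ας
  compact : IsCompact S
  mem : ∀ p ∈ Hcl, ∀ t, ςs p t ∈ S
  /-- all maximal solutions are complete: every solution on some `[0,T)` extends to `[0,∞)` -/
  complete : ∀ p ∈ Hcl, ∀ δ : ℝ → Vec ne × Stack d ne, LocallyIntegrable δ →
    ∀ (T : ℝ) (ς : ℝ → Z), 0 < T → IsCaraSol (R.idField p δ) (Ico 0 T) ς →
      ∃ ς' : ℝ → Z, IsCaraSol (R.idField p δ) (Ici 0) ς' ∧ EqOn ς' ς (Ico 0 T)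
  /-- input-to-state stability of `ς⋆`, from every initial time `t₀` -/
  iss : ∀ p ∈ Hcl, ∀ δ : ℝ → Vec ne × Stack d ne, LocallyIntegrable δ →
    ∀ ς : ℝ → Z, IsCaraSol (R.idField p δ) (Ici 0) ς → ∀ t₀ t : ℝ≥0, t₀ ≤ t →
      ‖ς t - ςs p t‖ₑ ≤ (βς ‖ς t₀ - ςs p t₀‖₊ (t - t₀) : ℝ≥0∞) + (ας : ℝ≥0∞) * supNorm δ t₀ t
  optimal : ∀ p ∈ Hcl, ∀ t, R.γ (ςs p t) ∈ R.minimisers cε cr p t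

/-- The choice of `ψ̇`: a bounded locally Lipschitz function that equals
`Dψ(η,γ(ς)) col(Φ(η,γ(ς)), Dγ(ς) φ(ς,ξ₂,η))` for `((ξ₂,η),ς) ∈ H⋆ × S⋆`. -/
structure Regulator.PsiDotOk (Hset : Set (Vec ne × Stack d ne)) (S : Set Z) : Prop where
  bounded : ∃ M : ℝ, ∀ v, ‖R.ψdot v‖ ≤ M
  lipschitz : LocallyLipschitz R.ψdot
  eq : ∀ (ξ2 : Vec ne) (η : Stack d ne) (ς : Z), (ξ2, η) ∈ Hset → ς ∈ S →
    R.ψdot (ξ2, η, ς) =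
      fderiv ℝ R.ψ (η, R.γ ς) (R.Phi η (R.γ ς), fderiv ℝ R.γ ς (R.φ (ς, ξ2, η)))

/-! ### The closed loop -/

/-- Solutions on `[0,∞)` of the closed-loop system with control parameters `ρ, g, κ, ℓ`; `x0s` is the
steady state that appears in the stabiliser. -/
structure IsClosedLoopSol (ρ g κ ℓ : ℝ) (x0s : ℝ → Vec n0) (w : ℝ → Vec nw) (u : ℝ → Vec nu)
    (x : ℝ → State n0 nχ) (η : ℝ → Stack d ne) (ς : ℝ → Z) (ξ1 ξ2 : ℝ → Vec ne) : Prop where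
  plant : IsPlantSol P w u x
  eta : SolvesOn η fun t =>
    R.Phi (η t) (R.γ (ς t)) + R.Gmul g (act (chainC nχ) (x t).2.1)
  sigma : SolvesOn ς fun t => R.φ (ς t, ξ2 t, η t)
  xi1 : SolvesOn ξ1 fun t => ξ2 t - (R.m1 * ρ) • (ξ1 t - R.lst (η t))
  xi2 : SolvesOn ξ2 fun t =>
    R.ψdot (ξ2 t, η t, ς t) - (R.m2 * ρ ^ 2) • (ξ1 t - R.lst (η t))
  control : ∀ t, 0 ≤ t → u t =
    R.control κ ℓ (x t).2.1 (x t).2.2 (R.fst (η t)) (steady nχ x0s t) (w t)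

end RegulatorDefs

end OutReg

end

open OutReg

/-! The closed loop is an interconnection of six subsystems: derivative observer, identifier,
internal model, chains of integrators, stabiliser and zero dynamics. Each is measured by its
deviation from the ideal signals, where appropriate in coordinates scaled by `ρ`, `g` or `κ`, and
each deviation is bounded by its inputs up to a vanishing transient (`HasAsymptoticGain`). The
observer, the internal model and the chains are Hurwitz systems sped up by their parameter, so their
gains carry its inverse (`exists_asymptoticGain_linear`). The stabiliser has the Lyapunov function
`‖z‖ ^ 2`, because the symmetric part of `Ω ℒ` is positive definite (`asymptoticGain_of_positive`).
For the identifier and the zero dynamics the gains are assumed. `exists_gain_loopErrors` collects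
all of them in the matrix `loopGain`, with one constant that is free of the control parameters.

The factor `g⁻ᵈ` has a simple origin. The mismatch `ψ(η,θ) - η̇_d⋆` enters only the last of the `d`
blocks of the internal model, which the scaling weights by `g^(1-d)`; the contraction rate `g`
contributes one more power. The mismatch consists of the optimal prediction error and of terms
Lipschitz in the errors of `η` and `ς`. The error of `η` is at most `g^(d-1)` times the scaled one,
so on its return it still meets a factor `1/g`. Hence `ρ` weakens the loop of observer and
identifier, `g` the loop through the internal model, `κ` the loop through the chains, which feel the
derivative of the first internal-model error, of size `g`, and `ℓ` all loops through the stabiliser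
and the zero dynamics. This is the order of the choice of parameters, and `static_gains` is the
resulting algebra.

`upperLimit_le_of_network` carries the algebra over to trajectories. Suprema over `[0,T]` satisfy
the gain inequalities with an additive constant, so they are bounded uniformly in `T`; the upper
limits are then finite and satisfy the inequalities without the constant.

Two points need care. The identifier steady state `ς⋆` is not assumed to be a solution; it is one
because input-to-state stability with zero perturbation and zero initial error leaves no room for a
deviation. Therefore `ψ(η⋆,θ⋆)` is differentiable and can serve as the reference of `ξ₂`, whereas
`η̇_d⋆` is only known to be continuous. Moreover `ψ̇` is only locally Lipschitz, but being bounded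
it satisfies a global Lipschitz estimate relative to the points of a compact set, and the ideal
signals stay in one. -/

/-! ## Exponential stability of linear systems -/

/-- Every eigenvalue of the exponential of an operator is the exponential of an eigenvalue. -/
theorem exists_hasEigenvalue_of_exp {E : Type*} [NormedAddCommGroup E] [NormedSpace ℂ E]
    [FiniteDimensional ℂ E] (T : E →L[ℂ] E) {μ : ℂ}
    (hμ : Module.End.HasEigenvalue ((NormedSpace.exp T : E →L[ℂ] E) : E →ₗ[ℂ] E) μ) :
    ∃ z, Module.End.HasEigenvalue (T : E →ₗ[ℂ] E) z ∧ μ = Complex.exp z := by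
  have : CompleteSpace E := FiniteDimensional.complete ℂ E
  set W := Module.End.eigenspace ((NormedSpace.exp T : E →L[ℂ] E) : E →ₗ[ℂ] E) μ with hW
  have hcomm : Commute ((NormedSpace.exp T : E →L[ℂ] E) : Module.End ℂ E) (T : Module.End ℂ E) := by
    have h := (Commute.refl T).exp_left
    exact LinearMap.ext fun v => congrArg (fun S : E →L[ℂ] E => S v) h.eq
  -- `T` commutes with its exponential and so preserves this eigenspace; over `ℂ` it has an
  -- eigenvector there, on which the exponential series sums to multiplication by `exp z`.
  have hmaps : ∀ v ∈ W, (T : E →ₗ[ℂ] E) v ∈ W := fun v hv =>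
    Module.End.mapsTo_genEigenspace_of_comm hcomm μ 1 hv
  have : Nontrivial W := Submodule.nontrivial_iff_ne_bot.mpr hμ
  obtain ⟨z, hz⟩ := Module.End.exists_eigenvalue ((T : E →ₗ[ℂ] E).restrict hmaps)
  obtain ⟨v, hv⟩ := hz.exists_hasEigenvector
  have hv0 : (v : E) ≠ 0 := fun h => hv.2 (Subtype.ext h)
  have hTv : T v = z • (v : E) := congrArg Subtype.val hv.apply_eq_smul
  refine ⟨z, Module.End.hasEigenvalue_of_hasEigenvector
    ⟨Module.End.mem_eigenspace_iff.mpr hTv, hv0⟩, ?_⟩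
  have h1 : (NormedSpace.exp T : E →L[ℂ] E) (v : E) = μ • (v : E) :=
    Module.End.mem_eigenspace_iff.mp v.2
  have hpow : ∀ n : ℕ, (T ^ n) (v : E) = z ^ n • (v : E) := by
    intro n
    induction n with
    | zero => simp
    | succ n ih => rw [pow_succ', mul_apply_eq_comp, ih, map_smul, hTv, smul_smul,
        pow_succ]
  have h2 : (NormedSpace.exp T : E →L[ℂ] E) (v : E) = Complex.exp z • (v : E) := by
    have hs := NormedSpace.exp_series_hasSum_exp' (𝕂 := ℂ) T
    have hs' := (ContinuousLinearMap.apply ℂ E (v : E)).hasSum hs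
    have hz := NormedSpace.exp_series_hasSum_exp' (𝕂 := ℂ) z
    have hz' := hz.smul_const (v : E)
    rw [← Complex.exp_eq_exp_ℂ] at hz'
    refine hs'.unique ?_
    convert! hz' using 2 with n
    simp [hpow, smul_smul]
  have h3 : (μ - Complex.exp z) • (v : E) = 0 := by rw [sub_smul, ← h1, ← h2, sub_self]
  exact sub_eq_zero.mp ((smul_eq_zero.mp h3).resolve_right hv0)

/-- An operator whose eigenvalues have negative real part generates an exponentially stable
semigroup. -/
theorem exists_norm_exp_le {E : Type*} [NormedAddCommGroup E] [NormedSpace ℂ E]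
    [FiniteDimensional ℂ E] (T : E →L[ℂ] E)
    (hT : ∀ z, Module.End.HasEigenvalue (T : E →ₗ[ℂ] E) z → z.re < 0) :
    ∃ c lam : ℝ, 0 < c ∧ 0 < lam ∧ ∀ t : ℝ, 0 ≤ t →
      ‖NormedSpace.exp (t • T)‖ ≤ c * Real.exp (-(lam * t)) := by
  have : CompleteSpace E := FiniteDimensional.complete ℂ E
  rcases subsingleton_or_nontrivial E with hE | hE
  · refine ⟨1, 1, one_pos, one_pos, fun t _ => ?_⟩
    rw [Subsingleton.elim (NormedSpace.exp (t • T)) 0, norm_zero]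
    positivity
  have hrad : spectralRadius ℂ (NormedSpace.exp T) < (1 : ℝ≥0) := by
    refine spectrum.spectralRadius_lt_of_forall_lt _ fun μ hμ => ?_
    have hμ' : μ ∈ spectrum ℂ ((NormedSpace.exp T : E →L[ℂ] E) : Module.End ℂ E) := by
      rwa [ContinuousLinearMap.spectrum_eq] at hμ
    obtain ⟨z, hz, rfl⟩ := exists_hasEigenvalue_of_exp T
      (Module.End.hasEigenvalue_iff_mem_spectrum.mpr hμ')
    rw [← NNReal.coe_lt_coe, coe_nnnorm, Complex.norm_exp]
    simpa using hT z hz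
  -- By Gelfand's formula, a spectral radius below one makes some power of `exp T` a strict
  -- contraction.
  have hlim := spectrum.pow_nnnorm_pow_one_div_tendsto_nhds_spectralRadius (NormedSpace.exp T)
  obtain ⟨n, hn, hn0⟩ := ((hlim.eventually_lt_const hrad).and (eventually_gt_atTop 0)).exists
  have hq : ‖NormedSpace.exp T ^ n‖ < 1 := by
    rw [← coe_nnnorm, ← NNReal.coe_one, NNReal.coe_lt_coe, ← ENNReal.coe_lt_coe]
    by_contra h
    rw [not_lt] at h
    exact absurd hn (not_lt.mpr (ENNReal.one_le_rpow (by simpa using h) (by positivity)))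
  have hn0' : (0 : ℝ) < n := Nat.cast_pos.mpr hn0
  -- The floor `1 / 2` keeps `q` positive, so that `log q` gives a finite decay rate.
  set q : ℝ := max ‖NormedSpace.exp T ^ n‖ (1 / 2) with hqdef
  have hq0 : 0 < q := lt_max_of_lt_right (by norm_num)
  have hq1 : q < 1 := max_lt hq (by norm_num)
  have hcont : Continuous fun t : ℝ => NormedSpace.exp (t • T) :=
    continuous_iff_continuousAt.mpr fun t => (hasDerivAt_exp_smul_const T t).continuousAt
  obtain ⟨M, hM⟩ := (isCompact_Icc (a := (0 : ℝ)) (b := n)).exists_bound_of_continuousOn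
    hcont.continuousOn
  have hM0 : 0 < M := by
    have := hM 0 ⟨le_rfl, hn0'.le⟩
    rw [zero_smul, NormedSpace.exp_zero, norm_one] at this
    linarith
  refine ⟨M * q⁻¹, -Real.log q / n, by positivity,
    div_pos (neg_pos.mpr (Real.log_neg hq0 hq1)) hn0', fun t ht => ?_⟩
  -- Time splits into `k` periods of length `n`, each contracting by `q`, and a remainder in `[0,
  -- n]` where the bound `M` applies; rounding down costs the factor `q⁻¹`.
  set k := ⌊t / n⌋₊ with hk
  have hk1 : (k : ℝ) * n ≤ t := by
    rw [← le_div_iff₀ hn0']; exact Nat.floor_le (by positivity)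
  have hk2 : t < (k + 1 : ℝ) * n := by
    rw [← div_lt_iff₀ hn0']; exact Nat.lt_floor_add_one _
  let _ : NormedAlgebra ℚ (E →L[ℂ] E) := NormedAlgebra.restrictScalars ℚ ℝ (E →L[ℂ] E)
  have hsplit : NormedSpace.exp (t • T) =
      (NormedSpace.exp T ^ n) ^ k * NormedSpace.exp ((t - k * n) • T) := by
    rw [← pow_mul, ← NormedSpace.exp_nsmul, ← NormedSpace.exp_add_of_commute]
    · congr 1
      rw [← Nat.cast_smul_eq_nsmul ℝ, ← add_smul]
      congr 1
      push_cast; ring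
    · exact ((Commute.refl T).smul_left _).smul_right _
  have hpow : ‖(NormedSpace.exp T ^ n) ^ k‖ ≤ q ^ k :=
    (norm_pow_le _ _).trans (pow_le_pow_left₀ (norm_nonneg _) (le_max_left _ _) _)
  have hexp : q ^ k ≤ q⁻¹ * Real.exp (-(-Real.log q / n * t)) := by
    have h1 : Real.exp (-(-Real.log q / n * t)) = Real.exp (Real.log q * (t / n)) := by
      congr 1; ring
    rw [h1, ← div_eq_inv_mul, le_div_iff₀ hq0, ← pow_succ, ← Real.exp_log (pow_pos hq0 _),
      Real.log_pow, Real.exp_le_exp]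
    have h2 : t / n ≤ ((k + 1 : ℕ) : ℝ) := by
      rw [div_le_iff₀ hn0']; push_cast; exact hk2.le
    nlinarith [Real.log_neg hq0 hq1]
  calc ‖NormedSpace.exp (t • T)‖ ≤ ‖(NormedSpace.exp T ^ n) ^ k‖ *
        ‖NormedSpace.exp ((t - k * n) • T)‖ := by rw [hsplit]; exact norm_mul_le _ _
    _ ≤ (q⁻¹ * Real.exp (-(-Real.log q / n * t))) * M := by
        refine mul_le_mul (hpow.trans hexp) (hM _ ⟨by linarith, by linarith⟩) (norm_nonneg _)
          (by positivity)
    _ = M * q⁻¹ * Real.exp (-(-Real.log q / n * t)) := by ring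

/-- The variation-of-constants estimate for `y' = κ T y + v`. -/
theorem norm_le_of_hasDerivWithinAt_linear {E : Type*} [NormedAddCommGroup E] [NormedSpace ℂ E]
    [FiniteDimensional ℂ E] {T : E →L[ℂ] E} {c lam : ℝ} (hc : 0 < c) (hlam : 0 < lam)
    (hT : ∀ t : ℝ, 0 ≤ t → ‖NormedSpace.exp (t • T)‖ ≤ c * Real.exp (-(lam * t)))
    {κ : ℝ} (hκ : 0 < κ) {y v : ℝ → E} {a b V : ℝ} (hab : a ≤ b)
    (hy : ContinuousOn y (Icc a b))
    (hy' : ∀ s ∈ Ico a b, HasDerivWithinAt y (κ • T (y s) + v s) (Ici s) s)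
    (hv : ∀ s ∈ Ico a b, ‖v s‖ ≤ V) (hV : 0 ≤ V) :
    ‖y b‖ ≤ c * Real.exp (-(lam * (κ * (b - a)))) * ‖y a‖ + c / lam / κ * V := by
  have : CompleteSpace E := FiniteDimensional.complete ℂ E
  -- With this integrating factor `U s (y s)` has derivative `U s (v s)`. Its norm is compared with
  -- an explicit primitive of the bound, so no integral of `v` is needed.
  set U : ℝ → E →L[ℂ] E := fun s => NormedSpace.exp ((κ * (b - s)) • T) with hU
  have hU' : ∀ s, HasDerivAt U (-(κ • (U s * T))) s := by
    intro s
    have h1 : HasDerivAt (fun s : ℝ => κ * (b - s)) (-κ) s := by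
      simpa using ((hasDerivAt_id s).const_sub b).const_mul κ
    have h2 := (hasDerivAt_exp_smul_const T (κ * (b - s))).scomp s h1
    simpa [hU, Function.comp_def, neg_smul] using h2
  have hUc : Continuous U := continuous_iff_continuousAt.mpr fun s => (hU' s).continuousAt
  have hf' : ∀ s ∈ Ico a b, HasDerivWithinAt (fun s => U s (y s)) (U s (v s)) (Ici s) s := by
    intro s hs
    have hB := ((ContinuousLinearMap.restrictScalarsL ℂ E E ℝ ℝ).hasFDerivAt.comp_hasDerivAt s
      (hU' s)).hasDerivWithinAt (s := Ici s)
    have h := hB.clm_apply (hy' s hs)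
    convert! h using 1
    simp
  have hB : ∀ s, HasDerivAt (fun s => c * Real.exp (-(lam * (κ * (b - a)))) * ‖y a‖ +
      c / lam / κ * V * (Real.exp (-(lam * (κ * (b - s)))) - Real.exp (-(lam * (κ * (b - a))))))
      (c * Real.exp (-(lam * (κ * (b - s)))) * V) s := by
    intro s
    have h1 : HasDerivAt (fun s : ℝ => -(lam * (κ * (b - s)))) (lam * κ) s := by
      have := ((((hasDerivAt_id s).const_sub b).const_mul κ).const_mul lam).neg
      convert! this using 1
      ring
    have h2 := ((h1.exp.sub_const (Real.exp (-(lam * (κ * (b - a)))))).const_mul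
      (c / lam / κ * V)).const_add (c * Real.exp (-(lam * (κ * (b - a)))) * ‖y a‖)
    convert! h2 using 1
    field_simp
  have key := image_norm_le_of_norm_deriv_right_le_deriv_boundary (f := fun s => U s (y s))
    (hUc.continuousOn.clm_apply hy) hf' (B := fun s => c * Real.exp (-(lam * (κ * (b - a)))) *
      ‖y a‖ + c / lam / κ * V * (Real.exp (-(lam * (κ * (b - s)))) -
        Real.exp (-(lam * (κ * (b - a)))))) (by
      simp only [sub_self, mul_zero, add_zero]
      refine (ContinuousLinearMap.le_opNorm _ _).trans ?_
      gcongr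
      exact hT _ (mul_nonneg hκ.le (sub_nonneg.mpr hab))) hB (by
      intro s hs
      refine (ContinuousLinearMap.le_opNorm _ _).trans ?_
      have := hT _ (mul_nonneg hκ.le (sub_nonneg.mpr hs.2.le))
      gcongr
      exact hv s hs) (right_mem_Icc.mpr hab)
  have hUb : U b = 1 := by simp [hU]
  simp only [hUb, one_apply_eq_self, sub_self, mul_zero, neg_zero, Real.exp_zero]
    at key
  refine key.trans ?_
  have h0 : 0 ≤ c / lam / κ * V := by positivity
  nlinarith [mul_nonneg h0 (Real.exp_pos (-(lam * (κ * (b - a))))).le]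

/-- A pair `(x, y)` stands for the complex vector `x + i y`; the hypothesis says that all complex
eigenvalues of `A` have negative real part. -/
theorem exists_linear_estimate {E : Type*} [NormedAddCommGroup E] [NormedSpace ℝ E]
    [FiniteDimensional ℝ E] (A : E →L[ℝ] E)
    (hA : ∀ (z : ℂ) (x y : E), A x = z.re • x - z.im • y → A y = z.im • x + z.re • y →
      (x ≠ 0 ∨ y ≠ 0) → z.re < 0) :
    ∃ c lam : ℝ, 0 < c ∧ 0 < lam ∧ ∀ κ : ℝ, 0 < κ → ∀ (y v : ℝ → E) (a b V : ℝ), a ≤ b →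
      ContinuousOn y (Icc a b) →
      (∀ s ∈ Ico a b, HasDerivWithinAt y (κ • A (y s) + v s) (Ici s) s) →
      (∀ s ∈ Ico a b, ‖v s‖ ≤ V) → 0 ≤ V →
      ‖y b‖ ≤ c * Real.exp (-(lam * (κ * (b - a)))) * ‖y a‖ + c / κ * V := by
  classical
  -- Complexification in coordinates: `J` embeds `E` into `ℂⁿ` and intertwines `A` with `T`. The
  -- real and imaginary parts of an eigenvector of `T` form a pair to which `hA` applies.
  let B := Module.finBasis ℝ E
  let n := Module.finrank ℝ E
  let M : Matrix (Fin n) (Fin n) ℝ := LinearMap.toMatrix B B (A : E →ₗ[ℝ] E)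
  let T : (Fin n → ℂ) →L[ℂ] (Fin n → ℂ) :=
    (Matrix.toLin' (M.map (algebraMap ℝ ℂ))).toContinuousLinearMap
  have hM : ∀ (x : E) i, ∑ j, M i j * B.repr x j = B.repr (A x) i := by
    intro x i
    have := congrFun (LinearMap.toMatrix_mulVec_repr B B (A : E →ₗ[ℝ] E) x) i
    simpa [Matrix.mulVec, dotProduct] using this
  have hrepr : ∀ (f : Fin n → ℝ) i, B.repr (B.equivFun.symm f) i = f i := fun f i =>
    congrFun (B.equivFun.apply_symm_apply f) i
  have hTapp : ∀ (v : Fin n → ℂ) i, T v i = ∑ j, (M i j : ℂ) * v j := by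
    intro v i
    simp [T, Matrix.mulVec, dotProduct]
  let J0 : E →ₗ[ℝ] (Fin n → ℂ) :=
    { toFun := fun x i => ((B.repr x i : ℝ) : ℂ)
      map_add' := fun x y => by ext i; simp
      map_smul' := fun r x => by ext i; simp }
  have hJ0inj : Function.Injective J0 := by
    intro x y hxy
    refine B.repr.injective (Finsupp.ext fun i => ?_)
    exact Complex.ofReal_injective (congrFun hxy i)
  let J : E →L[ℝ] (Fin n → ℂ) := LinearMap.toContinuousLinearMap J0
  have hJA : ∀ x, J (A x) = T (J x) := by
    intro x
    ext i
    rw [hTapp]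
    change ((B.repr (A x) i : ℝ) : ℂ) = ∑ j, (M i j : ℂ) * ((B.repr x j : ℝ) : ℂ)
    rw [← hM]
    push_cast
    rfl
  obtain ⟨k, hk, hkJ⟩ : ∃ k : ℝ, 0 < k ∧ ∀ x, ‖x‖ ≤ k * ‖J x‖ := by
    obtain ⟨K, hK, hKJ⟩ := LinearMap.exists_antilipschitzWith (J0) (LinearMap.ker_eq_bot.mpr hJ0inj)
    refine ⟨K, hK, fun x => ?_⟩
    have := hKJ.le_mul_dist x 0
    rwa [map_zero, dist_zero_right, dist_zero_right] at this
  have hT : ∀ z, Module.End.HasEigenvalue (T : (Fin n → ℂ) →ₗ[ℂ] (Fin n → ℂ)) z → z.re < 0 := by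
    intro z hz
    obtain ⟨v, hv⟩ := hz.exists_hasEigenvector
    have hTv : T v = z • v := hv.apply_eq_smul
    refine hA z (B.equivFun.symm fun i => (v i).re) (B.equivFun.symm fun i => (v i).im) ?_ ?_ ?_
    · refine B.repr.injective (Finsupp.ext fun i => ?_)
      rw [← hM]
      have := congrArg Complex.re (congrFun hTv i)
      rw [hTapp] at this
      simpa [hrepr, -Module.Basis.equivFun_symm_apply] using this
    · refine B.repr.injective (Finsupp.ext fun i => ?_)
      rw [← hM]
      have := congrArg Complex.im (congrFun hTv i)
      rw [hTapp] at this
      simpa [hrepr, -Module.Basis.equivFun_symm_apply, add_comm] using this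
    · by_contra! h
      refine hv.2 (funext fun i => Complex.ext ?_ ?_)
      · have := congrFun ((LinearEquiv.map_eq_zero_iff _).mp h.1) i
        simpa using this
      · have := congrFun ((LinearEquiv.map_eq_zero_iff _).mp h.2) i
        simpa using this
  obtain ⟨c, lam, hc, hlam, hdec⟩ := exists_norm_exp_le T hT
  -- One constant dominates both the transient factor `k c ‖J‖` and the gain factor `k c ‖J‖ / lam`.
  refine ⟨k * c * (‖J‖ + 1) * (1 + 1 / lam), lam, by positivity, hlam,
    fun κ hκ y v a b V hab hy hy' hv hV => ?_⟩
  have h := norm_le_of_hasDerivWithinAt_linear (y := fun s => J (y s)) (v := fun s => J (v s))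
    (V := ‖J‖ * V) hc hlam hdec hκ hab (J.continuous.comp_continuousOn hy)
    (fun s hs => by
      have := J.hasFDerivAt.comp_hasDerivWithinAt s (hy' s hs)
      rw [map_add, map_smul, hJA] at this
      exact this)
    (fun s hs => (J.le_opNorm _).trans (by gcongr; exact hv s hs)) (by positivity)
  have hya := J.le_opNorm (y a)
  set X := Real.exp (-(lam * (κ * (b - a)))) with hX
  have hX0 : 0 < X := Real.exp_pos _
  calc ‖y b‖ ≤ k * ‖J (y b)‖ := hkJ _
    _ ≤ k * (c * X * (‖J‖ * ‖y a‖) + c / lam / κ * (‖J‖ * V)) := by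
        refine mul_le_mul_of_nonneg_left (h.trans ?_) hk.le
        gcongr
    _ = (k * c * ‖J‖ * 1) * X * ‖y a‖ + (k * c * ‖J‖ * (1 / lam)) / κ * V := by
        field_simp
    _ ≤ _ := by
        gcongr
        all_goals first | linarith [norm_nonneg J] | (have : 0 < 1 / lam := by positivity); linarith

/-! ## Asymptotic gains and small-gain networks -/

/-- `y` is bounded by the supremum of `v` up to a vanishing transient, from every initial time. -/
def HasAsymptoticGain (y v : ℝ → ℝ) : Prop :=
  ∃ b : ℝ → ℝ → ℝ, (∀ t₀, 0 ≤ t₀ → Tendsto (b t₀) atTop (𝓝 0)) ∧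
    (∃ C, ∀ t, 0 ≤ t → b 0 t ≤ C) ∧
    ∀ t₀ t V, 0 ≤ t₀ → t₀ ≤ t → 0 ≤ V → (∀ s ∈ Ico t₀ t, v s ≤ V) → y t ≤ b t₀ t + V

theorem HasAsymptoticGain.mono {y v v' : ℝ → ℝ} (h : HasAsymptoticGain y v)
    (hv : ∀ t, 0 ≤ t → v t ≤ v' t) : HasAsymptoticGain y v' := by
  obtain ⟨b, h1, h2, h3⟩ := h
  exact ⟨b, h1, h2, fun t₀ t V h0 ht hV hs => h3 t₀ t V h0 ht hV fun s hs' =>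
    (hv s (h0.trans hs'.1)).trans (hs s hs')⟩

/-- The transient is the exponential scaled by the value of `y` at the initial time. A bound `V` on
the scaled input `k * v` is a bound `V / k` on `v`. -/
theorem HasAsymptoticGain.of_exp {y v : ℝ → ℝ} {c lam k : ℝ} (hlam : 0 < lam) (hk : 0 < k)
    (hc : 0 ≤ c) (hy : 0 ≤ y 0)
    (h : ∀ a b V, 0 ≤ a → a ≤ b → (∀ s ∈ Ico a b, v s ≤ V) → 0 ≤ V →
      y b ≤ c * Real.exp (-(lam * (b - a))) * y a + k * V) :
    HasAsymptoticGain y fun t => k * v t := by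
  refine ⟨fun a b => c * Real.exp (-(lam * (b - a))) * y a, fun a _ => ?_,
    ⟨c * y 0, fun t ht => ?_⟩, fun a b V ha hab hV hv => ?_⟩
  · have h1 : Tendsto (fun b : ℝ => lam * (b - a)) atTop atTop :=
      (tendsto_atTop_add_const_right _ (-a) tendsto_id).const_mul_atTop hlam
    have h2 := ((Real.tendsto_exp_neg_atTop_nhds_zero.comp h1).const_mul c).mul_const (y a)
    simpa using h2
  · have : Real.exp (-(lam * (t - 0))) ≤ 1 := by
      rw [Real.exp_le_one_iff, neg_nonpos]; positivity
    have h3 : c * Real.exp (-(lam * (t - 0))) ≤ c := mul_le_of_le_one_right hc this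
    exact mul_le_mul_of_nonneg_right h3 hy
  · have := h a b (V / k) ha hab (fun s hs => (le_div_iff₀' hk).mpr (hv s hs)) (by positivity)
    rwa [mul_div_cancel₀ _ hk.ne'] at this

/-- The upper limit at infinity of a real function, in `[0,∞]`. -/
noncomputable def upperLimit (f : ℝ → ℝ) : ℝ≥0∞ :=
  limsup (fun t : ℝ≥0 => ENNReal.ofReal (f t)) atTop

theorem upperLimit_ne_top {f : ℝ → ℝ} {B : ℝ} (hf : ∀ t, 0 ≤ t → f t ≤ B) : upperLimit f ≠ ⊤ := by
  refine ne_top_of_le_ne_top ENNReal.ofReal_ne_top (b := ENNReal.ofReal B) ?_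
  refine (limsup_le_limsup (v := fun _ => ENNReal.ofReal B) (.of_forall fun t => ?_)).trans ?_
  · exact ENNReal.ofReal_le_ofReal (hf t t.2)
  · simp

theorem exists_forall_le_upperLimit_add {f : ℝ → ℝ} {B : ℝ} (hf : ∀ t, 0 ≤ t → f t ≤ B) {δ : ℝ}
    (hδ : 0 < δ) : ∃ T, 0 ≤ T ∧ ∀ t, T ≤ t → f t ≤ (upperLimit f).toReal + δ := by
  have hlt : upperLimit f < ENNReal.ofReal ((upperLimit f).toReal + δ) := by
    rw [ENNReal.lt_ofReal_iff_toReal_lt (upperLimit_ne_top hf)]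
    linarith
  obtain ⟨T, hT⟩ := eventually_atTop.mp (eventually_lt_of_limsup_lt hlt)
  refine ⟨T, T.2, fun t ht => ?_⟩
  have h := hT ⟨t, T.2.trans ht⟩ ht
  exact ((ENNReal.ofReal_lt_ofReal_iff (by positivity)).mp h).le

theorem upperLimit_le {f : ℝ → ℝ} {L : ℝ} (hL : 0 ≤ L)
    (h : ∀ δ, 0 < δ → ∃ T, ∀ t, T ≤ t → f t ≤ L + δ) : upperLimit f ≤ ENNReal.ofReal L := by
  refine ENNReal.le_of_forall_pos_le_add fun δ hδ _ => ?_
  obtain ⟨T, hT⟩ := h δ hδ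
  rw [← ENNReal.ofReal_coe_nnreal, ← ENNReal.ofReal_add hL δ.coe_nonneg]
  refine (limsup_le_limsup (v := fun _ => ENNReal.ofReal (L + δ)) ?_).trans ?_
  · filter_upwards [eventually_ge_atTop T.toNNReal] with t ht
    exact ENNReal.ofReal_le_ofReal (hT t (Real.toNNReal_le_iff_le_coe.mp ht))
  · simp

/-- A network of asymptotic gains: if the static gain inequalities are solvable, then the network
is bounded and the static bound for the output holds for the upper limits. -/
theorem upperLimit_le_of_network {ι : Type*} [Fintype ι] {F : ι → ℝ → ℝ} {E : ℝ → ℝ}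
    {Γ : ι → ι → ℝ} {γ o : ι → ℝ} {K r B : ℝ}
    (hΓ : ∀ i j, 0 ≤ Γ i j) (hγ : ∀ i, 0 ≤ γ i) (ho : ∀ i, 0 ≤ o i) (hr : 0 ≤ r)
    (hF : ∀ i t, 0 ≤ F i t) (hFc : ∀ i, ContinuousOn (F i) (Ici 0))
    (hE0 : ∀ t, 0 ≤ E t) (hE : ∀ t, 0 ≤ t → E t ≤ B)
    (hgain : ∀ i, HasAsymptoticGain (F i) fun t => (∑ j, Γ i j * F j t) + γ i * E t)
    (hbdd : ∀ (a : ι → ℝ) (C ε : ℝ), (∀ i, 0 ≤ a i) → 0 ≤ C → 0 ≤ ε →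
      (∀ i, a i ≤ C + ((∑ j, Γ i j * a j) + γ i * ε)) → ∀ i, a i ≤ K * (C + ε))
    (hout : ∀ (a : ι → ℝ) (ε : ℝ), (∀ i, 0 ≤ a i) → 0 ≤ ε →
      (∀ i, a i ≤ (∑ j, Γ i j * a j) + γ i * ε) → ∑ j, o j * a j ≤ r * ε) :
    upperLimit (fun t => ∑ j, o j * F j t) ≤ ENNReal.ofReal r * upperLimit E := by
  choose b hb0 hbC hb using hgain
  choose C hC using hbC
  have hB : 0 ≤ B := (hE0 0).trans (hE 0 le_rfl)
  set C' := ∑ i, |C i| with hC'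
  have hCC' : ∀ i, C i ≤ C' := fun i =>
    (le_abs_self _).trans (Finset.single_le_sum (f := fun i => |C i|) (fun _ _ => abs_nonneg _)
      (Finset.mem_univ i))
  have hC'0 : 0 ≤ C' := Finset.sum_nonneg fun _ _ => abs_nonneg _
  -- Continuity makes the suprema over `[0, T]` finite. They satisfy the gain inequalities with the
  -- bounded transients from time zero as additive constant, so `hbdd` bounds them independently of
  -- `T`.
  have hbound : ∀ i t, 0 ≤ t → F i t ≤ K * (C' + B) := by
    intro i T hT
    have hcomp : ∀ i, BddAbove (F i '' Icc 0 T) := fun i =>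
      (isCompact_Icc.image_of_continuousOn ((hFc i).mono Icc_subset_Ici_self)).bddAbove
    have hle : ∀ i, ∀ s ∈ Icc 0 T, F i s ≤ sSup (F i '' Icc 0 T) := fun i s hs =>
      le_csSup (hcomp i) (mem_image_of_mem _ hs)
    have hnn : ∀ i, 0 ≤ sSup (F i '' Icc 0 T) := fun i =>
      (hF i 0).trans (hle i 0 ⟨le_rfl, hT⟩)
    refine (hle i T ⟨hT, le_rfl⟩).trans (hbdd (fun i => sSup (F i '' Icc 0 T)) C' B hnn hC'0 hB
      (fun i => ?_) i)
    refine csSup_le ((nonempty_Icc.mpr hT).image _) ?_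
    rintro _ ⟨t, ht, rfl⟩
    refine (hb i 0 t _ le_rfl ht.1 ?_ fun s hs => ?_).trans
      (add_le_add_left ((hC i t ht.1).trans (hCC' i)) _)
    · exact add_nonneg (Finset.sum_nonneg fun j _ => mul_nonneg (hΓ i j) (hnn j))
        (mul_nonneg (hγ i) hB)
    · refine add_le_add (Finset.sum_le_sum fun j _ => ?_) ?_
      · exact mul_le_mul_of_nonneg_left (hle j s ⟨hs.1, hs.2.le.trans ht.2⟩) (hΓ i j)
      · exact mul_le_mul_of_nonneg_left (hE s hs.1) (hγ i)
  set a : ι → ℝ := fun i => (upperLimit (F i)).toReal with ha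
  set ε := (upperLimit E).toReal with hε
  have ha0 : ∀ i, 0 ≤ a i := fun _ => ENNReal.toReal_nonneg
  have hε0 : 0 ≤ ε := ENNReal.toReal_nonneg
  have hev : ∀ δ, 0 < δ → ∃ T, 0 ≤ T ∧ ∀ t, T ≤ t → (∀ i, F i t ≤ a i + δ) ∧ E t ≤ ε + δ := by
    intro δ hδ
    obtain ⟨T₁, hT₁, h₁⟩ := exists_forall_le_upperLimit_add hE hδ
    choose T₂ hT₂ h₂ using fun i => exists_forall_le_upperLimit_add (hbound i) hδ
    refine ⟨T₁ + ∑ i, T₂ i, add_nonneg hT₁ (Finset.sum_nonneg fun i _ => hT₂ i), fun t ht =>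
      ⟨fun i => h₂ i t ?_, h₁ t ?_⟩⟩
    · have := Finset.single_le_sum (f := T₂) (fun i _ => hT₂ i) (Finset.mem_univ i)
      linarith
    · have := Finset.sum_nonneg fun i (_ : i ∈ Finset.univ) => hT₂ i
      linarith
  -- Restarting the gain estimate at a late time `T`, where all inputs are close to their upper
  -- limits, and letting the transient decay removes the additive constant.
  have hstatic : ∀ i, a i ≤ (∑ j, Γ i j * a j) + γ i * ε := by
    intro i
    have hV0 : 0 ≤ (∑ j, Γ i j * a j) + γ i * ε :=
      add_nonneg (Finset.sum_nonneg fun j _ => mul_nonneg (hΓ i j) (ha0 j)) (mul_nonneg (hγ i) hε0)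
    refine ENNReal.toReal_le_of_le_ofReal hV0 (upperLimit_le hV0 fun δ hδ => ?_)
    have hS : 0 < 2 * ((∑ j, Γ i j) + γ i + 1) := by
      have := Finset.sum_nonneg fun j (_ : j ∈ Finset.univ) => hΓ i j
      have := hγ i
      positivity
    -- The overshoots of the inputs add up to at most `δ / 2`; the other half is left to the
    -- transient.
    set δ' := δ / (2 * ((∑ j, Γ i j) + γ i + 1)) with hδ'
    have hδ'0 : 0 < δ' := by positivity
    obtain ⟨T, hT0, hT⟩ := hev δ' hδ'0
    obtain ⟨T', hT'⟩ := eventually_atTop.mp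
      ((hb0 i T hT0).eventually_le_const (show (0 : ℝ) < δ / 2 by positivity))
    refine ⟨max T T', fun t ht => ?_⟩
    have hVeq : (∑ j, Γ i j * (a j + δ')) + γ i * (ε + δ') =
        ((∑ j, Γ i j * a j) + γ i * ε) + ((∑ j, Γ i j) + γ i) * δ' := by
      simp only [mul_add, Finset.sum_add_distrib, add_mul, Finset.sum_mul]
      ring
    have hsmall : ((∑ j, Γ i j) + γ i) * δ' ≤ δ / 2 := by
      have : ((∑ j, Γ i j) + γ i + 1) * δ' = δ / 2 := by
        have h0 : (∑ j, Γ i j) + γ i + 1 ≠ 0 := by linarith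
        rw [hδ']; field_simp
      nlinarith
    have h1 := hb i T t ((∑ j, Γ i j * (a j + δ')) + γ i * (ε + δ')) hT0
      ((le_max_left _ _).trans ht)
      (add_nonneg (Finset.sum_nonneg fun j _ => mul_nonneg (hΓ i j) (by linarith [ha0 j]))
        (mul_nonneg (hγ i) (by linarith)))
      fun s hs => add_le_add
        (Finset.sum_le_sum fun j _ => mul_le_mul_of_nonneg_left ((hT s hs.1).1 j) (hΓ i j))
        (mul_le_mul_of_nonneg_left (hT s hs.1).2 (hγ i))
    have h2 := hT' t ((le_max_right _ _).trans ht)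
    linarith
  have hsum := hout a ε ha0 hε0 hstatic
  have hfin : ENNReal.ofReal r * upperLimit E = ENNReal.ofReal (r * ε) := by
    rw [ENNReal.ofReal_mul hr, hε, ENNReal.ofReal_toReal (upperLimit_ne_top hE)]
  rw [hfin]
  refine (upperLimit_le (L := ∑ j, o j * a j)
    (Finset.sum_nonneg fun j _ => mul_nonneg (ho j) (ha0 j)) fun δ hδ => ?_).trans
    (ENNReal.ofReal_le_ofReal hsum)
  have hS : 0 < (∑ j, o j) + 1 := by
    have := Finset.sum_nonneg fun j (_ : j ∈ Finset.univ) => ho j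
    positivity
  obtain ⟨T, -, hT⟩ := hev (δ / ((∑ j, o j) + 1)) (by positivity)
  refine ⟨T, fun t ht => ?_⟩
  calc ∑ j, o j * F j t ≤ ∑ j, o j * (a j + δ / ((∑ j, o j) + 1)) :=
        Finset.sum_le_sum fun j _ => mul_le_mul_of_nonneg_left ((hT t ht).1 j) (ho j)
    _ = (∑ j, o j * a j) + (∑ j, o j) * (δ / ((∑ j, o j) + 1)) := by
        simp only [mul_add, Finset.sum_add_distrib, Finset.sum_mul]
    _ ≤ _ := by
        have : ((∑ j, o j) + 1) * (δ / ((∑ j, o j) + 1)) = δ := by field_simp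
        have h0 : 0 < δ / ((∑ j, o j) + 1) := by positivity
        nlinarith

/-! ## The static gain inequalities -/

section StaticGains

variable {c ρ g κ ℓ B r G y s z x w p C E : ℝ}

/-- The loop of the identifier and the derivative observer. -/
theorem identifier_loop (hc : 1 ≤ c) (hρ : 2 * (c * (1 + c)) ≤ ρ) (hG : 0 ≤ G)
    (hy0 : 0 ≤ y) (hz0 : 0 ≤ z) (hC : 0 ≤ C) (hE : 0 ≤ E)
    (hy : y ≤ C + c * (E + ρ * (G * z) + ρ⁻¹ * (y + E + G * z + s)))
    (hs : s ≤ C + c * (y + E + G * z)) :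
    y ≤ 3 * C + 3 * c * E + 3 * c * ρ * (G * z) ∧
      s ≤ 4 * c * C + 4 * c ^ 2 * E + 4 * c ^ 2 * ρ * (G * z) := by
  have hρ0 : 0 < ρ := by nlinarith
  have hρ1 : 1 ≤ ρ := by nlinarith
  have hGz : 0 ≤ G * z := mul_nonneg hG hz0
  set v := G * z with hv
  -- The feedback of `y` onto itself, directly and through `s`, has gain `c (1 + c) / ρ`. The
  -- threshold on `ρ` allows half of `y` to be absorbed on the left.
  have hk : c * ρ⁻¹ * (1 + c) ≤ 1 / 2 := by
    have h : c * ρ⁻¹ * (1 + c) = c * (1 + c) / ρ := by field_simp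
    rw [h, div_le_iff₀ hρ0]; linarith
  have hk0 : 0 ≤ c * ρ⁻¹ := by positivity
  have hy1 : y ≤ 3 * C + 3 * c * E + 3 * c * ρ * v := by
    have h1 : y + E + v + s ≤ (1 + c) * (C + y + E + v) := by nlinarith
    have h2 : c * ρ⁻¹ * (y + E + v + s) ≤ 1 / 2 * (C + y + E + v) :=
      calc c * ρ⁻¹ * (y + E + v + s) ≤ c * ρ⁻¹ * ((1 + c) * (C + y + E + v)) :=
            mul_le_mul_of_nonneg_left h1 hk0
        _ = c * ρ⁻¹ * (1 + c) * (C + y + E + v) := by ring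
        _ ≤ _ := mul_le_mul_of_nonneg_right hk (by linarith)
    have h3 : y ≤ C + c * E + c * ρ * v + c * ρ⁻¹ * (y + E + v + s) := by
      refine hy.trans (le_of_eq (by ring))
    have h4 : v ≤ c * ρ * v := by
      have : 1 ≤ c * ρ := by nlinarith
      nlinarith
    nlinarith
  refine ⟨hy1, ?_⟩
  have h5 : c * y ≤ c * (3 * C + 3 * c * E + 3 * c * ρ * v) :=
    mul_le_mul_of_nonneg_left hy1 (by linarith)
  have h6 : c * E ≤ c ^ 2 * E := mul_le_mul_of_nonneg_right (by nlinarith) hE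
  have h7 : c * v ≤ c ^ 2 * ρ * v := mul_le_mul_of_nonneg_right (by nlinarith) hGz
  nlinarith

/-- The loop of the internal model. -/
theorem internal_model_loop (hc : 1 ≤ c) (hg0 : 0 < g) (hg : 10 * c ^ 3 * ρ ≤ g)
    (hr0 : 0 ≤ r) (hr1 : r ≤ 1) (hrG : r * G = g⁻¹)
    (hz0 : 0 ≤ z) (hC : 0 ≤ C) (hE : 0 ≤ E) (hρ : 1 ≤ ρ)
    (hs : s ≤ 4 * c * C + 4 * c ^ 2 * E + 4 * c ^ 2 * ρ * (G * z))
    (hG : 0 ≤ G)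
    (hz : z ≤ C + c * (x + r * (G * z + s + E))) :
    r * (G * z + s + E) ≤ 4 * c * C + 5 * c ^ 2 * (r * E) + z ∧
      z ≤ 10 * c ^ 2 * C + 2 * c * x + 10 * c ^ 3 * (r * E) := by
  have hGz : 0 ≤ G * z := mul_nonneg hG hz0
  have h1 : G * z + s + E ≤ 4 * c * C + 5 * c ^ 2 * E + 5 * c ^ 2 * ρ * (G * z) := by
    have h2 : G * z ≤ c ^ 2 * ρ * (G * z) := by
      have : 1 ≤ c ^ 2 * ρ := by nlinarith [mul_nonneg (sub_nonneg.mpr hc) (sub_nonneg.mpr hc)]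
      nlinarith
    have h3 : E ≤ c ^ 2 * E := le_mul_of_one_le_left hE (one_le_pow₀ hc)
    linarith
  -- The amplification `G` of the internal-model error meets the weight `r`, and only `1 / g`
  -- survives; this factor has to beat `ρ`.
  have h4 : r * (G * z) = g⁻¹ * z := by rw [← mul_assoc, hrG]
  have h5 : 5 * c ^ 3 * ρ * (g⁻¹ * z) ≤ z / 2 := by
    have : 5 * c ^ 3 * ρ * g⁻¹ ≤ 1 / 2 := by
      rw [← div_eq_mul_inv, div_le_iff₀ hg0]; linarith
    nlinarith
  have h6 : r * (G * z + s + E) ≤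
      4 * c * C + 5 * c ^ 2 * (r * E) + 5 * c ^ 2 * ρ * (g⁻¹ * z) := by
    calc r * (G * z + s + E) ≤
        r * (4 * c * C + 5 * c ^ 2 * E + 5 * c ^ 2 * ρ * (G * z)) :=
          mul_le_mul_of_nonneg_left h1 hr0
      _ = r * (4 * c * C) + 5 * c ^ 2 * (r * E) + 5 * c ^ 2 * ρ * (r * (G * z)) := by ring
      _ ≤ _ := by
        rw [h4]
        have : r * (4 * c * C) ≤ 1 * (4 * c * C) :=
          mul_le_mul_of_nonneg_right hr1 (by positivity)
        linarith
  have hgz : 0 ≤ g⁻¹ * z := by positivity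
  have hrE : 0 ≤ r * E := mul_nonneg hr0 hE
  constructor
  · have : 5 * c ^ 2 * ρ * (g⁻¹ * z) ≤ 5 * c ^ 3 * ρ * (g⁻¹ * z) := by
      refine mul_le_mul_of_nonneg_right ?_ hgz
      have : c ^ 2 ≤ c ^ 3 := pow_le_pow_right₀ hc (by norm_num)
      nlinarith
    linarith
  · have h7 : c * (r * (G * z + s + E)) ≤
        c * (4 * c * C + 5 * c ^ 2 * (r * E) + 5 * c ^ 2 * ρ * (g⁻¹ * z)) :=
      mul_le_mul_of_nonneg_left h6 (by linarith)
    have h8 : C ≤ c ^ 2 * C := le_mul_of_one_le_left hC (one_le_pow₀ hc)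
    nlinarith

/-- The loop of the chains of integrators. -/
theorem chain_loop (hc : 1 ≤ c) (hg0 : 0 < g) (hκ : 50 * c ^ 4 * g ≤ κ) (hκ' : 2 * c ≤ κ)
    (hr0 : 0 ≤ r) (hx0 : 0 ≤ x) (hw0 : 0 ≤ w) (hC : 0 ≤ C) (hE : 0 ≤ E)
    (hT : r * (G * z + s + E) ≤ 4 * c * C + 5 * c ^ 2 * (r * E) + z)
    (hz : z ≤ 10 * c ^ 2 * C + 2 * c * x + 10 * c ^ 3 * (r * E))
    (hx : x ≤ C + c * (κ⁻¹ * (w + g * (z + x) + g * (r * (G * z + s + E))))) :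
    x ≤ 3 * C + w + r * E ∧ z ≤ 16 * c ^ 2 * C + 2 * c * w + 12 * c ^ 3 * (r * E) := by
  have hκ0 : 0 < κ := by nlinarith
  have hrE : 0 ≤ r * E := mul_nonneg hr0 hE
  set e := r * E
  have hc2 : 1 ≤ c ^ 2 := one_le_pow₀ hc
  have hc3 : c ^ 2 ≤ c ^ 3 := pow_le_pow_right₀ hc (by norm_num)
  have hc1 : c ≤ c ^ 2 := by nlinarith
  have h1 : (z + x) + r * (G * z + s + E) ≤ 25 * c ^ 3 * (x + C + e) := by
    have a1 : x ≤ c ^ 3 * x := by nlinarith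
    have a2 : c * x ≤ c ^ 3 * x := mul_le_mul_of_nonneg_right (hc1.trans hc3) hx0
    have a3 : c ^ 2 * C ≤ c ^ 3 * C := mul_le_mul_of_nonneg_right hc3 hC
    have a4 : c * C ≤ c ^ 3 * C := mul_le_mul_of_nonneg_right (hc1.trans hc3) hC
    have a5 : c ^ 2 * e ≤ c ^ 3 * e := mul_le_mul_of_nonneg_right hc3 hrE
    have a6 : 0 ≤ c ^ 3 * x := by positivity
    nlinarith
  -- The chains are driven at rate `g` by the derivative of the first internal-model error, hence
  -- `κ` has to dominate `g`.
  have h2 : c * κ⁻¹ * g * (25 * c ^ 3) ≤ 1 / 2 := by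
    have : c * κ⁻¹ * g * (25 * c ^ 3) = 25 * c ^ 4 * g / κ := by field_simp
    rw [this, div_le_iff₀ hκ0]; linarith
  have h3 : c * κ⁻¹ ≤ 1 / 2 := by
    rw [← div_eq_mul_inv, div_le_iff₀ hκ0]; linarith
  have h4 : c * κ⁻¹ * g * ((z + x) + r * (G * z + s + E)) ≤ 1 / 2 * (x + C + e) :=
    calc c * κ⁻¹ * g * ((z + x) + r * (G * z + s + E))
        ≤ c * κ⁻¹ * g * (25 * c ^ 3 * (x + C + e)) :=
          mul_le_mul_of_nonneg_left h1 (by positivity)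
      _ = c * κ⁻¹ * g * (25 * c ^ 3) * (x + C + e) := by ring
      _ ≤ _ := mul_le_mul_of_nonneg_right h2 (by linarith)
  have h5 : c * κ⁻¹ * w ≤ 1 / 2 * w := mul_le_mul_of_nonneg_right h3 hw0
  have h6 : x ≤ C + c * κ⁻¹ * w + c * κ⁻¹ * g * ((z + x) + r * (G * z + s + E)) :=
    hx.trans (le_of_eq (by ring))
  have h7 : x ≤ 3 * C + w + e := by linarith
  refine ⟨h7, ?_⟩
  have h8 : c * x ≤ c * (3 * C + w + e) := mul_le_mul_of_nonneg_left h7 (by linarith)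
  have h9 : c * C ≤ c ^ 2 * C := mul_le_mul_of_nonneg_right hc1 hC
  have h10 : c * e ≤ c ^ 3 * e := mul_le_mul_of_nonneg_right (hc1.trans hc3) hrE
  nlinarith

/-- The loop of the stabiliser. -/
theorem stabiliser_loop (hc : 1 ≤ c) (hB : 1 ≤ B) (hρ0 : 0 ≤ ρ) (hρg : ρ ≤ g) (hG : 0 ≤ G)
    (hℓ0 : 0 < ℓ)
    (hℓ : 2 * (c * B * ((c * B + 1 + 4 * c ^ 2 * g * G) * (19 * c ^ 3) + 5 * c ^ 2)) ≤ r * ℓ)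
    (hr0 : 0 ≤ r) (hr1 : r ≤ 1)
    (hz0 : 0 ≤ z) (hx0 : 0 ≤ x) (hw0 : 0 ≤ w) (hC : 0 ≤ C) (hE : 0 ≤ E)
    (hx : x ≤ 3 * C + w + r * E)
    (hz : z ≤ 16 * c ^ 2 * C + 2 * c * w + 12 * c ^ 3 * (r * E))
    (hs : s ≤ 4 * c * C + 4 * c ^ 2 * E + 4 * c ^ 2 * ρ * (G * z))
    (hp : p ≤ C + c * B * (x + z + w))
    (hw : w ≤ C + c * (ℓ⁻¹ * B * (p + x + z + w + s + E))) :
    w ≤ 3 * C + r * E ∧ x + z ≤ 31 * c ^ 2 * C + 17 * c ^ 3 * (r * E) := by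
  have hc2 : 1 ≤ c ^ 2 := one_le_pow₀ hc
  have hc3 : c ^ 2 ≤ c ^ 3 := pow_le_pow_right₀ hc (by norm_num)
  have hc1 : c ≤ c ^ 2 := by nlinarith
  have hrE : 0 ≤ r * E := mul_nonneg hr0 hE
  have hrE1 : r * E ≤ E := by nlinarith
  set q := x + z + w with hq
  have hq0 : 0 ≤ q := by positivity
  have hqle : q ≤ 19 * c ^ 3 * (C + w + E) := by
    have a1 : c ^ 2 * C ≤ c ^ 3 * C := mul_le_mul_of_nonneg_right hc3 hC
    have a2 : C ≤ c ^ 3 * C := le_mul_of_one_le_left hC (hc2.trans hc3)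
    have a3 : w ≤ c ^ 3 * w := le_mul_of_one_le_left hw0 (hc2.trans hc3)
    have a4 : c * w ≤ c ^ 3 * w := mul_le_mul_of_nonneg_right (hc1.trans hc3) hw0
    have a5 : c ^ 3 * (r * E) ≤ c ^ 3 * E := mul_le_mul_of_nonneg_left hrE1 (by positivity)
    have a6 : E ≤ c ^ 3 * E := le_mul_of_one_le_left hE (hc2.trans hc3)
    have a7 : 0 ≤ c ^ 3 * E := by positivity
    have a8 : 0 ≤ c ^ 3 * w := by positivity
    nlinarith
  have hzq : z ≤ q := by linarith
  have hGz : 4 * c ^ 2 * ρ * (G * z) ≤ 4 * c ^ 2 * g * G * q := by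
    have : ρ * (G * z) ≤ g * (G * q) :=
      mul_le_mul hρg (mul_le_mul_of_nonneg_left hzq hG) (mul_nonneg hG hz0) (hρ0.trans hρg)
    nlinarith
  set M := (c * B + 1 + 4 * c ^ 2 * g * G) * (19 * c ^ 3) + 5 * c ^ 2 with hM
  have hg0 : 0 ≤ g := hρ0.trans hρg
  have hsum : p + x + z + w + s + E ≤ M * (C + w + E) := by
    have b1 : (c * B + 1 + 4 * c ^ 2 * g * G) * q ≤
        (c * B + 1 + 4 * c ^ 2 * g * G) * (19 * c ^ 3 * (C + w + E)) :=
      mul_le_mul_of_nonneg_left hqle (by positivity)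
    have b2 : C + 4 * c * C ≤ 5 * c ^ 2 * C := by
      have : c * C ≤ c ^ 2 * C := mul_le_mul_of_nonneg_right hc1 hC
      have : C ≤ c ^ 2 * C := le_mul_of_one_le_left hC hc2
      linarith
    have b3 : 4 * c ^ 2 * E + E ≤ 5 * c ^ 2 * E := by
      have : E ≤ c ^ 2 * E := le_mul_of_one_le_left hE hc2
      linarith
    have b4 : 0 ≤ 5 * c ^ 2 * w := by positivity
    have b5 : M * (C + w + E) = (c * B + 1 + 4 * c ^ 2 * g * G) * (19 * c ^ 3 * (C + w + E)) +
      (5 * c ^ 2 * C + 5 * c ^ 2 * w + 5 * c ^ 2 * E) := by rw [hM]; ring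
    have b6 : (c * B + 1 + 4 * c ^ 2 * g * G) * q = c * B * q + q + 4 * c ^ 2 * g * G * q := by
      ring
    linarith
  -- The gain is made at most `r / 2`, not merely `1 / 2`: the prediction error then reaches `w`
  -- with weight `r`, which preserves the factor `g⁻ᵈ` of the final bound.
  have hk : c * B * ℓ⁻¹ * M ≤ r / 2 := by
    have : c * B * ℓ⁻¹ * M = c * B * M / ℓ := by field_simp
    rw [this, div_le_iff₀ hℓ0]
    linarith
  have h1 : w ≤ C + r / 2 * (C + w + E) := by
    refine hw.trans (add_le_add_right ?_ _)
    calc c * (ℓ⁻¹ * B * (p + x + z + w + s + E)) ≤ c * (ℓ⁻¹ * B * (M * (C + w + E))) := by gcongr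
      _ = c * B * ℓ⁻¹ * M * (C + w + E) := by ring
      _ ≤ _ := mul_le_mul_of_nonneg_right hk (by positivity)
  have h2 : w ≤ 3 * C + r * E := by
    have b1 : r * C ≤ C := mul_le_of_le_one_left hC hr1
    have b2 : r * w ≤ w := mul_le_of_le_one_left hw0 hr1
    linarith
  refine ⟨h2, ?_⟩
  have h3 : c * w ≤ c * (3 * C + r * E) := mul_le_mul_of_nonneg_left h2 (by linarith)
  have a1 : C ≤ c ^ 2 * C := le_mul_of_one_le_left hC hc2
  have a2 : c * C ≤ c ^ 2 * C := mul_le_mul_of_nonneg_right hc1 hC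
  have a3 : r * E ≤ c ^ 3 * (r * E) := le_mul_of_one_le_left hrE (hc2.trans hc3)
  have a4 : c * (r * E) ≤ c ^ 3 * (r * E) := mul_le_mul_of_nonneg_right (hc1.trans hc3) hrE
  nlinarith

/-- The matrix of the gains between the components of the closed loop, in the order: derivative
observer, identifier, internal model, chains of integrators, stabiliser, zero dynamics. -/
noncomputable def loopGain (c ρ g κ ℓ B r G : ℝ) : Fin 6 → Fin 6 → ℝ :=
  ![![c * ρ⁻¹, c * ρ⁻¹, c * (ρ * G + ρ⁻¹ * G), 0, 0, 0],
    ![c, 0, c * G, 0, 0, 0],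
    ![0, c * r, c * (r * G), c, 0, 0],
    ![0, c * (κ⁻¹ * (g * r)), c * (κ⁻¹ * (g + g * (r * G))), c * (κ⁻¹ * g), c * κ⁻¹, 0],
    ![0, c * (ℓ⁻¹ * B), c * (ℓ⁻¹ * B), c * (ℓ⁻¹ * B), c * (ℓ⁻¹ * B), c * (ℓ⁻¹ * B)],
    ![0, 0, c * B, c * B, c * B, 0]]

/-- The gains from the prediction error. -/
noncomputable def inputGain (c ρ g κ ℓ B r : ℝ) : Fin 6 → ℝ :=
  ![c * (1 + ρ⁻¹), c, c * r, c * (κ⁻¹ * (g * r)), c * (ℓ⁻¹ * B), 0]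

theorem loopGain_nonneg (hc : 0 ≤ c) (hρ : 0 ≤ ρ) (hg : 0 ≤ g) (hκ : 0 ≤ κ) (hℓ : 0 ≤ ℓ)
    (hB : 0 ≤ B) (hr : 0 ≤ r) (hG : 0 ≤ G) (i j : Fin 6) : 0 ≤ loopGain c ρ g κ ℓ B r G i j := by
  fin_cases i <;> fin_cases j <;> simp [loopGain] <;> positivity

theorem inputGain_nonneg (hc : 0 ≤ c) (hρ : 0 ≤ ρ) (hg : 0 ≤ g) (hκ : 0 ≤ κ) (hℓ : 0 ≤ ℓ)
    (hB : 0 ≤ B) (hr : 0 ≤ r) (i : Fin 6) : 0 ≤ inputGain c ρ g κ ℓ B r i := by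
  fin_cases i <;> simp [inputGain] <;> positivity

/-- A crude common bound for all signals of the loop. -/
theorem static_bounds (hc : 1 ≤ c) (hρ : 1 ≤ ρ) (hB : 1 ≤ B) (hr1 : r ≤ 1) (hG : 1 ≤ G)
    (hx0 : 0 ≤ x) (hz0 : 0 ≤ z) (hC : 0 ≤ C) (hE : 0 ≤ E)
    (hy : y ≤ 3 * C + 3 * c * E + 3 * c * ρ * (G * z))
    (hs : s ≤ 4 * c * C + 4 * c ^ 2 * E + 4 * c ^ 2 * ρ * (G * z))
    (hxz : x + z ≤ 31 * c ^ 2 * C + 17 * c ^ 3 * (r * E))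
    (hw : w ≤ 3 * C + r * E) (hp : p ≤ C + c * B * (x + z + w)) {u : ℝ}
    (hu : u = y ∨ u = s ∨ u = z ∨ u = x ∨ u = w ∨ u = p) :
    u ≤ (200 * (c * B) * c ^ 5 * (ρ * G)) * (C + E) := by
  set S := C + E with hS
  have hCS : C ≤ S := by linarith
  have hES : E ≤ S := by linarith
  have hS0 : 0 ≤ S := by linarith
  have hrE : r * E ≤ S := (mul_le_of_le_one_left hE hr1).trans hES
  have hpow : ∀ n, n ≤ 5 → c ^ n ≤ c ^ 5 := fun n hn => pow_le_pow_right₀ hc hn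
  set D := c ^ 5 with hD
  have hD1 : 1 ≤ D := one_le_pow₀ hc
  have hρG : 1 ≤ ρ * G := one_le_mul_of_one_le_of_one_le hρ hG
  have hcB : 1 ≤ c * B := one_le_mul_of_one_le_of_one_le hc hB
  set A := ρ * G with hA
  have hxz' : x + z ≤ 48 * c ^ 3 * S := by
    have h1 : c ^ 2 * C ≤ c ^ 3 * S :=
      mul_le_mul (pow_le_pow_right₀ hc (by norm_num)) hCS hC (by positivity)
    have h2 : c ^ 3 * (r * E) ≤ c ^ 3 * S := mul_le_mul_of_nonneg_left hrE (by positivity)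
    linarith
  have hw' : w ≤ 4 * S := by linarith
  have hDS : S ≤ D * S := le_mul_of_one_le_left hS0 hD1
  have hAz : ρ * (G * z) ≤ A * (48 * c ^ 3 * S) := by
    rw [← mul_assoc]
    exact mul_le_mul_of_nonneg_left (by linarith) (by linarith)
  have hDA : D * S ≤ D * A * S :=
    mul_le_mul_of_nonneg_right (le_mul_of_one_le_right (by linarith) hρG) hS0
  have h3 : c ^ 3 * S ≤ D * S := mul_le_mul_of_nonneg_right (hpow 3 (by norm_num)) hS0
  -- Only the zero-dynamics error `p` needs the factor `c * B`; for the other signals it is inserted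
  -- for uniformity. The bound is only used for boundedness, so its size does not matter.
  have main : ∀ v : ℝ, v ≤ 200 * (D * A * S) → v ≤ 200 * (c * B) * D * A * S := by
    intro v hv
    refine hv.trans ?_
    have : 0 ≤ D * A * S := by positivity
    calc 200 * (D * A * S) ≤ (c * B) * (200 * (D * A * S)) :=
          le_mul_of_one_le_left (by positivity) hcB
      _ = _ := by ring
  have hDAS : 0 ≤ D * A * S := by positivity
  rcases hu with rfl | rfl | rfl | rfl | rfl | rfl
  · refine main _ ?_
    have h1 : c * (ρ * (G * z)) ≤ c * (A * (48 * c ^ 3 * S)) :=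
      mul_le_mul_of_nonneg_left hAz (by linarith)
    have h2 : c * (A * (48 * c ^ 3 * S)) ≤ 48 * (D * A * S) := by
      have : c ^ 4 * (A * S) ≤ D * (A * S) :=
        mul_le_mul_of_nonneg_right (hpow 4 (by norm_num)) (by positivity)
      calc c * (A * (48 * c ^ 3 * S)) = 48 * (c ^ 4 * (A * S)) := by ring
        _ ≤ 48 * (D * (A * S)) := by linarith
        _ = _ := by ring
    have h4 : c * E ≤ D * S :=
      mul_le_mul (by simpa using hpow 1 (by norm_num)) hES hE (by linarith)
    linarith
  · refine main _ ?_
    have h1 : c ^ 2 * (ρ * (G * z)) ≤ c ^ 2 * (A * (48 * c ^ 3 * S)) :=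
      mul_le_mul_of_nonneg_left hAz (by positivity)
    have h2 : c ^ 2 * (A * (48 * c ^ 3 * S)) = 48 * (D * A * S) := by rw [hD]; ring
    have h4 : c * C ≤ D * S :=
      mul_le_mul (by simpa using hpow 1 (by norm_num)) hCS hC (by linarith)
    have h5 : c ^ 2 * E ≤ D * S := mul_le_mul (hpow 2 (by norm_num)) hES hE (by linarith)
    linarith
  · exact main _ (by linarith)
  · exact main _ (by linarith)
  · exact main _ (by linarith)
  · have h1 : c * B * (x + z + w) ≤ c * B * (52 * (D * S)) :=
      mul_le_mul_of_nonneg_left (by linarith) (by linarith)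
    have h2 : C ≤ c * B * (D * S) := by
      have : D * S ≤ c * B * (D * S) := le_mul_of_one_le_left (by positivity) hcB
      linarith
    have h4 : c * B * (D * S) ≤ c * B * (D * A * S) :=
      mul_le_mul_of_nonneg_left hDA (by linarith)
    have h5 : 0 ≤ c * B * (D * A * S) := by positivity
    calc u ≤ 53 * (c * B * (D * S)) := by linarith
      _ ≤ 53 * (c * B * (D * A * S)) := by linarith
      _ ≤ 200 * (c * B * (D * A * S)) := by linarith
      _ = _ := by ring

/-- Solution of the static gain inequalities. -/
theorem static_gains (hc : 1 ≤ c) (hρ : 2 * (c * (1 + c)) ≤ ρ) (hg : 10 * c ^ 3 * ρ ≤ g)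
    (hκ : 50 * c ^ 4 * g ≤ κ) (hB : 1 ≤ B) (hr0 : 0 ≤ r) (hr1 : r ≤ 1) (hG : 1 ≤ G)
    (hrG : r * G = g⁻¹) (hℓ0 : 0 < ℓ)
    (hℓ : 2 * (c * B * ((c * B + 1 + 4 * c ^ 2 * g * G) * (19 * c ^ 3) + 5 * c ^ 2)) ≤ r * ℓ)
    (a : Fin 6 → ℝ) (ha : ∀ i, 0 ≤ a i) (hC : 0 ≤ C) (hE : 0 ≤ E)
    (h : ∀ i, a i ≤ C + ((∑ j, loopGain c ρ g κ ℓ B r G i j * a j) +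
      inputGain c ρ g κ ℓ B r i * E)) :
    a 2 + a 3 ≤ 31 * c ^ 2 * C + 17 * c ^ 3 * (r * E) ∧
      ∀ i, a i ≤ (200 * (c * B) * c ^ 5 * (ρ * G)) * (C + E) := by
  have hy := h 0
  have hs := h 1
  have hz := h 2
  have hx := h 3
  have hw := h 4
  have hp := h 5
  simp [loopGain, inputGain, Fin.sum_univ_succ] at hy hs hz hx hw hp
  have hy0 := ha 0
  have hs0 := ha 1
  have hz0 := ha 2
  have hx0 := ha 3
  have hw0 := ha 4
  have hp0 := ha 5
  have hρ1 : 1 ≤ ρ := by nlinarith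
  have hc3 : 1 ≤ c ^ 3 := one_le_pow₀ hc
  have hρg : ρ ≤ g := by nlinarith
  have hg0 : 0 < g := by linarith
  have hc4 : c ≤ c ^ 4 := le_self_pow₀ hc (by norm_num)
  have hκc : 2 * c ≤ κ := by nlinarith
  have hG0 : 0 ≤ G := by linarith
  -- The loops are closed from the inside outwards. Each step eliminates the feedback that its
  -- parameter controls and treats the signals of the outer loops as inputs.
  obtain ⟨y1, s1⟩ := identifier_loop hc hρ hG0 hy0 hz0 hC hE
    (hy.trans (le_of_eq (by ring))) (hs.trans (le_of_eq (by ring)))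
  obtain ⟨T1, z1⟩ := internal_model_loop (x := a 3) hc hg0 hg hr0 hr1 hrG hz0 hC hE hρ1 s1 hG0
    (hz.trans (le_of_eq (by ring)))
  obtain ⟨x1, z2⟩ := chain_loop hc hg0 hκ hκc hr0 hx0 hw0 hC hE T1 z1
    (hx.trans (le_of_eq (by ring)))
  obtain ⟨w1, xz⟩ := stabiliser_loop (x := a 3) hc hB (by linarith) hρg hG0 hℓ0 hℓ hr0 hr1
    hz0 hx0 hw0 hC hE x1 z2 s1 (hp.trans (le_of_eq (by ring))) (hw.trans (le_of_eq (by ring)))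
  refine ⟨by linarith, fun i => static_bounds hc hρ1 hB hr1 hG hx0 hz0 hC hE y1 s1 xz w1
    (hp.trans (le_of_eq (by ring))) ?_⟩
  fin_cases i <;> simp

end StaticGains

/-! ## High-gain linear systems in observer and in controller form -/

theorem OutReg.SolvesOn.continuousOn {V : Type*} [NormedAddCommGroup V] [NormedSpace ℝ V]
    {v F : ℝ → V}
    (h : SolvesOn v F) : ContinuousOn v (Ici 0) :=
  fun t ht => (h t ht).continuousWithinAt

theorem OutReg.SolvesOn.congr {V : Type*} [NormedAddCommGroup V] [NormedSpace ℝ V] {v F F' : ℝ → V}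
    (h : SolvesOn v F) (hF : ∀ t, 0 ≤ t → F t = F' t) : SolvesOn v F' :=
  fun t ht => hF t ht ▸ h t ht

/-- Multiplying the generator by `κ` only speeds up time: the decay rate becomes `lam * κ` and the
gain `k / κ`, with `k` determined by `A` alone. -/
theorem exists_asymptoticGain_linear {E : Type*} [NormedAddCommGroup E] [NormedSpace ℝ E]
    [FiniteDimensional ℝ E] (A : E →L[ℝ] E)
    (hA : ∀ (z : ℂ) (x y : E), A x = z.re • x - z.im • y → A y = z.im • x + z.re • y →
      (x ≠ 0 ∨ y ≠ 0) → z.re < 0) :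
    ∃ k : ℝ, 0 < k ∧ ∀ κ : ℝ, 0 < κ → ∀ y v : ℝ → E, SolvesOn y (fun t => κ • A (y t) + v t) →
      HasAsymptoticGain (fun t => ‖y t‖) fun t => k / κ * ‖v t‖ := by
  obtain ⟨c, lam, hc, hlam, h⟩ := exists_linear_estimate A hA
  refine ⟨c, hc, fun κ hκ y v hy => ?_⟩
  refine HasAsymptoticGain.of_exp (lam := lam * κ) (c := c) (by positivity) (by positivity) hc.le
    (norm_nonneg _) fun a b V ha hab hv hV => ?_
  have := h κ hκ y v a b V hab
    (hy.continuousOn.mono fun s hs => ha.trans hs.1)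
    (fun s hs => (hy s (ha.trans hs.1)).mono fun r hr => (ha.trans hs.1).trans hr) hv hV
  simpa only [mul_assoc] using this

/-- The operator `z ↦ (z_{i+1} - h_i z_1)_i`. -/
noncomputable def observerOp {n : ℕ} (ne : ℕ) (hn : 0 < n) (h : Fin n → ℝ) :
    Stack n ne →L[ℝ] Stack n ne :=
  LinearMap.toContinuousLinearMap
    { toFun := fun z i => (if hi : (i : ℕ) + 1 < n then z ⟨i + 1, hi⟩ else 0) - h i • z ⟨0, hn⟩
      map_add' := fun x y => by
        funext i
        by_cases hi : (i : ℕ) + 1 < n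
        · simp only [Pi.add_apply, hi, dif_pos, smul_add]; abel
        · simp only [Pi.add_apply, hi, dif_neg, not_false_eq_true, smul_add]; abel
      map_smul' := fun r x => by
        funext i
        by_cases hi : (i : ℕ) + 1 < n
        · simp only [Pi.smul_apply, hi, dif_pos, smul_sub, RingHom.id_apply, smul_comm r]
        · simp only [Pi.smul_apply, hi, dif_neg, not_false_eq_true, smul_sub, RingHom.id_apply,
            smul_comm r, smul_zero] }

theorem observerOp_apply {n ne : ℕ} (hn : 0 < n) (h : Fin n → ℝ) (z : Stack n ne) (i : Fin n) :
    observerOp ne hn h z i =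
      (if hi : (i : ℕ) + 1 < n then z ⟨i + 1, hi⟩ else 0) - h i • z ⟨0, hn⟩ := rfl

/-- The recursion is Horner's scheme: `V j` is `V 0` times a truncated characteristic polynomial at
`z`. At `j = n` the whole polynomial appears, so either it vanishes at `z` or `V 0`, and with it
every entry, vanishes. -/
theorem observer_root {n : ℕ} {h : Fin n → ℝ} {z : ℂ} {V : ℕ → ℂ}
    (hrec : ∀ i (hi : i < n), V (i + 1) = z * V i + h ⟨i, hi⟩ * V 0) (hVn : V n = 0) :
    Polynomial.aeval z (Polynomial.X ^ n + ∑ i : Fin n, Polynomial.C (h i) *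
      Polynomial.X ^ (n - 1 - (i : ℕ)) : Polynomial ℝ) = 0 ∨ ∀ i ≤ n, V i = 0 := by
  set h' : ℕ → ℂ := fun i => if hi : i < n then (h ⟨i, hi⟩ : ℂ) else 0 with hh'
  have hV : ∀ j ≤ n, V j = (z ^ j + ∑ i ∈ Finset.range j, h' i * z ^ (j - 1 - i)) * V 0 := by
    intro j
    induction j with
    | zero => simp
    | succ j ih =>
      intro hj
      have hj' : j < n := hj
      rw [hrec j hj', ih hj'.le, Finset.sum_range_succ]
      have h1 : h' j = h ⟨j, hj'⟩ := by simp [hh', hj']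
      have h2 : ∑ i ∈ Finset.range j, h' i * z ^ (j + 1 - 1 - i) =
          z * ∑ i ∈ Finset.range j, h' i * z ^ (j - 1 - i) := by
        rw [Finset.mul_sum]
        refine Finset.sum_congr rfl fun i hi => ?_
        have : j + 1 - 1 - i = (j - 1 - i) + 1 := by
          have := Finset.mem_range.mp hi
          omega
        rw [this, pow_succ]; ring
      rw [h2, h1]
      simp only [add_tsub_cancel_right, tsub_self, pow_zero, mul_one]
      ring
  have hp : Polynomial.aeval z (Polynomial.X ^ n + ∑ i : Fin n, Polynomial.C (h i) *
      Polynomial.X ^ (n - 1 - (i : ℕ)) : Polynomial ℝ) =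
      z ^ n + ∑ i ∈ Finset.range n, h' i * z ^ (n - 1 - i) := by
    rw [← Fin.sum_univ_eq_sum_range (fun i => h' i * z ^ (n - 1 - i))]
    simp [hh']
  have h0 := hV n le_rfl
  rw [hVn, ← hp] at h0
  rcases mul_eq_zero.mp h0.symm with h1 | h1
  · exact Or.inl h1
  · exact Or.inr fun i hi => by rw [hV i hi, h1, mul_zero]

theorem exists_asymptoticGain_observer {n : ℕ} (ne : ℕ) (hn : 0 < n) (h : Fin n → ℝ)
    (hh : IsHurwitz (Polynomial.X ^ n +
      ∑ i : Fin n, Polynomial.C (h i) * Polynomial.X ^ (n - 1 - (i : ℕ)))) :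
    ∃ k : ℝ, 0 < k ∧ ∀ g : ℝ, 0 < g → ∀ y v : ℝ → Stack n ne,
      SolvesOn y (fun t => g • observerOp ne hn h (y t) + v t) →
      HasAsymptoticGain (fun t => ‖y t‖) fun t => k / g * ‖v t‖ := by
  refine exists_asymptoticGain_linear _ fun z x y hx hy hxy => ?_
  by_contra hz
  have hcomp : ∀ (i : Fin n) (k : Fin ne), x i k = 0 ∧ y i k = 0 := by
    intro i k
    -- The operator acts separately on each component `k`. The value `0` at index `n` stands for the
    -- missing successor in the last row.
    set V : ℕ → ℂ := fun j => if hj : j < n then ⟨x ⟨j, hj⟩ k, y ⟨j, hj⟩ k⟩ else 0 with hV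
    have hrec : ∀ j (hj : j < n), V (j + 1) = z * V j + h ⟨j, hj⟩ * V 0 := by
      intro j hj
      have e1 := congrArg (fun u : Vec ne => u k) (congrFun hx ⟨j, hj⟩)
      have e2 := congrArg (fun u : Vec ne => u k) (congrFun hy ⟨j, hj⟩)
      rw [observerOp_apply] at e1 e2
      by_cases hj1 : j + 1 < n
      · simp only [hj1, dif_pos, PiLp.sub_apply, PiLp.smul_apply, smul_eq_mul, Pi.sub_apply,
          Pi.smul_apply, Pi.add_apply, PiLp.add_apply] at e1 e2
        apply Complex.ext
        · simp [hV, hj, hj1, hn]; linarith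
        · simp [hV, hj, hj1, hn]; linarith
      · simp only [hj1, dif_neg, not_false_eq_true, PiLp.sub_apply, PiLp.smul_apply, smul_eq_mul,
          Pi.sub_apply, Pi.smul_apply, Pi.add_apply, PiLp.add_apply, PiLp.zero_apply] at e1 e2
        apply Complex.ext
        · simp [hV, hj, hj1, hn]; linarith
        · simp [hV, hj, hj1, hn]; linarith
    rcases observer_root hrec (by simp [hV]) with h0 | h0
    · exact absurd (hh z h0) hz
    · have := h0 i i.2.le
      simp only [hV, i.2, dif_pos] at this
      exact ⟨congrArg Complex.re this, congrArg Complex.im this⟩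
  rcases hxy with h0 | h0
  · exact h0 (by ext i k; exact (hcomp i k).1)
  · exact h0 (by ext i k; exact (hcomp i k).2)

/-- The operator of the closed chains of integrators,
`X ↦ (X_2ⁱ, …, X_nⁱ, -∑ⱼ a_jⁱ X_jⁱ)ᵢ`. -/
noncomputable def chainOp {ne : ℕ} (nχ : Fin ne → ℕ) (a : ∀ i, Fin (nχ i) → ℝ) :
    ChainVec nχ →L[ℝ] ChainVec nχ :=
  LinearMap.toContinuousLinearMap
    { toFun := fun X => WithLp.toLp 2 fun p => if hp : (p.2 : ℕ) + 1 < nχ p.1 then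
        X ⟨p.1, ⟨p.2 + 1, hp⟩⟩ else -∑ j, a p.1 j * X ⟨p.1, j⟩
      map_add' := fun x y => by
        ext p
        by_cases hp : (p.2 : ℕ) + 1 < nχ p.1
        · simp [hp]
        · simp [hp, mul_add, Finset.sum_add_distrib]; ring
      map_smul' := fun r x => by
        ext p
        by_cases hp : (p.2 : ℕ) + 1 < nχ p.1
        · simp [hp]
        · simp [hp, Finset.mul_sum, mul_left_comm] }

theorem chainOp_apply {ne : ℕ} (nχ : Fin ne → ℕ) (a : ∀ i, Fin (nχ i) → ℝ) (X : ChainVec nχ)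
    (p : Σ i, Fin (nχ i)) : chainOp nχ a X p = if hp : (p.2 : ℕ) + 1 < nχ p.1 then
        X ⟨p.1, ⟨p.2 + 1, hp⟩⟩ else -∑ j, a p.1 j * X ⟨p.1, j⟩ := rfl

/-- An eigenvector of a companion matrix is geometric, `V j = z ^ j * V 0`; its last row is then the
characteristic equation multiplied by `V 0`. -/
theorem controller_root {n : ℕ} {a : Fin n → ℝ} {z : ℂ} {V : Fin n → ℂ}
    (hrec : ∀ (i : Fin n), z * V i = if hi : (i : ℕ) + 1 < n then V ⟨i + 1, hi⟩ else
      -∑ j, a j * V j) :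
    Polynomial.aeval z (Polynomial.X ^ n + ∑ j : Fin n, Polynomial.C (a j) *
      Polynomial.X ^ (j : ℕ) : Polynomial ℝ) = 0 ∨ ∀ i, V i = 0 := by
  rcases Nat.eq_zero_or_pos n with rfl | hn
  · exact Or.inr fun i => i.elim0
  have hV : ∀ j (hj : j < n), V ⟨j, hj⟩ = z ^ j * V ⟨0, hn⟩ := by
    intro j
    induction j with
    | zero => simp
    | succ j ih =>
      intro hj
      have := hrec ⟨j, by omega⟩
      rw [dif_pos hj, ih] at this
      rw [← this, pow_succ']; ring
  have hlast := hrec ⟨n - 1, by omega⟩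
  rw [dif_neg (show ¬ (n - 1 + 1 < n) by omega), hV] at hlast
  have hsum : ∑ j, (a j : ℂ) * V j = (∑ j, (a j : ℂ) * z ^ (j : ℕ)) * V ⟨0, hn⟩ := by
    rw [Finset.sum_mul]
    refine Finset.sum_congr rfl fun j _ => ?_
    rw [mul_assoc, ← hV j j.2]
  have hzn : z * (z ^ (n - 1) * V ⟨0, hn⟩) = z ^ n * V ⟨0, hn⟩ := by
    rw [← mul_assoc, ← pow_succ', Nat.sub_add_cancel hn]
  rw [hsum, hzn] at hlast
  have h0 : (z ^ n + ∑ j, (a j : ℂ) * z ^ (j : ℕ)) * V ⟨0, hn⟩ = 0 := by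
    rw [add_mul, hlast]; ring
  rcases mul_eq_zero.mp h0 with h1 | h1
  · left
    simpa using h1
  · exact Or.inr fun i => by rw [show i = ⟨i, i.2⟩ from rfl, hV i i.2, h1, mul_zero]

theorem exists_asymptoticGain_chain {ne : ℕ} (nχ : Fin ne → ℕ) (a : ∀ i, Fin (nχ i) → ℝ)
    (ha : ∀ i, IsHurwitz (Polynomial.X ^ nχ i +
      ∑ j : Fin (nχ i), Polynomial.C (a i j) * Polynomial.X ^ (j : ℕ))) :
    ∃ k : ℝ, 0 < k ∧ ∀ κ : ℝ, 0 < κ → ∀ y v : ℝ → ChainVec nχ,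
      SolvesOn y (fun t => κ • chainOp nχ a (y t) + v t) →
      HasAsymptoticGain (fun t => ‖y t‖) fun t => k / κ * ‖v t‖ := by
  refine exists_asymptoticGain_linear _ fun z x y hx hy hxy => ?_
  by_contra hz
  have hcomp : ∀ p : Σ i, Fin (nχ i), x p = 0 ∧ y p = 0 := by
    rintro ⟨i, j⟩
    have hrec : ∀ j : Fin (nχ i), z * (⟨x ⟨i, j⟩, y ⟨i, j⟩⟩ : ℂ) =
        if hj : (j : ℕ) + 1 < nχ i then (⟨x ⟨i, ⟨j + 1, hj⟩⟩, y ⟨i, ⟨j + 1, hj⟩⟩⟩ : ℂ) else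
          -∑ j, a i j * (⟨x ⟨i, j⟩, y ⟨i, j⟩⟩ : ℂ) := by
      intro j
      have e1 := congrArg (fun u : ChainVec nχ => u ⟨i, j⟩) hx
      have e2 := congrArg (fun u : ChainVec nχ => u ⟨i, j⟩) hy
      simp only [chainOp_apply, PiLp.sub_apply, PiLp.smul_apply, PiLp.add_apply, smul_eq_mul]
        at e1 e2
      by_cases hj : (j : ℕ) + 1 < nχ i
      · rw [dif_pos hj] at e1 e2 ⊢
        apply Complex.ext
        · simp; linarith
        · simp; linarith
      · rw [dif_neg hj] at e1 e2 ⊢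
        apply Complex.ext
        · simp; linarith
        · simp; linarith
    rcases controller_root hrec with h0 | h0
    · exact absurd (ha i z h0) hz
    · exact ⟨congrArg Complex.re (h0 j), congrArg Complex.im (h0 j)⟩
  rcases hxy with h0 | h0
  · exact h0 (by ext p; exact (hcomp p).1)
  · exact h0 (by ext p; exact (hcomp p).2)

/-- A monic quadratic polynomial with positive coefficients is Hurwitz. -/
theorem isHurwitz_quadratic {m1 m2 : ℝ} (h1 : 0 < m1) (h2 : 0 < m2) :
    IsHurwitz (Polynomial.X ^ 2 + ∑ i : Fin 2, Polynomial.C ((![m1, m2] : Fin 2 → ℝ) i) *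
      Polynomial.X ^ (2 - 1 - (i : ℕ))) := by
  intro z hz
  simp [Fin.sum_univ_succ] at hz
  have hre := congrArg Complex.re hz
  have him := congrArg Complex.im hz
  simp [pow_two] at hre him
  by_contra hneg
  push Not at hneg
  -- The imaginary part of the equation: a root is real, which positive coefficients exclude on
  -- `[0,∞)`, or has real part `-m1 / 2`.
  have h3 : z.im * (2 * z.re + m1) = 0 := by linarith
  rcases mul_eq_zero.mp h3 with h4 | h4
  · rw [h4] at hre
    nlinarith [mul_nonneg h1.le hneg]
  · linarith

/-! ## Carathéodory solutions -/

section Caratheodory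

variable {V : Type*} [NormedAddCommGroup V] [NormedSpace ℝ V]

theorem OutReg.SolvesOn.isCaraSol [CompleteSpace V] {F : ℝ → V → V} {z : ℝ → V}
    (h : SolvesOn z fun t => F t (z t)) (hc : ContinuousOn (fun t => F t (z t)) (Ici 0)) :
    IsCaraSol F (Ici 0) z := by
  intro t ht
  have hint : IntervalIntegrable (fun s => F s (z s)) volume 0 t :=
    (hc.mono (by rw [uIcc_of_le ht]; exact Icc_subset_Ici_self)).intervalIntegrable
  refine ⟨hint, ?_⟩
  rw [intervalIntegral.integral_eq_sub_of_hasDeriv_right (f := z)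
    (h.continuousOn.mono (by rw [uIcc_of_le ht]; exact Icc_subset_Ici_self)) (fun s hs => ?_) hint]
  · abel
  · rw [min_eq_left ht] at hs
    exact (h s hs.1.le).mono fun r hr => hs.1.le.trans (le_of_lt hr)

theorem OutReg.IsCaraSol.continuousOn {F : ℝ → V → V} {z : ℝ → V} (h : IsCaraSol F (Ici 0) z) :
    ContinuousOn z (Ici 0) := by
  have hT : ∀ T, 0 ≤ T → ContinuousOn z (Icc 0 T) := by
    intro T hT
    have hint : IntegrableOn (fun s => F s (z s)) (uIcc 0 T) volume := by
      rw [uIcc_of_le hT, integrableOn_Icc_iff_integrableOn_Ioc]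
      exact (intervalIntegrable_iff_integrableOn_Ioc_of_le hT).mp (h T hT).1
    have := intervalIntegral.continuousOn_primitive_interval hint
    rw [uIcc_of_le hT] at this
    exact (continuousOn_const.add this).congr fun t ht => (h t ht.1).2
  intro t ht
  have h1 : ContinuousWithinAt z (Icc 0 (t + 1)) t :=
    hT (t + 1) (by linarith [mem_Ici.mp ht]) t ⟨ht, by linarith⟩
  refine h1.mono_of_mem_nhdsWithin ?_
  rw [← Ici_inter_Iic]
  exact inter_mem self_mem_nhdsWithin (mem_nhdsWithin_of_mem_nhds (Iic_mem_nhds (by linarith)))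

theorem OutReg.IsCaraSol.solvesOn [CompleteSpace V] {F : ℝ → V → V} {z : ℝ → V}
    (h : IsCaraSol F (Ici 0) z)
    (hc : ContinuousOn (fun t => F t (z t)) (Ici 0)) : SolvesOn z fun t => F t (z t) := by
  -- Freezing the integrand at its value at `0` for negative times makes it continuous on the whole
  -- line, and the fundamental theorem of calculus applies also at the endpoint.
  have hmax : Continuous fun s : ℝ => max s 0 := continuous_id.max continuous_const
  have hG : Continuous fun s : ℝ => F (max s 0) (z (max s 0)) :=
    hc.comp_continuous hmax fun s => mem_Ici.mpr (le_max_right _ _)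
  intro t ht
  have h1 := (intervalIntegral.integral_hasDerivAt_right (hG.intervalIntegrable 0 t)
    (hG.stronglyMeasurableAtFilter _ _) hG.continuousAt).const_add (z 0)
  simp only [max_eq_left ht] at h1
  refine h1.hasDerivWithinAt.congr_of_mem (fun s hs => ?_) ht
  rw [(h s hs).2]
  congr 1
  refine intervalIntegral.integral_congr fun r hr => ?_
  rw [uIcc_of_le hs] at hr
  simp only [max_eq_left hr.1]

/-- Local existence for `z' = φ(z, q(t))`. -/
theorem exists_isCaraSol_Ico [CompleteSpace V] {W : Type*} [NormedAddCommGroup W] {φ : V × W → V}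
    (hφ : LocallyLipschitz φ) {q : ℝ → W} (hq : Continuous q) (z₀ : V) :
    ∃ (T : ℝ) (z : ℝ → V), 0 < T ∧ z 0 = z₀ ∧ IsCaraSol (fun t z => φ (z, q t)) (Ico 0 T) z := by
  obtain ⟨K, s, hs, hK⟩ := hφ (z₀, q 0)
  obtain ⟨r, hr, hrs⟩ := Metric.mem_nhds_iff.mp hs
  have hsub : ∀ z ∈ Metric.closedBall z₀ (r / 2), ∀ w ∈ Metric.closedBall (q 0) (r / 2),
      (z, w) ∈ s := fun z hz w hw => hrs (by
    rw [Metric.mem_ball, Prod.dist_eq]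
    exact max_lt (lt_of_le_of_lt hz (half_lt_self hr)) (lt_of_le_of_lt hw (half_lt_self hr)))
  have hev : ∀ᶠ t in 𝓝 (0 : ℝ), q t ∈ Metric.closedBall (q 0) (r / 2) :=
    hq.continuousAt (Metric.closedBall_mem_nhds _ (by positivity))
  obtain ⟨T₁, hT₁, hT₁q⟩ := Metric.eventually_nhds_iff.mp hev
  -- A bound for `φ` on the product of the two balls of radius `r / 2`.
  set L : ℝ≥0 := ‖φ (z₀, q 0)‖₊ + K * (r / 2).toNNReal with hL
  have hrr : ((r / 2).toNNReal : ℝ) = r / 2 := Real.coe_toNNReal _ (by positivity)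
  -- The first entry keeps `q` in its ball; the second keeps solutions of speed at most `L` in
  -- theirs.
  set T : ℝ := min (T₁ / 2) (r / 2 / (L + 1)) with hTdef
  have hT0 : 0 < T := lt_min (by positivity) (by positivity)
  have hqT : ∀ t ∈ Icc 0 T, q t ∈ Metric.closedBall (q 0) (r / 2) := fun t ht => hT₁q (by
    rw [Real.dist_eq, sub_zero, abs_of_nonneg ht.1]
    have := ht.2.trans (min_le_left _ _)
    linarith)
  have hPL : IsPicardLindelof (fun t z => φ (z, q t)) (tmin := 0) (tmax := T)
      ⟨0, le_rfl, hT0.le⟩ z₀ (r / 2).toNNReal 0 L K := by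
    refine ⟨fun t ht x hx y hy => ?_, fun x _ => ?_, fun t ht x hx => ?_, ?_⟩
    · rw [hrr] at hx hy
      have := hK (hsub x hx _ (hqT t ht)) (hsub y hy _ (hqT t ht))
      simpa [Prod.edist_eq] using this
    · exact (hφ.continuous.comp (continuous_const.prodMk hq)).continuousOn
    · rw [hrr] at hx
      have h1 := hK.dist_le_mul _ (hsub x hx _ (hqT t ht)) _ (mem_of_mem_nhds hs)
      have h2 : dist (x, q t) (z₀, q 0) ≤ r / 2 := by
        rw [Prod.dist_eq]; exact max_le hx (hqT t ht)
      have h3 : ‖φ (x, q t)‖ ≤ ‖φ (z₀, q 0)‖ + dist (φ (x, q t)) (φ (z₀, q 0)) := by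
        rw [dist_eq_norm]
        have := norm_add_le (φ (z₀, q 0)) (φ (x, q t) - φ (z₀, q 0))
        simpa using this
      rw [hL, NNReal.coe_add, NNReal.coe_mul, hrr, coe_nnnorm]
      have h4 : (K : ℝ) * dist (x, q t) (z₀, q 0) ≤ K * (r / 2) := by gcongr
      linarith
    · simp only [sub_zero, sub_self, NNReal.coe_zero, hrr]
      rw [max_eq_left hT0.le]
      have h1 : T ≤ r / 2 / (L + 1) := min_le_right _ _
      have h2 : (L : ℝ) * T ≤ L * (r / 2 / (L + 1)) := by gcongr
      have h3 : (L : ℝ) * (r / 2 / (L + 1)) ≤ r / 2 := by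
        rw [mul_div_assoc', div_le_iff₀ (by positivity)]
        nlinarith [L.coe_nonneg]
      linarith
  obtain ⟨z, hz0, hz⟩ := hPL.exists_eq_forall_mem_Icc_hasDerivWithinAt₀
  refine ⟨T, z, hT0, hz0, fun t ht => ?_⟩
  have hzc : ContinuousOn z (Icc 0 T) := fun s hs => (hz s hs).continuousWithinAt
  have hint : IntervalIntegrable (fun s => φ (z s, q s)) volume 0 t := by
    refine ContinuousOn.intervalIntegrable ?_
    rw [uIcc_of_le ht.1]
    exact hφ.continuous.comp_continuousOn
      ((hzc.mono (Icc_subset_Icc_right ht.2.le)).prodMk hq.continuousOn)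
  refine ⟨hint, ?_⟩
  rw [intervalIntegral.integral_eq_sub_of_hasDeriv_right (f := z)
    (hzc.mono (by rw [uIcc_of_le ht.1]; exact Icc_subset_Icc_right ht.2.le)) (fun s hs => ?_) hint]
  · abel
  · rw [min_eq_left ht.1, max_eq_right ht.1] at hs
    refine (hz s ⟨hs.1.le, hs.2.le.trans ht.2.le⟩).mono_of_mem_nhdsWithin ?_
    exact mem_nhdsWithin_of_mem_nhds (Icc_mem_nhds hs.1 (hs.2.trans ht.2))

end Caratheodory

/-! ### Lipschitz estimates relative to a compact set -/

/-- A bounded locally Lipschitz function satisfies a Lipschitz estimate between the points of a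
compact set and all points. -/
theorem exists_norm_sub_le_of_isCompact {E F : Type*} [NormedAddCommGroup E]
    [NormedAddCommGroup F] {f : E → F} (hf : LocallyLipschitz f) {M : ℝ} (hM : ∀ x, ‖f x‖ ≤ M)
    {K : Set E} (hK : IsCompact K) :
    ∃ L : ℝ, 0 ≤ L ∧ ∀ x ∈ K, ∀ y, ‖f y - f x‖ ≤ L * ‖y - x‖ := by
  refine hK.induction_on (p := fun s => ∃ L : ℝ, 0 ≤ L ∧ ∀ x ∈ s, ∀ y, ‖f y - f x‖ ≤ L * ‖y - x‖)
    ⟨0, le_rfl, by simp⟩ ?_ ?_ ?_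
  · rintro s t hst ⟨L, hL, h⟩
    exact ⟨L, hL, fun x hx => h x (hst hx)⟩
  · rintro s t ⟨L, hL, h⟩ ⟨L', hL', h'⟩
    refine ⟨L + L', by positivity, fun x hx y => ?_⟩
    have := norm_nonneg (y - x)
    rcases hx with hx | hx
    · nlinarith [h x hx y]
    · nlinarith [h' x hx y]
  · intro x _
    obtain ⟨C, s, hs, hC⟩ := hf x
    obtain ⟨r, hr, hrs⟩ := Metric.mem_nhds_iff.mp hs
    have hM0 : 0 ≤ M := (norm_nonneg _).trans (hM x)
    -- Within the neighbourhood `s` the local Lipschitz constant serves. A point outside `s` is at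
    -- distance at least `r / 2` from the half ball, so there the bound `2 * M` on the difference is
    -- itself linear in the distance.
    refine ⟨Metric.ball x (r / 2), mem_nhdsWithin_of_mem_nhds
      (Metric.ball_mem_nhds _ (by positivity)),
      C + 2 * M / (r / 2), by positivity, fun x' hx' y => ?_⟩
    have hx's : x' ∈ s := hrs (Metric.ball_subset_ball (by linarith) hx')
    rw [add_mul]
    by_cases hy : y ∈ s
    · have h1 := hC.dist_le_mul y hy x' hx's
      rw [dist_eq_norm, dist_eq_norm] at h1
      have : 0 ≤ 2 * M / (r / 2) * ‖y - x'‖ := by positivity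
      linarith
    · have hfar : r / 2 ≤ ‖y - x'‖ := by
        by_contra hlt
        push Not at hlt
        refine hy (hrs ?_)
        rw [Metric.mem_ball] at hx' ⊢
        have := dist_triangle y x' x
        rw [← dist_eq_norm] at hlt
        linarith
      have h1 : ‖f y - f x'‖ ≤ 2 * M := (norm_sub_le _ _).trans (by linarith [hM y, hM x'])
      have h2 : 2 * M ≤ 2 * M / (r / 2) * ‖y - x'‖ := by
        rw [div_mul_eq_mul_div, le_div_iff₀ (by positivity)]
        gcongr
      have : 0 ≤ (C : ℝ) * ‖y - x'‖ := by positivity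
      linarith

/-! ## The identifier -/

section Identifier

variable {nw n0 nu ne : ℕ} {nχ : Fin ne → ℕ} {d nθ nν : ℕ}
  {Z : Type*} [NormedAddCommGroup Z] [NormedSpace ℝ Z] [FiniteDimensional ℝ Z]
  {R : Regulator nw n0 nu nχ d nθ nν Z}
  {Hcl : Set (Signal d ne)} {Hset : Set (Vec ne × Stack d ne)}
  {cε : ℝ≥0 → ℝ≥0 → ℝ≥0 → ℝ≥0} {cr : Vec nθ → ℝ≥0}
  {βς : ℝ≥0 → ℝ≥0 → ℝ≥0} {ας : ℝ≥0} {S : Set Z} {ςs : Signal d ne → ℝ≥0 → Z}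

/-- The steady state of the identifier solves the equation of the identifier. -/
theorem solvesOn_identifierSteadyState
    (hid : R.IdentifierRequirement Hcl cε cr βς ας S ςs) {p : Signal d ne} (hp : p ∈ Hcl)
    (hpc : Continuous p) :
    SolvesOn (fun t => ςs p t.toNNReal) fun t =>
      R.φ (ςs p t.toNNReal, (p t.toNNReal).1, (p t.toNNReal).2) := by
  have : CompleteSpace Z := FiniteDimensional.complete ℝ Z
  have hq : Continuous fun t : ℝ => p t.toNNReal := hpc.comp continuous_real_toNNReal
  obtain ⟨T, z, hT, hz0, hz⟩ := exists_isCaraSol_Ico hid.φ_lipschitz hq (ςs p 0)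
  have hfield : R.idField p 0 = fun t z => R.φ (z, p t.toNNReal) := by
    funext t z
    simp [Regulator.idField]
  obtain ⟨z', hz', hzz'⟩ := hid.complete p hp 0 (locallyIntegrable_zero) T z hT
    (by rw [hfield]; exact hz)
  have hz'0 : z' 0 = ςs p 0 := (hzz' ⟨le_rfl, hT⟩).trans hz0
  -- The solution issuing from `ς⋆(0)` without perturbation has zero initial deviation, so the
  -- stability estimate forces it to coincide with `ς⋆` for all times.
  have heq : ∀ t : ℝ≥0, z' t = ςs p t := by
    intro t
    have h := hid.iss p hp 0 locallyIntegrable_zero z' hz' 0 t zero_le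
    rw [NNReal.coe_zero, hz'0, sub_self, nnnorm_zero, hid.kl.zero] at h
    have hsup : supNorm (0 : ℝ → Vec ne × Stack d ne) 0 t = 0 := by simp [supNorm]
    rw [hsup, mul_zero, ENNReal.coe_zero, add_zero, nonpos_iff_eq_zero, enorm_eq_zero] at h
    exact sub_eq_zero.mp h
  rw [hfield] at hz'
  have hc : ContinuousOn (fun t => R.φ (z' t, p t.toNNReal)) (Ici 0) :=
    hid.φ_lipschitz.continuous.comp_continuousOn (hz'.continuousOn.prodMk hq.continuousOn)
  have hsol := hz'.solvesOn hc
  have heq' : ∀ t, 0 ≤ t → ςs p t.toNNReal = z' t := fun t ht => by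
    rw [← heq, Real.coe_toNNReal _ ht]
  intro t ht
  have h := (hsol t ht).congr_of_mem (f₁ := fun t => ςs p t.toNNReal) (fun s hs => heq' s hs) ht
  simp only [← heq' t ht] at h
  exact h

/-- The identifier fed with `(ξ₂, η)` is the identifier of the ideal signal perturbed by the errors
of `ξ₂` and `η`; the gain is then the assumed stability estimate. -/
theorem asymptoticGain_identifier
    (hid : R.IdentifierRequirement Hcl cε cr βς ας S ςs) {p : Signal d ne} (hp : p ∈ Hcl)
    (hpc : Continuous p) {ς : ℝ → Z} {ξ2 : ℝ → Vec ne} {η : ℝ → Stack d ne}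
    (hς : SolvesOn ς fun t => R.φ (ς t, ξ2 t, η t))
    (hξ2 : ContinuousOn ξ2 (Ici 0)) (hη : ContinuousOn η (Ici 0)) :
    HasAsymptoticGain (fun t => ‖ς t - ςs p t.toNNReal‖) fun t =>
      ας * (‖ξ2 t - (p t.toNNReal).1‖ + ‖η t - (p t.toNNReal).2‖) := by
  have : CompleteSpace Z := FiniteDimensional.complete ℝ Z
  have hα : (0 : ℝ) < ας := hid.gain_pos
  have hq : Continuous fun t : ℝ => p t.toNNReal := hpc.comp continuous_real_toNNReal
  have hmax : Continuous fun s : ℝ => max s 0 := continuous_id.max continuous_const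
  -- Solutions are controlled only for `t ≥ 0`; `max t 0` extends the perturbation continuously to
  -- the line, which makes it locally integrable.
  set δ : ℝ → Vec ne × Stack d ne := fun t =>
    (ξ2 (max t 0) - (p t.toNNReal).1, η (max t 0) - (p t.toNNReal).2) with hδ
  have hδc : Continuous δ :=
    ((hξ2.comp_continuous hmax fun s => mem_Ici.mpr (le_max_right _ _)).sub
      (continuous_fst.comp hq)).prodMk
      ((hη.comp_continuous hmax fun s => mem_Ici.mpr (le_max_right _ _)).sub
        (continuous_snd.comp hq))
  have hfield : ∀ t, 0 ≤ t → ∀ z, R.idField p δ t z = R.φ (z, ξ2 t, η t) := by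
    intro t ht z
    simp [Regulator.idField, hδ, max_eq_left ht]
  have hsol : IsCaraSol (R.idField p δ) (Ici 0) ς := by
    refine SolvesOn.isCaraSol (hς.congr fun t ht => (hfield t ht _).symm) ?_
    refine (hid.φ_lipschitz.continuous.comp_continuousOn
      (hς.continuousOn.prodMk (hξ2.prodMk hη))).congr fun t ht => hfield t ht _
  refine ⟨fun t₀ t => βς ‖ς t₀ - ςs p t₀.toNNReal‖₊ (t - t₀).toNNReal, fun t₀ _ => ?_,
    ⟨βς ‖ς 0 - ςs p (0 : ℝ).toNNReal‖₊ 0, fun t ht => ?_⟩, fun t₀ t V h0 ht hV hv => ?_⟩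
  · have h1 : Tendsto (fun t : ℝ => (t - t₀).toNNReal) atTop atTop :=
      tendsto_real_toNNReal_atTop.comp (tendsto_atTop_add_const_right _ (-t₀) tendsto_id)
    exact NNReal.tendsto_coe.mpr ((hid.kl.tendsto _).comp h1)
  · exact NNReal.coe_le_coe.mpr (hid.kl.antitone _ zero_le)
  · have h := hid.iss p hp δ hδc.locallyIntegrable ς hsol t₀.toNNReal t.toNNReal
      (Real.toNNReal_le_toNNReal ht)
    rw [NNReal.sub_def, Real.coe_toNNReal _ h0, Real.coe_toNNReal _ (h0.trans ht)] at h
    have hsup : supNorm δ t₀ t ≤ ENNReal.ofReal (V / ας) := by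
      refine iSup₂_le fun s hs => ?_
      rw [← ofReal_norm]
      refine ENNReal.ofReal_le_ofReal ?_
      rw [le_div_iff₀' hα]
      refine le_trans ?_ (hv s hs)
      refine mul_le_mul_of_nonneg_left ?_ hα.le
      simp only [hδ, max_eq_left (h0.trans hs.1), Prod.norm_mk]
      exact max_le_add_of_nonneg (norm_nonneg _) (norm_nonneg _)
    have h2 : ENNReal.ofReal ‖ς t - ςs p t.toNNReal‖ ≤ ENNReal.ofReal
        (βς ‖ς t₀ - ςs p t₀.toNNReal‖₊ (t - t₀).toNNReal + V) := by
      rw [ofReal_norm, ENNReal.ofReal_add NNReal.zero_le_coe hV, ENNReal.ofReal_coe_nnreal]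
      refine h.trans (add_le_add_right ((mul_le_mul_right hsup _).trans (le_of_eq ?_)) _)
      rw [← ENNReal.ofReal_coe_nnreal, ← ENNReal.ofReal_mul hα.le, mul_div_cancel₀ _ hα.ne']
    exact (ENNReal.ofReal_le_ofReal_iff (add_nonneg NNReal.zero_le_coe hV)).mp h2

/-- The time derivative of the stack `η⋆` of the signal `p`. -/
def shiftSignal (p : Signal d ne) (t : ℝ) : Stack d ne := fun i =>
  if hi : (i : ℕ) + 1 < d then (p t.toNNReal).2 ⟨i + 1, hi⟩ else (p t.toNNReal).1

/-- The optimal prediction `ψ(η⋆,θ⋆)` is differentiable, and `ψ̇` is its derivative up to an error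
bounded by the prediction error. -/
theorem exists_solvesOn_prediction {Mψ : ℝ≥0} (hMψ : LipschitzWith Mψ R.ψ)
    (hA3 : R.Assumption3 Hcl Hset) (hid : R.IdentifierRequirement Hcl cε cr βς ας S ςs)
    (hψdot : R.PsiDotOk Hset S) {p : Signal d ne} (hp : p ∈ Hcl) (hpc : Continuous p)
    (hpd : SolvesOn (fun t => (p t.toNNReal).2) (shiftSignal p)) :
    ∃ r : ℝ → Vec ne,
      (∀ t, ‖r t‖ ≤ Mψ * ‖R.predErr p t.toNNReal (R.γ (ςs p t.toNNReal))‖) ∧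
      SolvesOn (fun t => R.ψ ((p t.toNNReal).2, R.γ (ςs p t.toNNReal))) fun t =>
        R.ψdot ((p t.toNNReal).1, (p t.toNNReal).2, ςs p t.toNNReal) + r t := by
  set D : ℝ → (Stack d ne × Vec nθ →L[ℝ] Vec ne) := fun t =>
    fderiv ℝ R.ψ ((p t.toNNReal).2, R.γ (ςs p t.toNNReal)) with hD
  set ς' : ℝ → Z := fun t => R.φ (ςs p t.toNNReal, (p t.toNNReal).1, (p t.toNNReal).2) with hς'
  -- The true derivative of `η⋆` and the model `Φ(η⋆,θ⋆)` differ only in the last block, and there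
  -- by the prediction error.
  set E : ℝ → Stack d ne := fun t =>
    shiftSignal p t - R.Phi (p t.toNNReal).2 (R.γ (ςs p t.toNNReal)) with hE
  have hEn : ∀ t, ‖E t‖ ≤ ‖R.predErr p t.toNNReal (R.γ (ςs p t.toNNReal))‖ := by
    intro t
    refine (pi_norm_le_iff_of_nonneg (norm_nonneg _)).mpr fun i => ?_
    by_cases hi : (i : ℕ) + 1 < d
    · simp [hE, shiftSignal, Regulator.Phi, hi]
    · simp [hE, shiftSignal, Regulator.Phi, hi, Regulator.predErr]
  refine ⟨fun t => D t (E t, 0), fun t => ?_, fun t ht => ?_⟩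
  · refine ((D t).le_opNorm _).trans (mul_le_mul (norm_fderiv_le_of_lipschitz ℝ hMψ) ?_
      (norm_nonneg _) Mψ.coe_nonneg)
    rw [Prod.norm_mk, norm_zero, max_eq_left (norm_nonneg _)]
    exact hEn t
  · have hγ := (hid.γ_differentiable (ςs p t.toNNReal)).hasFDerivAt.comp_hasDerivWithinAt t
      (solvesOn_identifierSteadyState hid hp hpc t ht)
    have hψ := (hA3.differentiable ((p t.toNNReal).2,
      R.γ (ςs p t.toNNReal))).hasFDerivAt.comp_hasDerivWithinAt t ((hpd t ht).prodMk hγ)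
    convert! hψ using 1
    -- The formula for `ψ̇` is available only on `H⋆ × S⋆`, where the ideal signals remain.
    have h := hψdot.eq (p t.toNNReal).1 (p t.toNNReal).2 (ςs p t.toNNReal) (hA3.mem p hp _)
      (hid.mem p hp _)
    simp only [h, hD, ← map_add]
    congr 1
    simp [hE]

end Identifier

/-! ## The derivative observer and the internal model -/

section InternalModel

variable {nw n0 nu ne : ℕ} {nχ : Fin ne → ℕ} {d nθ nν : ℕ}
  {Z : Type*} [NormedAddCommGroup Z] [NormedSpace ℝ Z]
  {R : Regulator nw n0 nu nχ d nθ nν Z}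
  {Hcl : Set (Signal d ne)} {Hset : Set (Vec ne × Stack d ne)}
  {cε : ℝ≥0 → ℝ≥0 → ℝ≥0 → ℝ≥0} {cr : Vec nθ → ℝ≥0}
  {βς : ℝ≥0 → ℝ≥0 → ℝ≥0} {ας : ℝ≥0} {S : Set Z} {ςs : Signal d ne → ℝ≥0 → Z}

/-- The optimal prediction `ψ(η⋆,θ⋆)`. -/
def optimalPrediction (R : Regulator nw n0 nu nχ d nθ nν Z) (ςs : Signal d ne → ℝ≥0 → Z)
    (p : Signal d ne) (t : ℝ) : Vec ne :=
  R.ψ ((p t.toNNReal).2, R.γ (ςs p t.toNNReal))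

/-- The optimal prediction error `ε⋆(t,θ⋆(t))`. -/
def optimalError (R : Regulator nw n0 nu nχ d nθ nν Z) (ςs : Signal d ne → ℝ≥0 → Z)
    (p : Signal d ne) (t : ℝ) : Vec ne :=
  R.predErr p t.toNNReal (R.γ (ςs p t.toNNReal))

/-- The scaled error of the derivative observer. -/
def derivativeObserverError (R : Regulator nw n0 nu nχ d nθ nν Z) (ςs : Signal d ne → ℝ≥0 → Z)
    (ρ : ℝ) (p : Signal d ne) (ξ1 ξ2 : ℝ → Vec ne) (t : ℝ) : Stack 2 ne :=
  ![ρ • (ξ1 t - R.lst (p t.toNNReal).2), ξ2 t - optimalPrediction R ςs p t]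

/-- The scaled error of the internal model. -/
noncomputable def internalModelError (g : ℝ) (p : Signal d ne) (η : ℝ → Stack d ne) (t : ℝ) :
    Stack d ne :=
  fun i => (g ^ (i : ℕ))⁻¹ • (η t i - (p t.toNNReal).2 i)

/-- The errors are taken relative to `η_d⋆` and to the prediction `ψ(η⋆,θ⋆)`, whose derivative is
known up to the prediction error. Scaling the first one by `ρ` yields `ρ` times a fixed Hurwitz
system. Its perturbation contains `ρ ε⋆`, `ρ² (η_d - η_d⋆)` and terms without `ρ`; division by the
rate `ρ` gives the three weights. -/
theorem exists_gain_derivativeObserver [FiniteDimensional ℝ Z] (hA3 : R.Assumption3 Hcl Hset)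
    (hid : R.IdentifierRequirement Hcl cε cr βς ας S ςs) (hψdot : R.PsiDotOk Hset S) :
    ∃ k : ℝ, 0 < k ∧ ∀ ρ : ℝ, 1 ≤ ρ → ∀ p ∈ Hcl, Continuous p →
      SolvesOn (fun t => (p t.toNNReal).2) (shiftSignal p) →
      ∀ (η : ℝ → Stack d ne) (ς : ℝ → Z) (ξ1 ξ2 : ℝ → Vec ne),
      SolvesOn ξ1 (fun t => ξ2 t - (R.m1 * ρ) • (ξ1 t - R.lst (η t))) →
      SolvesOn ξ2 (fun t =>
        R.ψdot (ξ2 t, η t, ς t) - (R.m2 * ρ ^ 2) • (ξ1 t - R.lst (η t))) →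
      ContinuousOn (derivativeObserverError R ςs ρ p ξ1 ξ2) (Ici 0) ∧
      HasAsymptoticGain (fun t => ‖derivativeObserverError R ςs ρ p ξ1 ξ2 t‖) fun t =>
        k * (‖optimalError R ςs p t‖ + ρ * ‖η t - (p t.toNNReal).2‖ +
          ρ⁻¹ * (‖ξ2 t - (p t.toNNReal).1‖ + ‖η t - (p t.toNNReal).2‖ +
            ‖ς t - ςs p t.toNNReal‖)) := by
  obtain ⟨k, hk, hgain⟩ := exists_asymptoticGain_observer ne (n := 2) two_pos ![R.m1, R.m2]
    (isHurwitz_quadratic R.m1_pos R.m2_pos)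
  obtain ⟨Mψ, hMψ⟩ := hA3.lipschitz
  obtain ⟨M, hM⟩ := hψdot.bounded
  -- The actual arguments of `ψ̇` are not known to be bounded in advance; it suffices that the ideal
  -- ones lie in a compact set.
  obtain ⟨L, hL0, hL⟩ := exists_norm_sub_le_of_isCompact hψdot.lipschitz hM
    ((hA3.compact.prod hid.compact).image (f := fun v : (Vec ne × Stack d ne) × Z =>
      (v.1.1, v.1.2, v.2)) (by fun_prop))
  have hm1 := R.m1_pos
  have hm2 := R.m2_pos
  refine ⟨k * (1 + Mψ + R.m1 + R.m2 + L), by positivity,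
    fun ρ hρ p hp hpc hpd η ς ξ1 ξ2 hξ1 hξ2 => ?_⟩
  have hρ0 : 0 < ρ := by linarith
  obtain ⟨r, hr, hpred⟩ := exists_solvesOn_prediction hMψ hA3 hid hψdot hp hpc hpd
  set v : ℝ → Stack 2 ne := fun t =>
    ![ρ • (-optimalError R ςs p t + (R.m1 * ρ) • (R.lst (η t) - R.lst (p t.toNNReal).2)),
      R.ψdot (ξ2 t, η t, ς t) - R.ψdot ((p t.toNNReal).1, (p t.toNNReal).2, ςs p t.toNNReal) - r t +
        (R.m2 * ρ ^ 2) • (R.lst (η t) - R.lst (p t.toNNReal).2)] with hv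
  have hsol : SolvesOn (derivativeObserverError R ςs ρ p ξ1 ξ2) fun t =>
      ρ • observerOp ne two_pos ![R.m1, R.m2] (derivativeObserverError R ςs ρ p ξ1 ξ2 t) + v t := by
    intro t ht
    rw [hasDerivWithinAt_pi]
    have hlst := (hasDerivWithinAt_pi.mp (hpd t ht)) ⟨d - 1, Nat.sub_lt R.d_pos one_pos⟩
    have hshift : shiftSignal p t ⟨d - 1, Nat.sub_lt R.d_pos one_pos⟩ = (p t.toNNReal).1 := by
      have := R.d_pos
      simp only [shiftSignal]
      rw [dif_neg (by omega)]
    rw [hshift] at hlst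
    intro i
    fin_cases i
    · have h := ((hξ1 t ht).sub hlst).const_smul ρ
      convert! h using 1
      simp only [Pi.add_apply, Pi.smul_apply, observerOp_apply, hv, derivativeObserverError,
        optimalError, Regulator.predErr, optimalPrediction]
      simp
      module
    · have h := (hξ2 t ht).sub (hpred t ht)
      convert! h using 1
      simp only [Pi.add_apply, Pi.smul_apply, observerOp_apply, hv, derivativeObserverError]
      simp
      module
  refine ⟨hsol.continuousOn, (hgain ρ hρ0 _ v hsol).mono fun t ht => ?_⟩
  set E := ‖optimalError R ςs p t‖ with hE
  set N := ‖η t - (p t.toNNReal).2‖ with hN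
  set D := ‖ξ2 t - (p t.toNNReal).1‖ + N + ‖ς t - ςs p t.toNNReal‖ with hD
  have hE0 : 0 ≤ E := norm_nonneg _
  have hN0 : 0 ≤ N := norm_nonneg _
  have hD0 : 0 ≤ D := by positivity
  have hlst : ‖R.lst (η t) - R.lst (p t.toNNReal).2‖ ≤ N :=
    norm_le_pi_norm (η t - (p t.toNNReal).2) _
  have hψ : ‖R.ψdot (ξ2 t, η t, ς t) -
      R.ψdot ((p t.toNNReal).1, (p t.toNNReal).2, ςs p t.toNNReal)‖ ≤ L * D := by
    refine (hL _ (mem_image_of_mem _ (⟨hA3.mem p hp _, hid.mem p hp _⟩ :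
      (p t.toNNReal, ςs p t.toNNReal) ∈ Hset ×ˢ S)) (ξ2 t, η t, ς t)).trans
        (mul_le_mul_of_nonneg_left ?_ hL0)
    simp only [Prod.norm_def, Prod.fst_sub, Prod.snd_sub]
    refine max_le ?_ (max_le ?_ ?_)
    all_goals linarith [norm_nonneg (ξ2 t - (p t.toNNReal).1), norm_nonneg (ς t - ςs p t.toNNReal)]
  have hvn : ‖v t‖ ≤ ρ * (E + R.m1 * ρ * N) + (L * D + Mψ * E + R.m2 * ρ ^ 2 * N) := by
    refine (pi_norm_le_iff_of_nonneg (by positivity)).mpr fun i => ?_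
    fin_cases i
    · have h1 : ‖v t 0‖ ≤ ρ * (E + R.m1 * ρ * N) := by
        simp only [hv, Matrix.cons_val_zero]
        rw [norm_smul, Real.norm_of_nonneg hρ0.le]
        refine mul_le_mul_of_nonneg_left ((norm_add_le _ _).trans ?_) hρ0.le
        rw [norm_neg, norm_smul, Real.norm_of_nonneg (by positivity)]
        gcongr
      exact h1.trans (le_add_of_nonneg_right (by positivity))
    · have h1 : ‖v t 1‖ ≤ L * D + Mψ * E + R.m2 * ρ ^ 2 * N := by
        simp only [hv, Matrix.cons_val_one, Matrix.cons_val_zero]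
        refine (norm_add_le _ _).trans (add_le_add ((norm_sub_le _ _).trans
          (add_le_add hψ (hr t))) ?_)
        rw [norm_smul, Real.norm_of_nonneg (by positivity)]
        gcongr
      exact h1.trans (le_add_of_nonneg_left (by positivity))
  calc k / ρ * ‖v t‖ ≤ k / ρ * (ρ * (E + R.m1 * ρ * N) + (L * D + Mψ * E + R.m2 * ρ ^ 2 * N)) := by
        gcongr
    _ = k * ((1 + Mψ * ρ⁻¹) * E + (R.m1 + R.m2) * (ρ * N) + L * (ρ⁻¹ * D)) := by field_simp; ring
    _ ≤ k * ((1 + Mψ + R.m1 + R.m2 + L) * (E + ρ * N + ρ⁻¹ * D)) := by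
        refine mul_le_mul_of_nonneg_left ?_ hk.le
        have h1 : (Mψ : ℝ) * ρ⁻¹ * E ≤ Mψ * E := by
          refine mul_le_mul_of_nonneg_right (mul_le_of_le_one_right Mψ.coe_nonneg ?_) hE0
          exact inv_le_one_of_one_le₀ hρ
        have h2 : 0 ≤ ρ * N := by positivity
        have h3 : 0 ≤ ρ⁻¹ * D := by positivity
        have h4 : (0 : ℝ) ≤ Mψ := Mψ.coe_nonneg
        nlinarith [mul_nonneg h4 h2, mul_nonneg h4 h3, mul_nonneg hm1.le hE0, mul_nonneg hm2.le hE0,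
          mul_nonneg hm1.le h3, mul_nonneg hm2.le h3, mul_nonneg hL0 hE0, mul_nonneg hL0 h2]
    _ = _ := by ring

theorem norm_sub_le_internalModelError {g : ℝ} (hg : 1 ≤ g) (p : Signal d ne)
    (η : ℝ → Stack d ne) (t : ℝ) :
    ‖η t - (p t.toNNReal).2‖ ≤ g ^ (d - 1) * ‖internalModelError g p η t‖ := by
  have hg0 : 0 < g := by linarith
  refine (pi_norm_le_iff_of_nonneg (by positivity)).mpr fun i => ?_
  have h1 : (η t - (p t.toNNReal).2) i = g ^ (i : ℕ) • internalModelError g p η t i := by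
    rw [internalModelError, smul_inv_smul₀ (by positivity), Pi.sub_apply]
  rw [h1, norm_smul, Real.norm_of_nonneg (by positivity)]
  refine mul_le_mul (pow_le_pow_right₀ hg (by omega)) (norm_le_pi_norm _ i) (norm_nonneg _)
    (by positivity)

/-- The gains of the internal model, driven by the regulation error `e`. -/
theorem exists_gain_internalModel (hA3 : R.Assumption3 Hcl Hset)
    (hid : R.IdentifierRequirement Hcl cε cr βς ας S ςs) :
    ∃ k : ℝ, 0 < k ∧ ∀ g : ℝ, 1 ≤ g → ∀ p : Signal d ne,
      SolvesOn (fun t => (p t.toNNReal).2) (shiftSignal p) →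
      ∀ (η : ℝ → Stack d ne) (ς : ℝ → Z) (e : ℝ → Vec ne),
      SolvesOn η (fun t => R.Phi (η t) (R.γ (ς t)) + R.Gmul g (e t)) →
      ∃ F : ℝ → Stack d ne, SolvesOn (internalModelError g p η) F ∧
      (∀ t, ‖F t‖ ≤ k * (g * (‖internalModelError g p η t‖ +
        ‖e t + (R.fst (η t) - R.fst (p t.toNNReal).2)‖) +
        g * ((g ^ d)⁻¹ * (‖η t - (p t.toNNReal).2‖ + ‖ς t - ςs p t.toNNReal‖ +
          ‖optimalError R ςs p t‖)))) ∧
      HasAsymptoticGain (fun t => ‖internalModelError g p η t‖) fun t =>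
        k * (‖e t + (R.fst (η t) - R.fst (p t.toNNReal).2)‖ +
          (g ^ d)⁻¹ * (‖η t - (p t.toNNReal).2‖ + ‖ς t - ςs p t.toNNReal‖ +
          ‖optimalError R ςs p t‖)) := by
  obtain ⟨k, hk, hgain⟩ := exists_asymptoticGain_observer ne R.d_pos R.h R.h_hurwitz
  obtain ⟨Mψ, hMψ⟩ := hA3.lipschitz
  obtain ⟨Mγ, hMγ⟩ := hid.γ_lipschitz
  set A := observerOp ne R.d_pos R.h with hA
  set b : ℝ := ‖R.h‖ + 1 + Mψ * (1 + Mγ) with hb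
  have hb0 : 0 < b := by positivity
  refine ⟨k * b + (‖A‖ + b), by positivity, fun g hg p hpd η ς e hη => ?_⟩
  have hg0 : 0 < g := by linarith
  set eh : ℝ → Vec ne := fun t => e t + (R.fst (η t) - R.fst (p t.toNNReal).2) with heh
  -- Writing `e` as `eh` minus the first error block turns the injection `G e` into the stabilising
  -- term `-h_i z_1` of `observerOp` plus an input proportional to `eh`.
  set v : ℝ → Stack d ne := fun t i => (g * R.h i) • eh t +
    if (i : ℕ) + 1 < d then 0 else
      (g ^ (i : ℕ))⁻¹ • (R.ψ (η t, R.γ (ς t)) - (p t.toNNReal).1) with hv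
  have hsol : SolvesOn (internalModelError g p η) fun t =>
      g • A (internalModelError g p η t) + v t := by
    intro t ht
    rw [hasDerivWithinAt_pi]
    intro i
    have h := ((hasDerivWithinAt_pi.mp (hη t ht) i).sub
      (hasDerivWithinAt_pi.mp (hpd t ht) i)).const_smul (g ^ (i : ℕ))⁻¹
    convert! h using 1
    simp only [Pi.add_apply, Pi.smul_apply, observerOp_apply, hv, hA, internalModelError, heh,
      shiftSignal, Regulator.Phi, Regulator.Gmul, Regulator.fst, pow_zero, inv_one, one_smul]
    have e1 : ∀ x : Vec ne, (g ^ (i : ℕ))⁻¹ • (g ^ ((i : ℕ) + 1) * R.h i) • x =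
        (g * R.h i) • x := by
      intro x
      rw [smul_smul]
      congr 1
      rw [pow_succ]; field_simp
    have e2 : ∀ x : Vec ne, g • (g ^ ((i : ℕ) + 1))⁻¹ • x = (g ^ (i : ℕ))⁻¹ • x := by
      intro x
      rw [smul_smul]
      congr 1
      rw [pow_succ]; field_simp
    by_cases hi : (i : ℕ) + 1 < d
    · simp only [hi, dif_pos, if_pos, smul_sub, smul_add, e1, e2]
      module
    · simp only [hi, dif_neg, if_neg, not_false_eq_true, smul_sub, smul_add, e1]
      module
  have hvn : ∀ t, ‖v t‖ ≤ b * (g * ‖eh t‖ + g * ((g ^ d)⁻¹ * (‖η t - (p t.toNNReal).2‖ +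
      ‖ς t - ςs p t.toNNReal‖ + ‖optimalError R ςs p t‖))) := by
    intro t
    set E := ‖optimalError R ςs p t‖ with hE
    set N := ‖η t - (p t.toNNReal).2‖ with hN
    set D := ‖ς t - ςs p t.toNNReal‖ with hD
    have hψ : ‖R.ψ (η t, R.γ (ς t)) - (p t.toNNReal).1‖ ≤ (1 + Mψ * (1 + Mγ)) * (N + D + E) := by
      have h1 : ‖R.ψ (η t, R.γ (ς t)) - R.ψ ((p t.toNNReal).2, R.γ (ςs p t.toNNReal))‖ ≤
          Mψ * (N + Mγ * D) := by
        refine (hMψ.norm_sub_le _ _).trans (mul_le_mul_of_nonneg_left ?_ Mψ.coe_nonneg)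
        rw [Prod.norm_def]
        exact max_le (le_add_of_nonneg_right (by positivity))
          ((hMγ.norm_sub_le _ _).trans (le_add_of_nonneg_left (norm_nonneg _)))
      have h2 : R.ψ (η t, R.γ (ς t)) - (p t.toNNReal).1 = (R.ψ (η t, R.γ (ς t)) -
          R.ψ ((p t.toNNReal).2, R.γ (ςs p t.toNNReal))) - optimalError R ςs p t := by
        simp [optimalError, Regulator.predErr]
      rw [h2]
      refine (norm_sub_le _ _).trans ((add_le_add_left h1 _).trans ?_)
      have hN0 : 0 ≤ N := norm_nonneg _
      have hD0 : 0 ≤ D := norm_nonneg _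
      have hE0 : 0 ≤ E := norm_nonneg _
      have a1 : 0 ≤ (Mψ : ℝ) * D := by positivity
      have a2 : 0 ≤ (Mψ : ℝ) * E := by positivity
      have a3 : 0 ≤ (Mψ : ℝ) * Mγ * N := by positivity
      have a4 : 0 ≤ (Mψ : ℝ) * Mγ * E := by positivity
      nlinarith
    have hS : 0 ≤ N + D + E := by positivity
    refine (pi_norm_le_iff_of_nonneg (by positivity)).mpr fun i => ?_
    have h1 : ‖(g * R.h i) • eh t‖ ≤ b * (g * ‖eh t‖) := by
      rw [norm_smul, norm_mul, Real.norm_of_nonneg hg0.le]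
      have : ‖R.h i‖ ≤ b := (norm_le_pi_norm R.h i).trans (by
        have : 0 ≤ (Mψ : ℝ) * (1 + Mγ) := by positivity
        linarith)
      calc g * ‖R.h i‖ * ‖eh t‖ ≤ g * b * ‖eh t‖ := by gcongr
        _ = _ := by ring
    simp only [hv]
    by_cases hi : (i : ℕ) + 1 < d
    · rw [if_pos hi, add_zero]
      refine h1.trans (mul_le_mul_of_nonneg_left (le_add_of_nonneg_right (by positivity)) hb0.le)
    · rw [if_neg hi]
      -- Only the last block carries the mismatch of `ψ`; its weight `g^(1-d)` equals `g * g⁻ᵈ`, and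
      -- the gain `k / g` later removes the factor `g`.
      have hid : d = (i : ℕ) + 1 := by omega
      rw [mul_add]
      refine (norm_add_le _ _).trans (add_le_add h1 ?_)
      rw [norm_smul, norm_inv, Real.norm_of_nonneg (by positivity : 0 ≤ g ^ (i : ℕ))]
      have h3 : g * (g ^ d)⁻¹ = (g ^ (i : ℕ))⁻¹ := by
        have : g ^ d = g ^ ((i : ℕ) + 1) := congrArg _ hid
        rw [this, pow_succ]; field_simp
      rw [← mul_assoc g, h3, mul_left_comm]
      refine mul_le_mul_of_nonneg_left (hψ.trans ?_) (by positivity)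
      refine mul_le_mul_of_nonneg_right ?_ hS
      linarith [norm_nonneg R.h]
  -- Besides the gain, the size of the derivative is recorded, since the derivative of the first
  -- block disturbs the chains.
  refine ⟨_, hsol, fun t => ?_, (hgain g hg0 _ v hsol).mono fun t ht => ?_⟩
  · set T := (g ^ d)⁻¹ * (‖η t - (p t.toNNReal).2‖ + ‖ς t - ςs p t.toNNReal‖ +
      ‖optimalError R ςs p t‖) with hT
    have hT0 : 0 ≤ T := by positivity
    set Y := ‖internalModelError g p η t‖ with hY
    have hY0 : 0 ≤ Y := norm_nonneg _
    have h1 : ‖g • A (internalModelError g p η t)‖ ≤ g * (‖A‖ * Y) := by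
      rw [norm_smul, Real.norm_of_nonneg hg0.le]
      gcongr
      exact A.le_opNorm _
    refine (norm_add_le _ _).trans ((add_le_add h1 (hvn t)).trans ?_)
    have hA0 : 0 ≤ ‖A‖ := norm_nonneg A
    have b1 : 0 ≤ k * b * (g * (Y + ‖eh t‖) + g * T) := by positivity
    have b2 : 0 ≤ ‖A‖ * (g * ‖eh t‖ + g * T) := by positivity
    have b3 : 0 ≤ b * (g * Y) := by positivity
    nlinarith
  · refine (mul_le_mul_of_nonneg_left (hvn t) (by positivity)).trans ?_
    set T := (g ^ d)⁻¹ * (‖η t - (p t.toNNReal).2‖ + ‖ς t - ςs p t.toNNReal‖ +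
      ‖optimalError R ςs p t‖) with hT
    have hT0 : 0 ≤ T := by positivity
    have h1 : k / g * (b * (g * ‖eh t‖ + g * T)) = k * b * (‖eh t‖ + T) := by field_simp
    rw [h1]
    refine mul_le_mul_of_nonneg_right ?_ (by positivity)
    linarith [norm_nonneg A]

end InternalModel

/-! ## Matrices acting on Euclidean spaces -/

section Act

variable {m n l : Type*} [Fintype n]

theorem act_apply (M : Matrix m n ℝ) (v : EuclideanSpace ℝ n) (i : m) :
    act M v i = ∑ j, M i j * v j := rfl

theorem smul_act (M : Matrix m n ℝ) (r : ℝ) (v : EuclideanSpace ℝ n) :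
    act (r • M) v = r • act M v := by
  ext i
  simp [act_apply, Finset.mul_sum, mul_assoc]

theorem act_act [Fintype m] (M : Matrix l m ℝ) (N : Matrix m n ℝ) (v : EuclideanSpace ℝ n) :
    act M (act N v) = act (M * N) v := by
  simp [act, Matrix.mulVec_mulVec]

variable [Fintype m]

/-- The continuous linear map given by a matrix. -/
noncomputable def actL (M : Matrix m n ℝ) : EuclideanSpace ℝ n →L[ℝ] EuclideanSpace ℝ m :=
  LinearMap.toContinuousLinearMap
    { toFun := act M
      map_add' := fun x y => by ext i; simp [act, Matrix.mulVec_add]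
      map_smul' := fun r x => by ext i; simp [act, Matrix.mulVec_smul] }

theorem actL_apply (M : Matrix m n ℝ) (v : EuclideanSpace ℝ n) : actL M v = act M v := rfl

theorem act_add (M : Matrix m n ℝ) (v w : EuclideanSpace ℝ n) :
    act M (v + w) = act M v + act M w := map_add (actL M) v w

theorem act_sub (M : Matrix m n ℝ) (v w : EuclideanSpace ℝ n) :
    act M (v - w) = act M v - act M w := map_sub (actL M) v w

theorem act_neg (M : Matrix m n ℝ) (v : EuclideanSpace ℝ n) :
    act M (-v) = -act M v := map_neg (actL M) v

theorem act_smul (M : Matrix m n ℝ) (r : ℝ) (v : EuclideanSpace ℝ n) :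
    act M (r • v) = r • act M v := map_smul (actL M) r v

theorem one_act [DecidableEq m] (v : EuclideanSpace ℝ m) : act (1 : Matrix m m ℝ) v = v := by
  ext i; simp [act]

theorem euclidean_norm_le_sum (v : EuclideanSpace ℝ n) : ‖v‖ ≤ ∑ i, |v i| := by
  rw [EuclideanSpace.norm_eq, Real.sqrt_le_left (Finset.sum_nonneg fun _ _ => abs_nonneg _)]
  simpa using Finset.sum_sq_le_sq_sum_of_nonneg (s := Finset.univ) (f := fun i => |v i|)
    fun _ _ => abs_nonneg _

theorem euclidean_norm_le {v : EuclideanSpace ℝ n} {b : ℝ} (hb : ∀ i, |v i| ≤ b) :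
    ‖v‖ ≤ Fintype.card n * b := by
  refine (euclidean_norm_le_sum v).trans ((Finset.sum_le_sum fun i _ => hb i).trans (le_of_eq ?_))
  simp

theorem abs_apply_le_norm (v : EuclideanSpace ℝ n) (i : n) : |v i| ≤ ‖v‖ :=
  PiLp.norm_apply_le v i

theorem norm_act_le {M : Matrix m n ℝ} {b : ℝ} (hb0 : 0 ≤ b) (hb : ∀ i j, |M i j| ≤ b)
    (v : EuclideanSpace ℝ n) : ‖act M v‖ ≤ Fintype.card m * Fintype.card n * b * ‖v‖ := by
  refine (euclidean_norm_le (b := Fintype.card n * b * ‖v‖) fun i => ?_).trans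
    (le_of_eq (by ring))
  rw [act_apply]
  refine (Finset.abs_sum_le_sum_abs _ _).trans ((Finset.sum_le_sum (g := fun _ => b * ‖v‖)
    fun j _ => ?_).trans (le_of_eq ?_))
  · rw [abs_mul]
    exact mul_le_mul (hb i j) (abs_apply_le_norm v j) (abs_nonneg _) hb0
  · simp [mul_assoc]

theorem hasDerivWithinAt_euclidean {f : ℝ → EuclideanSpace ℝ n} {f' : EuclideanSpace ℝ n}
    {s : Set ℝ} {x : ℝ} :
    HasDerivWithinAt f f' s x ↔ ∀ i, HasDerivWithinAt (fun t => f t i) (f' i) s x := by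
  simp only [hasDerivWithinAt_iff_hasFDerivWithinAt]
  rw [hasFDerivWithinAt_euclidean]
  refine forall_congr' fun i => ?_
  have : EuclideanSpace.proj (𝕜 := ℝ) i ∘L ContinuousLinearMap.toSpanSingleton ℝ f' =
      ContinuousLinearMap.toSpanSingleton ℝ (f' i) := by
    ext; simp
  rw [← this]

end Act

/-! ## The chains of integrators -/

section ChainError

variable {ne : ℕ} {nχ : Fin ne → ℕ}

theorem act_chainF_apply (χ : ChainVec nχ) (q : Σ i, Fin (nχ i)) :
    act (chainF nχ) χ q = if hq : (q.2 : ℕ) + 1 < nχ q.1 then χ ⟨q.1, ⟨q.2 + 1, hq⟩⟩ else 0 := by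
  obtain ⟨i, j⟩ := q
  rw [act_apply, Fintype.sum_sigma, Finset.sum_eq_single i]
  · simp only [chainF, Matrix.blockDiagonal'_apply_eq, Matrix.of_apply]
    by_cases hj : (j : ℕ) + 1 < nχ i
    · rw [dif_pos hj, Finset.sum_eq_single ⟨j + 1, hj⟩]
      · simp
      · intro k _ hk
        rw [if_neg fun h => hk (Fin.ext h), zero_mul]
      · simp
    · rw [dif_neg hj]
      refine Finset.sum_eq_zero fun k _ => ?_
      rw [if_neg fun h => hj (by have := k.2; omega), zero_mul]
  · intro i' _ hi'
    refine Finset.sum_eq_zero fun k _ => ?_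
    rw [chainF, Matrix.blockDiagonal'_apply_ne _ _ _ hi'.symm, zero_mul]
  · simp

theorem act_chainH_apply (ζ : Vec ne) (q : Σ i, Fin (nχ i)) :
    act (chainH nχ) ζ q = if (q.2 : ℕ) + 1 = nχ q.1 then ζ q.1 else 0 := by
  rw [act_apply, Finset.sum_eq_single q.1]
  · simp [chainH]
  · intro i _ hi
    simp [chainH, hi.symm]
  · simp

theorem act_chainC_transpose_apply (v : Vec ne) (q : Σ i, Fin (nχ i)) :
    act (chainC nχ)ᵀ v q = if (q.2 : ℕ) = 0 then v q.1 else 0 := by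
  rw [act_apply, Finset.sum_eq_single q.1]
  · simp [chainC]
  · intro i _ hi
    simp [chainC, hi.symm]
  · simp

theorem act_chainC_apply (χ : ChainVec nχ) (i : Fin ne) (hi : 0 < nχ i) :
    act (chainC nχ) χ i = χ ⟨i, ⟨0, hi⟩⟩ := by
  rw [act_apply, Finset.sum_eq_single ⟨i, ⟨0, hi⟩⟩]
  · simp [chainC]
  · rintro ⟨i', j⟩ _ hij
    simp only [chainC, Matrix.of_apply]
    rw [if_neg, zero_mul]
    rintro ⟨rfl, h0⟩
    exact hij (by congr 1; exact Fin.ext h0)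
  · simp

theorem act_chainK_apply (a : ∀ i, Fin (nχ i) → ℝ) (κ : ℝ) (χ : ChainVec nχ) (i : Fin ne) :
    act (chainK nχ a κ) χ i = -∑ j, a i j * κ ^ (nχ i - (j : ℕ)) * χ ⟨i, j⟩ := by
  rw [act_apply, Fintype.sum_sigma, Finset.sum_eq_single i]
  · simp [chainK]
  · intro i' _ hi'
    refine Finset.sum_eq_zero fun k _ => ?_
    simp [chainK, hi']
  · simp

/-- The chain state shifted by `Cᵀ e₀`. -/
noncomputable def shiftedChain (χ : ℝ → ChainVec nχ) (e0 : ℝ → Vec ne) (t : ℝ) : ChainVec nχ :=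
  χ t + act (chainC nχ)ᵀ (e0 t)

/-- The scaled chain state `X_jⁱ = κ^{1-j} χ̃_jⁱ`. -/
noncomputable def chainError (κ : ℝ) (χ : ℝ → ChainVec nχ) (e0 : ℝ → Vec ne) (t : ℝ) :
    ChainVec nχ :=
  WithLp.toLp 2 fun q => (κ ^ (q.2 : ℕ))⁻¹ * shiftedChain χ e0 t q

/-- The deviation of `ζ` from the virtual control `K(κ) χ̃`. -/
noncomputable def stabiliserError (a : ∀ i, Fin (nχ i) → ℝ) (κ : ℝ) (χ : ℝ → ChainVec nχ)
    (ζ e0 : ℝ → Vec ne) (t : ℝ) : Vec ne :=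
  ζ t - act (chainK nχ a κ) (shiftedChain χ e0 t)

/-- The gain matrix of the virtual control as a function of the scaled chain state. -/
def scaledChainK (a : ∀ i, Fin (nχ i) → ℝ) (κ : ℝ) : Matrix (Fin ne) (Σ i, Fin (nχ i)) ℝ :=
  Matrix.of fun i q => if q.1 = i then -(a q.1 q.2 * κ ^ nχ q.1) else 0

/-- The scaling `κ ^ j` of the `j`-th entry completes the power in `K(κ)`, so that all coefficients
of chain `i` carry the same power `κ ^ nχ i`. -/
theorem act_chainK_shiftedChain (a : ∀ i, Fin (nχ i) → ℝ) {κ : ℝ} (hκ : κ ≠ 0)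
    (χ : ℝ → ChainVec nχ) (e0 : ℝ → Vec ne) (t : ℝ) :
    act (chainK nχ a κ) (shiftedChain χ e0 t) = act (scaledChainK a κ) (chainError κ χ e0 t) := by
  ext i
  rw [act_apply, act_apply]
  refine Finset.sum_congr rfl fun q _ => ?_
  simp only [chainK, scaledChainK, Matrix.of_apply, chainError]
  by_cases h : q.1 = i
  · rw [if_pos h, if_pos h]
    have : κ ^ nχ q.1 = κ ^ (nχ q.1 - (q.2 : ℕ)) * κ ^ (q.2 : ℕ) := by
      rw [← pow_add, Nat.sub_add_cancel q.2.2.le]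
    rw [this]
    field_simp
  · rw [if_neg h, if_neg h, zero_mul, zero_mul]

theorem exists_norm_act_scaledChainK_le (a : ∀ i, Fin (nχ i) → ℝ) :
    ∃ k : ℝ, 0 < k ∧ ∀ κ : ℝ, 1 ≤ κ → ∀ v : ChainVec nχ,
      ‖act (scaledChainK a κ) v‖ ≤ k * (κ ^ (∑ i, nχ i) * ‖v‖) := by
  set A := (∑ q : Σ i, Fin (nχ i), |a q.1 q.2|) with hA
  have hA0 : 0 ≤ A := Finset.sum_nonneg fun _ _ => abs_nonneg _
  refine ⟨Fintype.card (Fin ne) * Fintype.card (Σ i, Fin (nχ i)) * A + 1, by positivity,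
    fun κ hκ v => ?_⟩
  have hκ0 : 0 ≤ κ := by linarith
  refine (norm_act_le (b := A * κ ^ (∑ i, nχ i)) (by positivity) (fun i q => ?_) v).trans ?_
  · simp only [scaledChainK, Matrix.of_apply]
    split_ifs
    · rw [abs_neg, abs_mul, abs_of_nonneg (pow_nonneg hκ0 _)]
      refine mul_le_mul ?_ (pow_le_pow_right₀ hκ ?_) (by positivity) hA0
      · exact Finset.single_le_sum (f := fun q : Σ i, Fin (nχ i) => |a q.1 q.2|)
          (fun _ _ => abs_nonneg _) (Finset.mem_univ q)
      · exact Finset.single_le_sum (f := nχ) (fun _ _ => Nat.zero_le _) (Finset.mem_univ q.1)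
    · rw [abs_zero]; positivity
  · have : 0 ≤ κ ^ (∑ i, nχ i) * ‖v‖ := by positivity
    rw [add_mul, one_mul]
    refine le_add_of_le_of_nonneg (le_of_eq (by ring)) this

/-- The power of `κ` may be crude: the bound enters only loops that close through `ℓ⁻¹`, and `ℓ` is
chosen after `κ`. -/
theorem exists_norm_shiftedChain_le :
    ∃ k : ℝ, 0 < k ∧ ∀ κ : ℝ, 1 ≤ κ → ∀ (χ : ℝ → ChainVec nχ) (e0 : ℝ → Vec ne) (t : ℝ),
      ‖χ t‖ ≤ k * (κ ^ (∑ i, nχ i) * ‖chainError κ χ e0 t‖ + ‖e0 t‖) := by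
  set N := Fintype.card (Σ i, Fin (nχ i)) with hN
  refine ⟨N + 1, by positivity, fun κ hκ χ e0 t => ?_⟩
  have hκ0 : 0 < κ := by linarith
  have hb : ∀ q, |χ t q| ≤ κ ^ (∑ i, nχ i) * ‖chainError κ χ e0 t‖ + ‖e0 t‖ := by
    intro q
    have h1 : χ t q = κ ^ (q.2 : ℕ) * chainError κ χ e0 t q - act (chainC nχ)ᵀ (e0 t) q := by
      simp only [chainError, shiftedChain, PiLp.add_apply]
      field_simp
      ring
    have h2 : |act (chainC nχ)ᵀ (e0 t) q| ≤ ‖e0 t‖ := by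
      rw [act_chainC_transpose_apply]
      split_ifs
      · exact abs_apply_le_norm _ _
      · rw [abs_zero]; exact norm_nonneg _
    rw [h1]
    refine (abs_sub _ _).trans (add_le_add ?_ h2)
    rw [abs_mul, abs_of_nonneg (by positivity)]
    refine mul_le_mul (pow_le_pow_right₀ hκ ?_) (abs_apply_le_norm _ _) (abs_nonneg _)
      (by positivity)
    exact q.2.2.le.trans (Finset.single_le_sum (f := nχ) (fun _ _ => Nat.zero_le _)
      (Finset.mem_univ q.1))
  refine (euclidean_norm_le hb).trans (mul_le_mul_of_nonneg_right ?_ (by positivity))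
  linarith

/-- The first entry of each chain has weight `κ ^ 0 = 1`, so the regulation error is controlled
without any power of `κ`; this keeps the final constant independent of `κ`. -/
theorem norm_act_chainC_add_le (hpos : ∀ i, 0 < nχ i) (κ : ℝ) (χ : ℝ → ChainVec nχ)
    (e0 : ℝ → Vec ne) (t : ℝ) :
    ‖act (chainC nχ) (χ t) + e0 t‖ ≤ ne * ‖chainError κ χ e0 t‖ := by
  refine (euclidean_norm_le (b := ‖chainError κ χ e0 t‖) fun i => ?_).trans (le_of_eq (by simp))
  have : (act (chainC nχ) (χ t) + e0 t) i = chainError κ χ e0 t ⟨i, ⟨0, hpos i⟩⟩ := by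
    simp [chainError, shiftedChain, act_chainC_apply _ _ (hpos i), act_chainC_transpose_apply]
  rw [this]
  exact abs_apply_le_norm _ _

/-- The gains of the chains of integrators. -/
theorem exists_gain_chainError (a : ∀ i, Fin (nχ i) → ℝ)
    (ha : ∀ i, IsHurwitz (Polynomial.X ^ nχ i +
      ∑ j : Fin (nχ i), Polynomial.C (a i j) * Polynomial.X ^ (j : ℕ))) :
    ∃ k : ℝ, 0 < k ∧ ∀ κ : ℝ, 1 ≤ κ → ∀ (χ : ℝ → ChainVec nχ) (ζ e0 e0' : ℝ → Vec ne),
      SolvesOn χ (fun t => act (chainF nχ) (χ t) + act (chainH nχ) (ζ t)) → SolvesOn e0 e0' →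
      ∃ F : ℝ → ChainVec nχ, SolvesOn (chainError κ χ e0) F ∧
        (∀ t, ‖F t‖ ≤ k * (κ * (‖chainError κ χ e0 t‖ + ‖stabiliserError a κ χ ζ e0 t‖ +
          ‖e0' t‖))) ∧
        HasAsymptoticGain (fun t => ‖chainError κ χ e0 t‖) fun t =>
          k * (κ⁻¹ * (‖stabiliserError a κ χ ζ e0 t‖ + ‖e0' t‖)) := by
  obtain ⟨k, hk, hgain⟩ := exists_asymptoticGain_chain nχ a ha
  set A := chainOp nχ a with hA
  set N : ℝ := (Fintype.card (Σ i, Fin (nχ i)) : ℝ) with hN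
  have hN0 : 0 ≤ N := Nat.cast_nonneg _
  refine ⟨(k + 1) * (N + 1) + ‖A‖, by positivity, fun κ hκ χ ζ e0 e0' hχ he0 => ?_⟩
  have hκ0 : 0 < κ := by linarith
  set X := chainError κ χ e0 with hX
  set W := stabiliserError a κ χ ζ e0 with hW
  -- The stabiliser error enters the end of each chain with weight at most one, the derivative of
  -- the shift enters its beginning with weight exactly one. Both conditions may hold at once, for a
  -- chain of length one.
  set v : ℝ → ChainVec nχ := fun t => WithLp.toLp 2 fun q =>
    (if (q.2 : ℕ) + 1 = nχ q.1 then (κ ^ (q.2 : ℕ))⁻¹ * W t q.1 else 0) +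
      if (q.2 : ℕ) = 0 then e0' t q.1 else 0 with hv
  have hvn : ∀ t, ‖v t‖ ≤ N * (‖W t‖ + ‖e0' t‖) := by
    intro t
    refine euclidean_norm_le fun q => ?_
    refine (abs_add_le _ _).trans (add_le_add ?_ ?_)
    · split_ifs
      · rw [abs_mul, abs_of_nonneg (by positivity)]
        refine (mul_le_of_le_one_left (abs_nonneg _) (inv_le_one_of_one_le₀ (one_le_pow₀ hκ))).trans
          (abs_apply_le_norm _ _)
      · rw [abs_zero]; exact norm_nonneg _
    · split_ifs
      · exact abs_apply_le_norm _ _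
      · rw [abs_zero]; exact norm_nonneg _
  have hsol : SolvesOn X fun t => κ • A (X t) + v t := by
    intro t ht
    have hsh : HasDerivWithinAt (shiftedChain χ e0)
        (act (chainF nχ) (χ t) + act (chainH nχ) (ζ t) + act (chainC nχ)ᵀ (e0' t)) (Ici 0) t :=
      (hχ t ht).add ((actL (chainC nχ)ᵀ).hasFDerivAt.comp_hasDerivWithinAt t (he0 t ht))
    rw [hasDerivWithinAt_euclidean]
    intro q
    have h := (hasDerivWithinAt_euclidean.mp hsh q).const_mul (κ ^ (q.2 : ℕ))⁻¹
    convert! h using 1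
    obtain ⟨i, j⟩ := q
    simp only [PiLp.add_apply, PiLp.smul_apply, smul_eq_mul, hA, chainOp_apply, hv, hX, chainError,
      act_chainF_apply, act_chainH_apply, act_chainC_transpose_apply]
    have he : (κ ^ (j : ℕ))⁻¹ * (if (j : ℕ) = 0 then e0' t i else 0) =
        if (j : ℕ) = 0 then e0' t i else 0 := by
      split_ifs with h0
      · rw [h0, pow_zero, inv_one, one_mul]
      · rw [mul_zero]
    by_cases hj : (j : ℕ) + 1 < nχ i
    · have hχs : χ t ⟨i, ⟨j + 1, hj⟩⟩ = shiftedChain χ e0 t ⟨i, ⟨j + 1, hj⟩⟩ := by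
        simp [shiftedChain, act_chainC_transpose_apply]
      have hne : ¬ (j : ℕ) + 1 = nχ i := by omega
      simp only [hj, dif_pos, hne, if_false, add_zero, zero_add, mul_add, he, hχs]
      congr 1
      rw [pow_succ]
      field_simp
    · have heq : (j : ℕ) + 1 = nχ i := by have := j.2; omega
      rw [dif_neg hj, dif_neg hj, if_pos heq, if_pos heq]
      simp only [zero_add, mul_add, he]
      rw [← add_assoc]
      congr 1
      have hW' : W t i =
          ζ t i + ∑ j', a i j' * κ ^ (nχ i - (j' : ℕ)) * shiftedChain χ e0 t ⟨i, j'⟩ := by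
        simp only [hW, stabiliserError, PiLp.sub_apply, act_chainK_apply]
        ring
      rw [hW', mul_add]
      -- The virtual control reproduces `κ` times the last companion row of `chainOp`; only the
      -- stabiliser error is left over.
      have hs : κ * -∑ j', a i j' * ((κ ^ (j' : ℕ))⁻¹ * shiftedChain χ e0 t ⟨i, j'⟩) +
          (κ ^ (j : ℕ))⁻¹ *
            ∑ j', a i j' * κ ^ (nχ i - (j' : ℕ)) * shiftedChain χ e0 t ⟨i, j'⟩ = 0 := by
        rw [mul_neg, Finset.mul_sum, Finset.mul_sum, neg_add_eq_sub, sub_eq_zero]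
        refine Finset.sum_congr rfl fun j' _ => ?_
        have h1 : κ ^ (nχ i - (j' : ℕ)) = κ * κ ^ (j : ℕ) * (κ ^ (j' : ℕ))⁻¹ := by
          rw [eq_mul_inv_iff_mul_eq₀ (by positivity), ← pow_succ', ← pow_add, heq,
            Nat.sub_add_cancel j'.2.le]
        rw [h1]
        field_simp
      linarith
  refine ⟨_, hsol, fun t => ?_, (hgain κ hκ0 X v hsol).mono fun t ht => ?_⟩
  · have h1 : ‖κ • A (X t)‖ ≤ κ * (‖A‖ * ‖X t‖) := by
      rw [norm_smul, Real.norm_of_nonneg hκ0.le]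
      gcongr
      exact A.le_opNorm _
    refine (norm_add_le _ _).trans ((add_le_add h1 (hvn t)).trans ?_)
    set w := ‖W t‖ + ‖e0' t‖ with hw
    have hw0 : 0 ≤ w := by positivity
    have h2 : N * w ≤ κ * (N * w) := le_mul_of_one_le_left (by positivity) hκ
    have b1 : 0 ≤ (k + 1) * (N + 1) * (κ * ‖X t‖) := by positivity
    have b2 : 0 ≤ ‖A‖ * (κ * w) := by positivity
    have b3 : 0 ≤ (k * N + k + 1) * (κ * w) := by positivity
    rw [add_assoc]
    nlinarith
  · set w := ‖W t‖ + ‖e0' t‖ with hw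
    have hw0 : 0 ≤ w := by positivity
    calc k / κ * ‖v t‖ ≤ k / κ * (N * w) := by gcongr; exact hvn t
      _ = k * N * (κ⁻¹ * w) := by field_simp
      _ ≤ _ := by
        refine mul_le_mul_of_nonneg_right ?_ (by positivity)
        nlinarith [norm_nonneg A]

end ChainError

/-! ## The stabiliser -/

/-- A perturbed linear system whose matrix has a positive definite symmetric part. -/
theorem asymptoticGain_of_positive {ne : ℕ} {z D : ℝ → Vec ne} {Ω : ℝ → Matrix (Fin ne) (Fin ne) ℝ}
    {ℓ : ℝ} (hℓ : 0 < ℓ) (hΩ : ∀ t, ((Ω t)ᵀ + Ω t - 1).PosSemidef)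
    (hz : SolvesOn z fun t => act (Ω t) (-ℓ • z t) + D t) :
    HasAsymptoticGain (fun t => ‖z t‖) fun t => 2 / ℓ * ‖D t‖ := by
  refine HasAsymptoticGain.of_exp (lam := ℓ / 4) (c := 1) (by positivity) (by positivity)
    zero_le_one (norm_nonneg _) fun a b V ha hab hV hV0 => ?_
  have hpos : ∀ t, ‖z t‖ ^ 2 ≤ 2 * inner ℝ (z t) (act (Ω t) (z t)) := by
    intro t
    have h := (hΩ t).dotProduct_mulVec_nonneg (z t).ofLp
    have h2 : (z t).ofLp ⬝ᵥ ((Ω t)ᵀ *ᵥ (z t).ofLp) = (z t).ofLp ⬝ᵥ (Ω t *ᵥ (z t).ofLp) := by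
      rw [Matrix.mulVec_transpose, dotProduct_comm, Matrix.dotProduct_mulVec]
    rw [Matrix.sub_mulVec, Matrix.add_mulVec, Matrix.one_mulVec, dotProduct_sub, dotProduct_add,
      star_trivial, h2] at h
    have h3 : inner ℝ (z t) (act (Ω t) (z t)) = (z t).ofLp ⬝ᵥ (Ω t *ᵥ (z t).ofLp) := by
      rw [EuclideanSpace.inner_eq_star_dotProduct, star_trivial, dotProduct_comm]
      rfl
    have h4 : ‖z t‖ ^ 2 = (z t).ofLp ⬝ᵥ (z t).ofLp := by
      rw [EuclideanSpace.real_norm_sq_eq]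
      simp [dotProduct, pow_two]
    rw [h3, h4]
    linarith
  -- Positivity and Young's inequality bound the derivative of `‖z‖ ^ 2` by `-(ℓ / 2) (‖z‖ ^ 2 - 4 V
  -- ^ 2 / ℓ ^ 2)`, so this weighted excess decreases.
  set f : ℝ → ℝ := fun t => Real.exp (ℓ / 2 * t) * (‖z t‖ ^ 2 - 4 / ℓ ^ 2 * V ^ 2) with hf
  have hzc := hz.continuousOn
  have hanti : AntitoneOn f (Icc a b) := by
    have hsub : Icc a b ⊆ Ici 0 := fun s hs => ha.trans hs.1
    refine antitoneOn_of_hasDerivWithinAt_nonpos (convex_Icc a b)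
      (f' := fun t => Real.exp (ℓ / 2 * t) * (ℓ / 2) * (‖z t‖ ^ 2 - 4 / ℓ ^ 2 * V ^ 2) +
        Real.exp (ℓ / 2 * t) * (2 * inner ℝ (z t) (act (Ω t) (-ℓ • z t) + D t))) ?_ ?_ ?_
    · have : ContinuousOn z (Icc a b) := hzc.mono hsub
      fun_prop
    · intro t ht
      have ht' : t ∈ Icc a b := interior_subset ht
      have h1 : HasDerivWithinAt z (act (Ω t) (-ℓ • z t) + D t) (interior (Icc a b)) t :=
        (hz t (hsub ht')).mono (interior_subset.trans hsub)
      have h2 : HasDerivAt (fun t => Real.exp (ℓ / 2 * t)) (Real.exp (ℓ / 2 * t) * (ℓ / 2)) t := by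
        simpa using ((hasDerivAt_id t).const_mul (ℓ / 2)).exp
      exact h2.hasDerivWithinAt.mul (h1.norm_sq.sub_const _)
    · intro t ht
      rw [interior_Icc] at ht
      have hD := hV t ⟨ht.1.le, ht.2⟩
      have h1 : inner ℝ (z t) (act (Ω t) (-ℓ • z t) + D t) =
          -ℓ * inner ℝ (z t) (act (Ω t) (z t)) + inner ℝ (z t) (D t) := by
        rw [inner_add_right, act_smul, inner_smul_right]
      have h2 : inner ℝ (z t) (D t) ≤ ‖z t‖ * V :=
        (real_inner_le_norm _ _).trans (by gcongr)
      rw [h1, mul_assoc, ← mul_add]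
      refine mul_nonpos_of_nonneg_of_nonpos (Real.exp_pos _).le ?_
      have h3 := mul_le_mul_of_nonneg_left (hpos t) hℓ.le
      have h4 : ℓ / 2 * (4 / ℓ ^ 2 * V ^ 2) = 2 / ℓ * V ^ 2 := by field_simp; ring
      have h5 : 2 * (‖z t‖ * V) ≤ ℓ / 2 * ‖z t‖ ^ 2 + 2 / ℓ * V ^ 2 := by
        have h6 : 0 ≤ (ℓ * ‖z t‖ - 2 * V) ^ 2 / (2 * ℓ) := by positivity
        have h7 : (ℓ * ‖z t‖ - 2 * V) ^ 2 / (2 * ℓ) =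
            ℓ / 2 * ‖z t‖ ^ 2 + 2 / ℓ * V ^ 2 - 2 * (‖z t‖ * V) := by field_simp; ring
        linarith
      linarith
  have hfin := hanti (left_mem_Icc.mpr hab) (right_mem_Icc.mpr hab) hab
  simp only [hf] at hfin
  set q := Real.exp (-(ℓ / 4 * (b - a))) with hq
  have hq0 : 0 < q := Real.exp_pos _
  have hsq : q ^ 2 * Real.exp (ℓ / 2 * b) = Real.exp (ℓ / 2 * a) := by
    rw [hq, pow_two, ← Real.exp_add, ← Real.exp_add]
    congr 1; ring
  have h1 : ‖z b‖ ^ 2 ≤ q ^ 2 * ‖z a‖ ^ 2 + 4 / ℓ ^ 2 * V ^ 2 := by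
    rw [← hsq] at hfin
    have hb : 0 < Real.exp (ℓ / 2 * b) := Real.exp_pos _
    have h2 : ‖z b‖ ^ 2 - 4 / ℓ ^ 2 * V ^ 2 ≤ q ^ 2 * (‖z a‖ ^ 2 - 4 / ℓ ^ 2 * V ^ 2) := by
      refine le_of_mul_le_mul_left ?_ hb
      linarith
    have h3 : 0 ≤ q ^ 2 * (4 / ℓ ^ 2 * V ^ 2) := by positivity
    linarith
  rw [one_mul]
  -- Taking square roots halves the decay rate to `ℓ / 4`; the cross term of the square is
  -- nonnegative.
  refine abs_le_of_sq_le_sq' (a := ‖z b‖) ?_ (by positivity) |>.2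
  refine h1.trans ?_
  have h2 : 0 ≤ q * ‖z a‖ * (2 / ℓ * V) := by positivity
  have h3 : (2 / ℓ * V) ^ 2 = 4 / ℓ ^ 2 * V ^ 2 := by field_simp; ring
  nlinarith

/-! ## The plant in closed loop -/

/-- On a kernel vector `v` the quadratic form equals `-‖v‖ ^ 2`, which is nonnegative only for `v =
0`. -/
theorem isUnit_det_of_positive {n : ℕ} {M : Matrix (Fin n) (Fin n) ℝ}
    (hM : (Mᵀ + M - 1).PosSemidef) : IsUnit M.det := by
  rw [← Matrix.isUnit_iff_isUnit_det, ← Matrix.mulVec_injective_iff_isUnit]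
  refine (injective_iff_map_eq_zero (Matrix.mulVecLin M)).mpr fun v hv => ?_
  have hv' : M *ᵥ v = 0 := hv
  have h := hM.dotProduct_mulVec_nonneg v
  have h2 : v ⬝ᵥ (Mᵀ *ᵥ v) = v ⬝ᵥ (M *ᵥ v) := by
    rw [Matrix.mulVec_transpose, dotProduct_comm, Matrix.dotProduct_mulVec]
  rw [Matrix.sub_mulVec, Matrix.add_mulVec, Matrix.one_mulVec, dotProduct_sub, dotProduct_add,
    star_trivial, h2, hv', dotProduct_zero] at h
  refine dotProduct_self_eq_zero.mp (le_antisymm (by linarith) ?_)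
  exact Finset.sum_nonneg fun i _ => mul_self_nonneg _

section ClosedLoop

variable {nw n0 nu ne : ℕ} {nχ : Fin ne → ℕ} {d nθ nν : ℕ}
  {Z : Type*} [NormedAddCommGroup Z] [NormedSpace ℝ Z]
  {P : Plant nw n0 nu ne nχ} {R : Regulator nw n0 nu nχ d nθ nν Z}

theorem OutReg.Assumption2.posSemidef {L : Matrix (Fin nu) (Fin ne) ℝ} (hA2 : Assumption2 P L)
    (w : Vec nw) (x : State n0 nχ) :
    ((P.Ω w x * L)ᵀ + P.Ω w x * L - 1).PosSemidef := by
  rw [Matrix.transpose_mul]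
  exact hA2.positive w x

/-- `K(κ) Cᵀ` is diagonal and its entries are multiples of the constant coefficients of the Hurwitz
polynomials. These are nonzero, for otherwise `0` would be a root. -/
theorem isUnit_det_Kη (hpos : ∀ i, 0 < nχ i) {κ ℓ : ℝ} (hκ : κ ≠ 0) (hℓ : ℓ ≠ 0) :
    IsUnit (R.Kη κ ℓ).det := by
  have ha : ∀ i, R.a i ⟨0, hpos i⟩ ≠ 0 := by
    intro i h0
    have h := R.a_hurwitz i 0 (by
      have hsum : ∑ j : Fin (nχ i), ((R.a i j : ℝ) : ℂ) * (0 : ℂ) ^ (j : ℕ) = 0 := by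
        refine Finset.sum_eq_zero fun j _ => ?_
        by_cases hj : (j : ℕ) = 0
        · rw [show j = ⟨0, hpos i⟩ from Fin.ext hj, h0]; simp
        · rw [zero_pow hj, mul_zero]
      simpa [(hpos i).ne'] using hsum)
    simp at h
  have hK : chainK nχ R.a κ * (chainC nχ)ᵀ =
      Matrix.diagonal fun i => -(R.a i ⟨0, hpos i⟩ * κ ^ nχ i) := by
    ext i j
    rw [Matrix.mul_apply, Finset.sum_eq_single ⟨j, ⟨0, hpos j⟩⟩]
    · by_cases hij : i = j
      · subst hij
        simp [chainK, chainC]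
      · rw [Matrix.diagonal_apply_ne _ hij]
        simp only [chainK, Matrix.of_apply]
        rw [if_neg fun h => hij h.symm, zero_mul]
    · rintro ⟨i', k⟩ _ hk
      simp only [chainC, Matrix.transpose_apply, Matrix.of_apply]
      rw [if_neg, mul_zero]
      rintro ⟨rfl, h0⟩
      exact hk (by congr 1; exact Fin.ext h0)
    · simp
  rw [Regulator.Kη, Matrix.det_smul, hK, Matrix.det_diagonal]
  refine isUnit_iff_ne_zero.mpr (mul_ne_zero (pow_ne_zero _ hℓ) (Finset.prod_ne_zero_iff.mpr ?_))
  exact fun i _ => neg_ne_zero.mpr (mul_ne_zero (ha i) (pow_ne_zero _ hκ))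

/-- The ideal `η₁` makes the internal model supply exactly the feedforward that cancels `q` and
compensates `K_w ν`. -/
theorem act_Kη_upsilon (hA2 : Assumption2 P R.L) {κ ℓ : ℝ} (hK : IsUnit (R.Kη κ ℓ).det)
    (w : Vec nw) (x : State n0 nχ) :
    act (R.Kη κ ℓ) (R.upsilon P κ ℓ w x) =
      -act (P.Ω w x * R.L)⁻¹ (P.q w x) - act (R.Kw κ ℓ) (R.ν x w) := by
  have hM := isUnit_det_of_positive (hA2.posSemidef w x)
  rw [Regulator.upsilon, act_neg, act_act, Matrix.mul_inv_rev, ← Matrix.mul_assoc,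
    Matrix.mul_nonsing_inv _ hK, Matrix.one_mul, act_add, act_act, ← Matrix.mul_assoc,
    Matrix.nonsing_inv_mul _ hM, Matrix.one_mul]
  abel

theorem act_neg_smul_one (r : ℝ) (v : Vec ne) :
    act (-(r • (1 : Matrix (Fin ne) (Fin ne) ℝ))) v = -(r • v) := by
  rw [← neg_smul, smul_act, one_act, neg_smul]

/-- The equation of `ζ` in the coordinates of the stabiliser. -/
theorem zeta_rhs_eq (hA2 : Assumption2 P R.L) {κ ℓ : ℝ} (hK : IsUnit (R.Kη κ ℓ).det)
    (w : Vec nw) (x xs : State n0 nχ) (χ : ChainVec nχ) (ζ η1 : Vec ne) :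
    P.q w x + act (P.Ω w x) (R.control κ ℓ χ ζ η1 xs w) =
      act (P.Ω w x * R.L) (-ℓ • (ζ - act (chainK nχ R.a κ)
          (χ + act (chainC nχ)ᵀ (η1 - R.upsilon P κ ℓ w xs)))) +
        act (P.Ω w x * R.L)
          (act (P.Ω w x * R.L)⁻¹ (P.q w x) - act (P.Ω w xs * R.L)⁻¹ (P.q w xs)) := by
  have hM := isUnit_det_of_positive (hA2.posSemidef w x)
  have hq : P.q w x = act (P.Ω w x * R.L) (act (P.Ω w x * R.L)⁻¹ (P.q w x)) := by
    rw [act_act, Matrix.mul_nonsing_inv _ hM, one_act]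
  have hups := act_Kη_upsilon hA2 hK w xs
  have hKη_act : ∀ v, ℓ • act (chainK nχ R.a κ) (act (chainC nχ)ᵀ v) = act (R.Kη κ ℓ) v := by
    intro v
    rw [Regulator.Kη, smul_act, act_act]
  conv_lhs => rw [hq]
  rw [Regulator.control, act_act (P.Ω w x) R.L, ← act_add, ← act_add]
  congr 1
  rw [act_add (chainK nχ R.a κ), smul_sub, smul_add]
  simp only [neg_smul]
  -- The term `K_w ν` cancels for every `K_w`. What remains is the difference of `(Ω ℒ)⁻¹ q` at the
  -- actual and at the ideal state, to which the Lipschitz condition applies.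
  rw [hKη_act, act_sub, hups, Regulator.Kχ, smul_act, act_neg_smul_one]
  module

/-- Detectability of the zero dynamics as an asymptotic gain. -/
theorem asymptoticGain_zeroDynamics {β0 : ℝ≥0 → ℝ≥0 → ℝ≥0} {α0 : ℝ≥0} (hβ : IsKL β0)
    {w : ℝ → Vec nw} {x : ℝ → State n0 nχ} {x0s : ℝ → Vec n0} {us : ℝ → Vec nu}
    (h : IsSteadyState P β0 α0 w x x0s us) (hα : 0 < α0) :
    HasAsymptoticGain (fun t => ‖(x t).1 - x0s t‖) fun t => α0 * ‖(x t).2‖ := by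
  have hα' : (0 : ℝ) < α0 := hα
  refine ⟨fun t₀ t => β0 ‖(x t₀).1 - x0s t₀‖₊ (t - t₀).toNNReal, fun t₀ _ => ?_,
    ⟨β0 ‖(x 0).1 - x0s 0‖₊ 0, fun t ht => ?_⟩, fun t₀ t V h0 ht hV hv => ?_⟩
  · have h1 : Tendsto (fun t : ℝ => (t - t₀).toNNReal) atTop atTop :=
      tendsto_real_toNNReal_atTop.comp (tendsto_atTop_add_const_right _ (-t₀) tendsto_id)
    exact NNReal.tendsto_coe.mpr ((hβ.tendsto _).comp h1)
  · exact NNReal.coe_le_coe.mpr (hβ.antitone _ zero_le)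
  · have hd := h.detect t₀.toNNReal t.toNNReal (Real.toNNReal_le_toNNReal ht)
    rw [NNReal.sub_def, Real.coe_toNNReal _ h0, Real.coe_toNNReal _ (h0.trans ht)] at hd
    have hsup : supNorm (fun τ => (x τ).2) t₀ t ≤ ENNReal.ofReal (V / α0) := by
      refine iSup₂_le fun s hs => ?_
      rw [← ofReal_norm]
      refine ENNReal.ofReal_le_ofReal ?_
      rw [le_div_iff₀' hα']
      exact hv s hs
    have h2 : ENNReal.ofReal ‖(x t).1 - x0s t‖ ≤ ENNReal.ofReal
        (β0 ‖(x t₀).1 - x0s t₀‖₊ (t - t₀).toNNReal + V) := by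
      rw [ofReal_norm, ENNReal.ofReal_add NNReal.zero_le_coe hV, ENNReal.ofReal_coe_nnreal]
      refine hd.trans (add_le_add_right ((mul_le_mul_right hsup _).trans (le_of_eq ?_)) _)
      rw [← ENNReal.ofReal_coe_nnreal, ← ENNReal.ofReal_mul hα'.le, mul_div_cancel₀ _ hα'.ne']
    exact (ENNReal.ofReal_le_ofReal_iff (add_nonneg NNReal.zero_le_coe hV)).mp h2

theorem continuous_idealSignal {κ ℓ : ℝ} {w : ℝ → Vec nw} {x0s : ℝ → Vec n0}
    (h : ContDiffOn ℝ d (R.etaOne P κ ℓ w x0s) (Ici 0)) :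
    Continuous (R.idealSignal P κ ℓ w x0s) := by
  have hc : ∀ i ≤ d, Continuous fun t : ℝ≥0 =>
      iteratedDerivWithin i (R.etaOne P κ ℓ w x0s) (Ici 0) t := fun i hi =>
    (h.continuousOn_iteratedDerivWithin (by exact_mod_cast hi)
      (uniqueDiffOn_Ici 0)).comp_continuous NNReal.continuous_coe fun t => t.2
  exact (hc d le_rfl).prodMk (continuous_pi fun i => hc i i.2.le)

theorem solvesOn_idealSignal {κ ℓ : ℝ} {w : ℝ → Vec nw} {x0s : ℝ → Vec n0}
    (h : ContDiffOn ℝ d (R.etaOne P κ ℓ w x0s) (Ici 0)) :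
    SolvesOn (fun t => (R.idealSignal P κ ℓ w x0s t.toNNReal).2)
      (shiftSignal (R.idealSignal P κ ℓ w x0s)) := by
  intro t ht
  rw [hasDerivWithinAt_pi]
  intro i
  have hd : HasDerivWithinAt (iteratedDerivWithin i (R.etaOne P κ ℓ w x0s) (Ici 0))
      (iteratedDerivWithin (i + 1) (R.etaOne P κ ℓ w x0s) (Ici 0) t) (Ici 0) t := by
    rw [iteratedDerivWithin_succ]
    exact (h.differentiableOn_iteratedDerivWithin (by exact_mod_cast i.2) (uniqueDiffOn_Ici 0) t
      ht).hasDerivWithinAt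
  have heq : shiftSignal (R.idealSignal P κ ℓ w x0s) t i =
      iteratedDerivWithin (i + 1) (R.etaOne P κ ℓ w x0s) (Ici 0) t := by
    by_cases hi : (i : ℕ) + 1 < d
    · simp [shiftSignal, hi, Regulator.idealSignal, Real.coe_toNNReal _ ht]
    · have hid : d = (i : ℕ) + 1 := by omega
      simp only [shiftSignal, hi, dif_neg, not_false_eq_true, Regulator.idealSignal,
        Real.coe_toNNReal _ ht]
      exact congrArg (fun n => iteratedDerivWithin n (R.etaOne P κ ℓ w x0s) (Ici 0) t) hid
  rw [heq]
  refine hd.congr_of_mem (fun s hs => ?_) ht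
  simp [Regulator.idealSignal, Real.coe_toNNReal s hs]

theorem fst_idealSignal {κ ℓ : ℝ} {w : ℝ → Vec nw} {x0s : ℝ → Vec n0} {t : ℝ} (ht : 0 ≤ t) :
    R.fst (R.idealSignal P κ ℓ w x0s t.toNNReal).2 =
      R.upsilon P κ ℓ (w t) (steady nχ x0s t) := by
  simp [Regulator.fst, Regulator.idealSignal, Real.coe_toNNReal t ht, Regulator.etaOne]

/-- The optimal error is a continuous function of a point of the compact set `H⋆ × S⋆`. Its
boundedness is needed to bound the network before passing to upper limits. -/
theorem exists_norm_optimalError_le {Hcl : Set (Signal d ne)} {Hset : Set (Vec ne × Stack d ne)}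
    {cε : ℝ≥0 → ℝ≥0 → ℝ≥0 → ℝ≥0} {cr : Vec nθ → ℝ≥0}
    {βς : ℝ≥0 → ℝ≥0 → ℝ≥0} {ας : ℝ≥0} {S : Set Z} {ςs : Signal d ne → ℝ≥0 → Z}
    (hA3 : R.Assumption3 Hcl Hset) (hid : R.IdentifierRequirement Hcl cε cr βς ας S ςs) :
    ∃ B, ∀ p ∈ Hcl, ∀ t, ‖optimalError R ςs p t‖ ≤ B := by
  obtain ⟨Mψ, hMψ⟩ := hA3.lipschitz
  obtain ⟨Mγ, hMγ⟩ := hid.γ_lipschitz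
  have hψ := hMψ.continuous
  have hγ := hMγ.continuous
  obtain ⟨B, hB⟩ := (hA3.compact.prod hid.compact).exists_bound_of_continuousOn
    (f := fun v => v.1.1 - R.ψ (v.1.2, R.γ v.2)) (by fun_prop)
  exact ⟨B, fun p hp t => hB (p t.toNNReal, ςs p t.toNNReal) ⟨hA3.mem p hp _, hid.mem p hp _⟩⟩

/-- The gain of the stabiliser, in terms of the deviation `x - x⋆` and of the derivative of the
scaled chain state. -/
theorem exists_gain_stabiliser (hA2 : Assumption2 P R.L) :
    ∃ k : ℝ, 0 < k ∧ ∀ κ ℓ : ℝ, 1 ≤ κ → 1 ≤ ℓ → ∀ (w : ℝ → Vec nw) (u : ℝ → Vec nu)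
      (x : ℝ → State n0 nχ) (x0s : ℝ → Vec n0) (η1 e0 : ℝ → Vec ne) (F : ℝ → ChainVec nχ),
      IsPlantSol P w u x →
      (∀ t, 0 ≤ t → u t =
        R.control κ ℓ (x t).2.1 (x t).2.2 (η1 t) (steady nχ x0s t) (w t)) →
      (∀ t, 0 ≤ t → e0 t = η1 t - R.upsilon P κ ℓ (w t) (steady nχ x0s t)) →
      SolvesOn (chainError κ (fun t => (x t).2.1) e0) F →
      ContinuousOn (stabiliserError R.a κ (fun t => (x t).2.1) (fun t => (x t).2.2) e0) (Ici 0) ∧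
      HasAsymptoticGain
        (fun t => ‖stabiliserError R.a κ (fun t => (x t).2.1) (fun t => (x t).2.2) e0 t‖)
        fun t => k * (ℓ⁻¹ * (‖(x t).1 - x0s t‖ + ‖(x t).2‖ + κ ^ (∑ i, nχ i) * ‖F t‖)) := by
  obtain ⟨M, hM⟩ := hA2.bounded
  obtain ⟨Λ, hΛ⟩ := hA2.lipschitz
  obtain ⟨kK, hkK, hK⟩ := exists_norm_act_scaledChainK_le (nχ := nχ) R.a
  set m : ℝ := Fintype.card (Fin ne) * Fintype.card (Fin ne) * |M| with hm
  have hm0 : 0 ≤ m := by positivity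
  refine ⟨2 * (m * Λ + kK), by positivity,
    fun κ ℓ hκ hℓ w u x x0s η1 e0 F hsol hu he0 hF => ?_⟩
  have hκ0 : 0 < κ := by linarith
  have hℓ0 : 0 < ℓ := by linarith
  have hKη : IsUnit (R.Kη κ ℓ).det := isUnit_det_Kη P.chain_pos hκ0.ne' hℓ0.ne'
  set Δ : ℝ → Vec ne := fun t => act (P.Ω (w t) (x t) * R.L)⁻¹ (P.q (w t) (x t)) -
    act (P.Ω (w t) (steady nχ x0s t) * R.L)⁻¹ (P.q (w t) (steady nχ x0s t)) with hΔ
  -- The second term arises because the virtual control moves: it is the derivative of `K(κ) χ̃`,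
  -- expressed through the derivative of the scaled chain state.
  set D : ℝ → Vec ne := fun t => act (P.Ω (w t) (x t) * R.L) (Δ t) -
    act (scaledChainK R.a κ) (F t) with hD
  set W := stabiliserError R.a κ (fun t => (x t).2.1) (fun t => (x t).2.2) e0 with hW
  have hWsol : SolvesOn W fun t => act (P.Ω (w t) (x t) * R.L) (-ℓ • W t) + D t := by
    intro t ht
    have h1 := (hsol.zeta t ht).sub
      ((actL (scaledChainK R.a κ)).hasFDerivAt.comp_hasDerivWithinAt t (hF t ht))
    have hWeq : W = (fun t => (x t).2.2) - (actL (scaledChainK R.a κ)) ∘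
        chainError κ (fun t => (x t).2.1) e0 := by
      funext s
      simp only [hW, stabiliserError, Pi.sub_apply, Function.comp_apply, actL_apply]
      rw [act_chainK_shiftedChain _ hκ0.ne']
    rw [hWeq]
    convert! h1 using 1
    rw [← hWeq]
    simp only [actL_apply, hD]
    rw [hu t ht, zeta_rhs_eq hA2 hKη, ← he0 t ht, add_sub_assoc]
    rfl
  refine ⟨hWsol.continuousOn, (asymptoticGain_of_positive hℓ0
    (fun t => hA2.posSemidef (w t) (x t)) hWsol).mono fun t ht => ?_⟩
  have hΔn : ‖Δ t‖ ≤ Λ * (‖(x t).1 - x0s t‖ + ‖(x t).2‖) := by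
    refine (hΛ.norm_sub_le (w t, x t) (w t, steady nχ x0s t)).trans
      (mul_le_mul_of_nonneg_left ?_ Λ.coe_nonneg)
    simp only [Prod.mk_sub_mk, sub_self, Prod.norm_mk, norm_zero]
    refine max_le (by positivity) ?_
    have : x t - steady nχ x0s t = ((x t).1 - x0s t, (x t).2) := by
      ext1
      · rfl
      · exact sub_zero _
    rw [this, Prod.norm_mk]
    exact max_le_add_of_nonneg (norm_nonneg _) (norm_nonneg _)
  have hΩn : ‖act (P.Ω (w t) (x t) * R.L) (Δ t)‖ ≤ m * ‖Δ t‖ :=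
    norm_act_le (abs_nonneg M) (fun i j => (hM _ _ i j).trans (le_abs_self M)) _
  set N := κ ^ (∑ i, nχ i) * ‖F t‖ with hN
  have hN0 : 0 ≤ N := by positivity
  set Q := ‖(x t).1 - x0s t‖ + ‖(x t).2‖ with hQ
  have hQ0 : 0 ≤ Q := by positivity
  have hDn : ‖D t‖ ≤ (m * Λ + kK) * (Q + N) := by
    refine (norm_sub_le _ _).trans ?_
    have h1 : m * ‖Δ t‖ ≤ m * (Λ * Q) := mul_le_mul_of_nonneg_left hΔn hm0
    have h2 := hK κ hκ (F t)
    have h3 : 0 ≤ m * Λ * N := by positivity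
    have h4 : 0 ≤ kK * Q := by positivity
    linarith
  calc 2 / ℓ * ‖D t‖ ≤ 2 / ℓ * ((m * Λ + kK) * (Q + N)) := by gcongr
    _ = _ := by field_simp

end ClosedLoop

/-! ## The network of gains of the closed loop -/

theorem loopGain_rows (c ρ g κ ℓ B r G : ℝ) (a : Fin 6 → ℝ) (E : ℝ) :
    (fun i => (∑ j, loopGain c ρ g κ ℓ B r G i j * a j) + inputGain c ρ g κ ℓ B r i * E) =
      ![c * (E + ρ * (G * a 2) + ρ⁻¹ * (a 0 + E + G * a 2 + a 1)),
        c * (a 0 + E + G * a 2),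
        c * (a 3 + r * (G * a 2 + a 1 + E)),
        c * (κ⁻¹ * (a 4 + g * (a 2 + a 3) + g * (r * (G * a 2 + a 1 + E)))),
        c * (ℓ⁻¹ * (B * (a 5 + a 3 + a 2 + a 4 + a 1 + E))),
        c * (B * (a 3 + a 2 + a 4))] := by
  funext i
  fin_cases i <;> simp [loopGain, inputGain, Fin.sum_univ_six] <;> ring

section Network

variable {nw n0 nu ne : ℕ} {nχ : Fin ne → ℕ} {d nθ nν : ℕ}
  {Z : Type*} [NormedAddCommGroup Z] [NormedSpace ℝ Z]

/-- The norms of the errors of the components of the closed loop. -/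
noncomputable def loopErrors (R : Regulator nw n0 nu nχ d nθ nν Z) (ςs : Signal d ne → ℝ≥0 → Z)
    (ρ g κ : ℝ) (p : Signal d ne) (x0s : ℝ → Vec n0) (x : ℝ → State n0 nχ)
    (η : ℝ → Stack d ne) (ς : ℝ → Z) (ξ1 ξ2 : ℝ → Vec ne) : Fin 6 → ℝ → ℝ :=
  ![fun t => ‖derivativeObserverError R ςs ρ p ξ1 ξ2 t‖,
    fun t => ‖ς t - ςs p t.toNNReal‖,
    fun t => ‖internalModelError g p η t‖,
    fun t => ‖chainError κ (fun t => (x t).2.1)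
      (fun t => internalModelError g p η t ⟨0, R.d_pos⟩) t‖,
    fun t => ‖stabiliserError R.a κ (fun t => (x t).2.1) (fun t => (x t).2.2)
      (fun t => internalModelError g p η t ⟨0, R.d_pos⟩) t‖,
    fun t => ‖(x t).1 - x0s t‖]

theorem internalModelError_zero (R : Regulator nw n0 nu nχ d nθ nν Z) (g : ℝ) (p : Signal d ne)
    (η : ℝ → Stack d ne) (t : ℝ) :
    internalModelError g p η t ⟨0, R.d_pos⟩ = R.fst (η t) - R.fst (p t.toNNReal).2 := by
  simp [internalModelError, Regulator.fst]

theorem norm_sub_le_derivativeObserverError (R : Regulator nw n0 nu nχ d nθ nν Z)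
    (ςs : Signal d ne → ℝ≥0 → Z) (ρ : ℝ) (p : Signal d ne) (ξ1 ξ2 : ℝ → Vec ne) (t : ℝ) :
    ‖ξ2 t - (p t.toNNReal).1‖ ≤
      ‖derivativeObserverError R ςs ρ p ξ1 ξ2 t‖ + ‖optimalError R ςs p t‖ := by
  have h : ξ2 t - (p t.toNNReal).1 =
      derivativeObserverError R ςs ρ p ξ1 ξ2 t 1 - optimalError R ςs p t := by
    simp [derivativeObserverError, optimalError, optimalPrediction, Regulator.predErr]
  rw [h]
  exact (norm_sub_le _ _).trans (add_le_add_left (norm_le_pi_norm _ 1) _)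

theorem exists_norm_chain_le (a : ∀ i, Fin (nχ i) → ℝ) :
    ∃ k : ℝ, 0 < k ∧ ∀ κ : ℝ, 1 ≤ κ → ∀ (χ : ℝ → ChainVec nχ) (ζ e0 : ℝ → Vec ne) (t : ℝ),
      ‖(χ t, ζ t)‖ ≤ k * (κ ^ (∑ i, nχ i) *
        (‖chainError κ χ e0 t‖ + ‖e0 t‖ + ‖stabiliserError a κ χ ζ e0 t‖)) := by
  obtain ⟨kS, hkS, hS⟩ := exists_norm_shiftedChain_le (nχ := nχ)
  obtain ⟨kK, hkK, hK⟩ := exists_norm_act_scaledChainK_le (nχ := nχ) a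
  refine ⟨kS + kK + 1, by positivity, fun κ hκ χ ζ e0 t => ?_⟩
  have hκ0 : κ ≠ 0 := by linarith
  have hN : 1 ≤ κ ^ (∑ i, nχ i) := one_le_pow₀ hκ
  set N := κ ^ (∑ i, nχ i)
  have h1 := hS κ hκ χ e0 t
  have h2 := hK κ hκ (chainError κ χ e0 t)
  have h3 : ‖ζ t‖ ≤ ‖stabiliserError a κ χ ζ e0 t‖ +
      ‖act (scaledChainK a κ) (chainError κ χ e0 t)‖ := by
    rw [← act_chainK_shiftedChain a hκ0]
    have : ζ t = stabiliserError a κ χ ζ e0 t + act (chainK nχ a κ) (shiftedChain χ e0 t) := by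
      simp [stabiliserError]
    exact (congrArg norm this).le.trans (norm_add_le _ _)
  set X := ‖chainError κ χ e0 t‖ with hX
  set W := ‖stabiliserError a κ χ ζ e0 t‖ with hW
  have hX0 : 0 ≤ X := norm_nonneg _
  have hW0 : 0 ≤ W := norm_nonneg _
  have he0 : 0 ≤ ‖e0 t‖ := norm_nonneg _
  have hNe : ‖e0 t‖ ≤ N * ‖e0 t‖ := le_mul_of_one_le_left he0 hN
  have hNW : W ≤ N * W := le_mul_of_one_le_left hW0 hN
  have hNX : 0 ≤ N * X := by positivity
  have hQ : 0 ≤ N * (X + ‖e0 t‖ + W) := by positivity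
  have hkK' : 0 ≤ kK * (N * (X + ‖e0 t‖ + W)) := by positivity
  have hkS' : 0 ≤ kS * (N * (X + ‖e0 t‖ + W)) := by positivity
  rw [Prod.norm_mk]
  refine max_le ?_ ?_
  · have : kS * (N * X + ‖e0 t‖) ≤ kS * (N * (X + ‖e0 t‖ + W)) :=
      mul_le_mul_of_nonneg_left (by linarith) hkS.le
    linarith
  · have : kK * (N * X) ≤ kK * (N * (X + ‖e0 t‖ + W)) :=
      mul_le_mul_of_nonneg_left (by linarith) hkK.le
    linarith

/-- The bounds that turn the gains of the stabiliser into a row of `loopGain`. -/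
theorem stabiliser_row {k3 k4 kq g κN κ r G z x w s E p D FX q : ℝ} (hk3 : 0 ≤ k3)
    (hk4 : 0 ≤ k4) (hg : 1 ≤ g) (hκ : 1 ≤ κ) (hκN : 1 ≤ κN)
    (hr1 : r ≤ 1) (hrG : r * G ≤ 1) (hz : 0 ≤ z) (hx : 0 ≤ x) (hw : 0 ≤ w) (hs : 0 ≤ s)
    (hE : 0 ≤ E) (hp : 0 ≤ p) (hkq : 0 ≤ kq)
    (hD : D ≤ k3 * (g * (z + x) + g * (r * (G * z + s + E))))
    (hFX : FX ≤ k4 * (κ * (x + w + D))) (hq : q ≤ kq * (κN * κ * g * (x + z + w))) :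
    p + q + κN * FX ≤
      (1 + kq + k4 * (1 + 2 * k3)) * (κN * κ * g * (p + x + z + w + s + E)) := by
  have hA1 : 1 ≤ κN * κ := one_le_mul_of_one_le_of_one_le hκN hκ
  have hB1 : 1 ≤ κN * κ * g := one_le_mul_of_one_le_of_one_le hA1 hg
  set T := p + x + z + w + s + E with hT
  have hT0 : 0 ≤ T := by positivity
  have h1 : r * (G * z + s + E) ≤ z + s + E := by
    have a1 : r * G * z ≤ 1 * z := mul_le_mul_of_nonneg_right hrG hz
    have a2 : r * (s + E) ≤ 1 * (s + E) := mul_le_mul_of_nonneg_right hr1 (by linarith)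
    linarith
  have h2 : D ≤ k3 * (g * (2 * T)) := by
    refine hD.trans (mul_le_mul_of_nonneg_left ?_ hk3)
    rw [← mul_add]
    exact mul_le_mul_of_nonneg_left (by linarith) (by linarith)
  have h3 : x + w + D ≤ (1 + 2 * k3) * (g * T) := by
    have : x + w ≤ g * T := (by linarith : x + w ≤ T).trans (le_mul_of_one_le_left hT0 hg)
    linarith
  have h4 : κN * FX ≤ k4 * (1 + 2 * k3) * (κN * κ * g * T) := by
    calc κN * FX ≤ κN * (k4 * (κ * ((1 + 2 * k3) * (g * T)))) :=
          mul_le_mul_of_nonneg_left (hFX.trans (mul_le_mul_of_nonneg_left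
            (mul_le_mul_of_nonneg_left h3 (by linarith)) hk4)) (by linarith)
      _ = _ := by ring
  have h5 : p ≤ κN * κ * g * T :=
    (by linarith : p ≤ T).trans (le_mul_of_one_le_left hT0 hB1)
  have h6 : kq * (κN * κ * g * (x + z + w)) ≤ kq * (κN * κ * g * T) :=
    mul_le_mul_of_nonneg_left (mul_le_mul_of_nonneg_left (by linarith) (by linarith)) hkq
  linarith

end Network

/-! ### The six gain relations with a common constant -/

section Network

variable {nw n0 nu ne : ℕ} {nχ : Fin ne → ℕ} {d nθ nν : ℕ}
  {Z : Type*} [NormedAddCommGroup Z] [NormedSpace ℝ Z] [FiniteDimensional ℝ Z]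
  {P : Plant nw n0 nu ne nχ} {R : Regulator nw n0 nu nχ d nθ nν Z}
  {β0 : ℝ≥0 → ℝ≥0 → ℝ≥0} {α0 : ℝ≥0}
  {ss : (ℝ → Vec nw) → (ℝ → Vec nu) → (ℝ → State n0 nχ) → (ℝ → Vec n0) × (ℝ → Vec nu)}
  {Hcl : Set (Signal d ne)} {Hset : Set (Vec ne × Stack d ne)}
  {cε : ℝ≥0 → ℝ≥0 → ℝ≥0 → ℝ≥0} {cr : Vec nθ → ℝ≥0}
  {βς : ℝ≥0 → ℝ≥0 → ℝ≥0} {ας : ℝ≥0} {S : Set Z} {ςs : Signal d ne → ℝ≥0 → Z}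

/-- The errors of the components of the closed loop satisfy the gain relations `loopGain`, with a
constant that does not depend on the control parameters. -/
theorem exists_gain_loopErrors (hA1 : Assumption1 P β0 α0 ss) (hA2 : Assumption2 P R.L)
    (hA3 : R.Assumption3 Hcl Hset) (hid : R.IdentifierRequirement Hcl cε cr βς ας S ςs)
    (hψdot : R.PsiDotOk Hset S) (hideal : R.IdealInClass P ss Hcl) :
    ∃ c : ℝ, 1 ≤ c ∧ ∀ ρ g κ ℓ : ℝ, 1 ≤ ρ → 1 ≤ g → 1 < κ → 1 < ℓ →
      ∀ (w : ℝ → Vec nw) (u : ℝ → Vec nu) (x : ℝ → State n0 nχ) (η : ℝ → Stack d ne)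
        (ς : ℝ → Z) (ξ1 ξ2 : ℝ → Vec ne),
        IsClosedLoopSol P R ρ g κ ℓ (ss w u x).1 w u x η ς ξ1 ξ2 →
        ∀ p, p = R.idealSignal P κ ℓ w (ss w u x).1 →
        ∀ F, F = loopErrors R ςs ρ g κ p (ss w u x).1 x η ς ξ1 ξ2 →
        (∀ i, ContinuousOn (F i) (Ici 0)) ∧
        (∀ i, HasAsymptoticGain (F i) fun t =>
          (∑ j, loopGain c ρ g κ ℓ (κ ^ (∑ i, nχ i) * κ * g) (g ^ d)⁻¹ (g ^ (d - 1)) i j *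
            F j t) + inputGain c ρ g κ ℓ (κ ^ (∑ i, nχ i) * κ * g) (g ^ d)⁻¹ i *
              ‖optimalError R ςs p t‖) ∧
        ∀ t, ‖act (chainC nχ) (x t).2.1‖ ≤ ne * F 3 t + F 2 t := by
  obtain ⟨k1, hk1, H1⟩ := exists_gain_derivativeObserver hA3 hid hψdot
  obtain ⟨k3, hk3, H3⟩ := exists_gain_internalModel hA3 hid
  obtain ⟨k4, hk4, H4⟩ := exists_gain_chainError R.a R.a_hurwitz
  obtain ⟨k5, hk5, H5⟩ := exists_gain_stabiliser hA2
  obtain ⟨kq, hkq, Hq⟩ := exists_norm_chain_le (nχ := nχ) R.a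
  have hα0 : (0 : ℝ) ≤ α0 := α0.coe_nonneg
  have hας : (0 : ℝ) ≤ ας := ας.coe_nonneg
  set k3' := k3 * (ne + 1) with hk3'
  have hk3'0 : 0 ≤ k3' := by positivity
  have hc4 : 0 ≤ k4 * (1 + k3') := by positivity
  have hc5 : 0 ≤ k5 * (1 + kq + k4 * (1 + 2 * k3')) := by positivity
  have hc6 : 0 ≤ α0 * kq := by positivity
  -- The sum dominates the constant of every row. The terms with `k3'` arise where the derivative of
  -- the internal-model error is substituted into the estimates of the chains and of the stabiliser.
  set c : ℝ := 1 + k1 + ας + k3' + k4 * (1 + k3') + k5 * (1 + kq + k4 * (1 + 2 * k3')) +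
    α0 * kq with hc
  have c1 : k1 ≤ c := by linarith
  have c2 : (ας : ℝ) ≤ c := by linarith
  have c3 : k3' ≤ c := by linarith
  have c4 : k4 * (1 + k3') ≤ c := by linarith
  have c5 : k5 * (1 + kq + k4 * (1 + 2 * k3')) ≤ c := by linarith
  have c6 : α0 * kq ≤ c := by linarith
  refine ⟨c, by linarith, fun ρ g κ ℓ hρ hg hκ hℓ w u x η ς ξ1 ξ2 hsol p hp F hF => ?_⟩
  clear_value c
  obtain ⟨hcd, hpH⟩ := hideal w u x hsol.plant κ ℓ hκ hℓ
  have hpc : Continuous p := hp ▸ continuous_idealSignal hcd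
  have hpd : SolvesOn (fun t => (p t.toNNReal).2) (shiftSignal p) := by
    rw [hp]; exact solvesOn_idealSignal hcd
  rw [← hp] at hpH
  obtain ⟨hYc, hY⟩ := H1 ρ hρ p hpH hpc hpd η ς ξ1 ξ2 hsol.xi1 hsol.xi2
  have hS := asymptoticGain_identifier hid hpH hpc hsol.sigma hsol.xi2.continuousOn
    hsol.eta.continuousOn
  obtain ⟨FZ, hFZ, hFZn, hZ⟩ := H3 g hg p hpd η ς _ hsol.eta
  set e0 : ℝ → Vec ne := fun t => internalModelError g p η t ⟨0, R.d_pos⟩ with he0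
  have he0' : SolvesOn e0 fun t => FZ t ⟨0, R.d_pos⟩ := fun t ht =>
    hasDerivWithinAt_pi.mp (hFZ t ht) _
  have he0_eq : ∀ t, R.fst (η t) - R.fst (p t.toNNReal).2 = e0 t := fun t =>
    (internalModelError_zero R g p η t).symm
  obtain ⟨FX, hFX, hFXn, hX⟩ := H4 κ hκ.le (fun t => (x t).2.1) (fun t => (x t).2.2) e0 _
    hsol.plant.chi he0'
  obtain ⟨hWc, hW⟩ := H5 κ ℓ hκ.le hℓ.le w u x (ss w u x).1 (fun t => R.fst (η t)) e0 FX
    hsol.plant hsol.control (fun t ht => by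
      rw [← he0_eq t, hp, fst_idealSignal ht]) hFX
  have hss := hA1.steadyState w u x hsol.plant
  have hP := asymptoticGain_zeroDynamics hA1.kl hss hA1.pos
  simp only [he0_eq] at hFZn hZ
  have hcont : ∀ i, ContinuousOn (F i) (Ici 0) := by
    subst hF
    intro i
    fin_cases i
    · exact hYc.norm
    · exact (hsol.sigma.continuousOn.sub
        (solvesOn_identifierSteadyState hid hpH hpc).continuousOn).norm
    · exact hFZ.continuousOn.norm
    · exact hFX.continuousOn.norm
    · exact hWc.norm
    · exact (hsol.plant.x0.continuousOn.sub hss.x0s_eq.continuousOn).norm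
  have hF0 : ∀ i t, 0 ≤ F i t := by
    subst hF
    intro i t
    fin_cases i <;> exact norm_nonneg _
  have hv : ∀ t, ‖ξ2 t - (p t.toNNReal).1‖ ≤ F 0 t + ‖optimalError R ςs p t‖ := fun t => by
    rw [hF]; exact norm_sub_le_derivativeObserverError R ςs ρ p ξ1 ξ2 t
  have hη : ∀ t, ‖η t - (p t.toNNReal).2‖ ≤ g ^ (d - 1) * F 2 t := fun t => by
    rw [hF]; exact norm_sub_le_internalModelError hg p η t
  have he : ∀ t, ‖act (chainC nχ) (x t).2.1 + e0 t‖ ≤ ne * F 3 t := fun t => by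
    rw [hF]; exact norm_act_chainC_add_le P.chain_pos κ (fun t => (x t).2.1) e0 t
  have he0n : ∀ t, ‖e0 t‖ ≤ F 2 t := fun t => by
    rw [hF]; exact norm_le_pi_norm (internalModelError g p η t) _
  have hg0 : 0 < g := by linarith
  have hgd : 1 ≤ g ^ d := one_le_pow₀ hg
  have hG : 1 ≤ g ^ (d - 1) := one_le_pow₀ hg
  have hr0 : 0 ≤ (g ^ d)⁻¹ := by positivity
  have hr1 : (g ^ d)⁻¹ ≤ 1 := inv_le_one_of_one_le₀ hgd
  have hrG : (g ^ d)⁻¹ * g ^ (d - 1) ≤ 1 := by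
    rw [inv_mul_le_iff₀ (by positivity), mul_one]
    exact pow_le_pow_right₀ hg (Nat.sub_le _ _)
  have hκN : 1 ≤ κ ^ (∑ i, nχ i) := one_le_pow₀ hκ.le
  have hκ0 : 0 < κ := by linarith
  have hℓ0 : 0 < ℓ := by linarith
  set G := g ^ (d - 1)
  set r := (g ^ d)⁻¹
  set κN := κ ^ (∑ i, nχ i)
  set E : ℝ → ℝ := fun t => ‖optimalError R ςs p t‖ with hE
  have hE0 : ∀ t, 0 ≤ E t := fun t => norm_nonneg _
  have hT0 : ∀ t, 0 ≤ G * F 2 t + F 1 t + E t := fun t => by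
    have := hF0 2 t; have := hF0 1 t; have := hE0 t; positivity
  have hT : ∀ t, ‖η t - (p t.toNNReal).2‖ + ‖ς t - ςs p t.toNNReal‖ + E t ≤
      G * F 2 t + F 1 t + E t := fun t => by
    have h1 : ‖ς t - ςs p t.toNNReal‖ = F 1 t := by rw [hF]; rfl
    rw [h1]
    linarith [hη t]
  -- The derivative of the shift of the chains; its size `g` is the reason for choosing `κ` after
  -- `g`.
  have hD : ∀ t, ‖FZ t ⟨0, R.d_pos⟩‖ ≤
      k3' * (g * (F 2 t + F 3 t) + g * (r * (G * F 2 t + F 1 t + E t))) := fun t => by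
    have h1 : ‖internalModelError g p η t‖ = F 2 t := by rw [hF]; rfl
    refine (norm_le_pi_norm (FZ t) _).trans ((hFZn t).trans ?_)
    rw [h1, hk3', mul_assoc]
    refine mul_le_mul_of_nonneg_left ?_ hk3.le
    have h2 : g * (F 2 t + ‖act (chainC nχ) (x t).2.1 + e0 t‖) ≤
        (ne + 1) * (g * (F 2 t + F 3 t)) := by
      rw [mul_left_comm]
      refine mul_le_mul_of_nonneg_left ?_ hg0.le
      have : 0 ≤ (ne : ℝ) * F 2 t := mul_nonneg ne.cast_nonneg (hF0 2 t)
      linarith [he t, hF0 3 t]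
    have h3 : g * (r * (‖η t - (p t.toNNReal).2‖ + ‖ς t - ςs p t.toNNReal‖ + E t)) ≤
        (ne + 1) * (g * (r * (G * F 2 t + F 1 t + E t))) := by
      refine (mul_le_mul_of_nonneg_left (mul_le_mul_of_nonneg_left (hT t) hr0) hg0.le).trans ?_
      exact le_mul_of_one_le_left (mul_nonneg hg0.le (mul_nonneg hr0 (hT0 t)))
        (by linarith [(Nat.cast_nonneg ne : (0 : ℝ) ≤ ne)])
    linarith
  -- The factor `κ * g` is not needed here; it is inserted so that the stabiliser and the zero
  -- dynamics share one factor `B`.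
  have hq : ∀ t, ‖(x t).2‖ ≤ kq * (κN * κ * g * (F 3 t + F 2 t + F 4 t)) := fun t => by
    have h1 := Hq κ hκ.le (fun t => (x t).2.1) (fun t => (x t).2.2) e0 t
    refine h1.trans (mul_le_mul_of_nonneg_left ?_ hkq.le)
    have h2 : ‖chainError κ (fun t => (x t).2.1) e0 t‖ = F 3 t := by rw [hF]; rfl
    have h3 : ‖stabiliserError R.a κ (fun t => (x t).2.1) (fun t => (x t).2.2) e0 t‖ = F 4 t := by
      rw [hF]; rfl
    rw [h2, h3]
    have h4 := hF0 2 t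
    have h5 := hF0 3 t
    have h6 := hF0 4 t
    refine mul_le_mul ?_ (by linarith [he0n t]) (by positivity) (by positivity)
    exact (le_mul_of_one_le_right (by linarith) hκ.le).trans
      (le_mul_of_one_le_right (by positivity) hg)
  refine ⟨hcont, ?_, fun t => ?_⟩
  swap
  · calc ‖act (chainC nχ) (x t).2.1‖ = ‖act (chainC nχ) (x t).2.1 + e0 t - e0 t‖ := by
          rw [add_sub_cancel_right]
      _ ≤ _ := (norm_sub_le _ _).trans (add_le_add (he t) (he0n t))
  have rows := fun t => congrFun (loopGain_rows c ρ g κ ℓ (κN * κ * g) r G (fun j => F j t) (E t))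
  have key : ∀ i v, HasAsymptoticGain (F i) v →
      (∀ t, 0 ≤ t → v t ≤ (∑ j, loopGain c ρ g κ ℓ (κN * κ * g) r G i j * F j t) +
        inputGain c ρ g κ ℓ (κN * κ * g) r i * E t) →
      HasAsymptoticGain (F i) fun t =>
        (∑ j, loopGain c ρ g κ ℓ (κN * κ * g) r G i j * F j t) +
          inputGain c ρ g κ ℓ (κN * κ * g) r i * E t := fun i v h h' => h.mono h'
  have f0 : (fun t => ‖derivativeObserverError R ςs ρ p ξ1 ξ2 t‖) = F 0 := by rw [hF]; rfl
  have f1 : (fun t => ‖ς t - ςs p t.toNNReal‖) = F 1 := by rw [hF]; rfl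
  have f2 : (fun t => ‖internalModelError g p η t‖) = F 2 := by rw [hF]; rfl
  have f3 : (fun t => ‖chainError κ (fun t => (x t).2.1) e0 t‖) = F 3 := by rw [hF]; rfl
  have f4 : (fun t => ‖stabiliserError R.a κ (fun t => (x t).2.1) (fun t => (x t).2.2) e0 t‖) =
    F 4 := by rw [hF]; rfl
  have f5 : (fun t => ‖(x t).1 - (ss w u x).1 t‖) = F 5 := by rw [hF]; rfl
  rw [f0] at hY
  rw [f1] at hS
  rw [f2] at hZ
  rw [f3] at hX
  rw [f4] at hW
  rw [f5] at hP
  have hs : ∀ t, ‖ς t - ςs p t.toNNReal‖ = F 1 t := congrFun f1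
  have hx : ∀ t, ‖chainError κ (fun t => (x t).2.1) e0 t‖ = F 3 t := congrFun f3
  have hw : ∀ t, ‖stabiliserError R.a κ (fun t => (x t).2.1) (fun t => (x t).2.2) e0 t‖ =
    F 4 t := congrFun f4
  have hpp : ∀ t, ‖(x t).1 - (ss w u x).1 t‖ = F 5 t := congrFun f5
  intro i
  fin_cases i
  · refine key 0 _ hY fun t _ => (?_ : _ ≤ _).trans_eq (rows t 0).symm
    simp only [Matrix.cons_val_zero, hs]
    have h1 := hv t
    have h2 := hη t
    have n0 := hF0 0 t
    have n1 := hF0 1 t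
    have n2 := hF0 2 t
    have nE := hE0 t
    refine mul_le_mul c1 ?_ (by positivity) (hk1.le.trans c1)
    gcongr
  · refine key 1 _ hS fun t _ => (?_ : _ ≤ _).trans_eq (rows t 1).symm
    exact mul_le_mul c2 (add_le_add (hv t) (hη t)) (by positivity) (hας.trans c2)
  · refine key 2 _ hZ fun t _ => (?_ : _ ≤ _).trans_eq (rows t 2).symm
    have hRT : 0 ≤ r * (G * F 2 t + F 1 t + E t) := mul_nonneg hr0 (hT0 t)
    have h1 : ‖act (chainC nχ) (x t).2.1 + e0 t‖ +
        r * (‖η t - (p t.toNNReal).2‖ + ‖ς t - ςs p t.toNNReal‖ + E t) ≤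
        (ne + 1) * (F 3 t + r * (G * F 2 t + F 1 t + E t)) := by
      have h2 := mul_le_mul_of_nonneg_left (hT t) hr0
      have h3 : 0 ≤ (ne : ℝ) * (r * (G * F 2 t + F 1 t + E t)) :=
        mul_nonneg ne.cast_nonneg hRT
      linarith [he t, hF0 3 t]
    refine (mul_le_mul_of_nonneg_left h1 hk3.le).trans ?_
    rw [← mul_assoc, ← hk3']
    exact mul_le_mul_of_nonneg_right c3 (add_nonneg (hF0 3 t) hRT)
  · refine key 3 _ hX fun t _ => (?_ : _ ≤ _).trans_eq (rows t 3).symm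
    have hRT : 0 ≤ r * (G * F 2 t + F 1 t + E t) := mul_nonneg hr0 (hT0 t)
    have n2 := hF0 2 t
    have n3 := hF0 3 t
    have n4 := hF0 4 t
    have hQ : 0 ≤ g * (F 2 t + F 3 t) + g * (r * (G * F 2 t + F 1 t + E t)) := by positivity
    have h1 : F 4 t + ‖FZ t ⟨0, R.d_pos⟩‖ ≤ (1 + k3') *
        (F 4 t + g * (F 2 t + F 3 t) + g * (r * (G * F 2 t + F 1 t + E t))) := by
      have : 0 ≤ k3' * F 4 t := mul_nonneg hk3'0 n4
      linarith [hD t]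
    simp only [hw]
    calc k4 * (κ⁻¹ * (F 4 t + ‖FZ t ⟨0, R.d_pos⟩‖))
        ≤ k4 * (κ⁻¹ * ((1 + k3') *
          (F 4 t + g * (F 2 t + F 3 t) + g * (r * (G * F 2 t + F 1 t + E t))))) := by gcongr
      _ = k4 * (1 + k3') * (κ⁻¹ *
          (F 4 t + g * (F 2 t + F 3 t) + g * (r * (G * F 2 t + F 1 t + E t)))) := by ring
      _ ≤ _ := mul_le_mul_of_nonneg_right c4 (by positivity)
  · refine key 4 _ hW fun t _ => (?_ : _ ≤ _).trans_eq (rows t 4).symm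
    simp only [hpp]
    have n1 := hF0 1 t
    have n2 := hF0 2 t
    have n3 := hF0 3 t
    have n4 := hF0 4 t
    have n5 := hF0 5 t
    have nE := hE0 t
    have h1 := stabiliser_row hk3'0 hk4.le hg hκ.le hκN hr1 hrG n2 n3 n4 n1 nE n5 hkq.le
      (hD t) (by simpa only [hx, hw] using hFXn t) (hq t)
    calc k5 * (ℓ⁻¹ * (F 5 t + ‖(x t).2‖ + κN * ‖FX t‖))
        ≤ k5 * (ℓ⁻¹ * ((1 + kq + k4 * (1 + 2 * k3')) *
          (κN * κ * g * (F 5 t + F 3 t + F 2 t + F 4 t + F 1 t + E t)))) := by gcongr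
      _ = k5 * (1 + kq + k4 * (1 + 2 * k3')) * (ℓ⁻¹ *
          (κN * κ * g * (F 5 t + F 3 t + F 2 t + F 4 t + F 1 t + E t))) := by ring
      _ ≤ _ := mul_le_mul_of_nonneg_right c5 (by positivity)
  · refine key 5 _ hP fun t _ => (?_ : _ ≤ _).trans_eq (rows t 5).symm
    have n2 := hF0 2 t
    have n3 := hF0 3 t
    have n4 := hF0 4 t
    refine (mul_le_mul_of_nonneg_left (hq t) hα0).trans ?_
    rw [← mul_assoc]
    exact mul_le_mul_of_nonneg_right c6 (by positivity)

end Network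

/-! ### Choice of the parameters and the asymptotic bound -/

theorem theorem1 {nw n0 nu ne : ℕ} {nχ : Fin ne → ℕ} {d nθ nν : ℕ}
    {Z : Type*} [NormedAddCommGroup Z] [NormedSpace ℝ Z] [FiniteDimensional ℝ Z]
    (P : Plant nw n0 nu ne nχ) (R : Regulator nw n0 nu nχ d nθ nν Z)
    -- the first assumption, with the steady states that it provides
    (β0 : ℝ≥0 → ℝ≥0 → ℝ≥0) (α0 : ℝ≥0)
    (ss : (ℝ → Vec nw) → (ℝ → Vec nu) → (ℝ → State n0 nχ) → (ℝ → Vec n0) × (ℝ → Vec nu))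
    (hA1 : Assumption1 P β0 α0 ss)
    -- the second assumption
    (hA2 : Assumption2 P R.L)
    -- the third assumption, with the class and the compact set
    (Hcl : Set (Signal d ne)) (Hset : Set (Vec ne × Stack d ne))
    (hA3 : R.Assumption3 Hcl Hset)
    -- the cost functional and the identifier requirement
    (cε : ℝ≥0 → ℝ≥0 → ℝ≥0 → ℝ≥0) (cr : Vec nθ → ℝ≥0) (hcost : R.CostWellDefined cε cr Hcl)
    (βς : ℝ≥0 → ℝ≥0 → ℝ≥0) (ας : ℝ≥0) (S : Set Z) (ςs : Signal d ne → ℝ≥0 → Z)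
    (hid : R.IdentifierRequirement Hcl cε cr βς ας S ςs)
    (hψdot : R.PsiDotOk Hset S)
    -- the ideal signals belong to the class
    (hideal : R.IdealInClass P ss Hcl) :
    ∃ (c ρs : ℝ) (gs κs : ℝ → ℝ) (ℓs : ℝ → ℝ → ℝ),
      0 < c ∧ 0 < ρs ∧ (∀ ρ, 0 < gs ρ) ∧ (∀ g, 0 < κs g) ∧ (∀ g κ, 0 < ℓs g κ) ∧
      ∀ ρ g κ ℓ : ℝ, ρs ≤ ρ → gs ρ ≤ g → κs g ≤ κ → ℓs g κ ≤ ℓ →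
        ∀ (w : ℝ → Vec nw) (u : ℝ → Vec nu) (x : ℝ → State n0 nχ) (η : ℝ → Stack d ne)
          (ς : ℝ → Z) (ξ1 ξ2 : ℝ → Vec ne),
          IsClosedLoopSol P R ρ g κ ℓ (ss w u x).1 w u x η ς ξ1 ξ2 →
          limsup (fun t : ℝ≥0 => ‖act (chainC nχ) (x t).2.1‖ₑ) atTop ≤
            ENNReal.ofReal (c / g ^ d) *
              limsup (fun t : ℝ≥0 =>
                ‖R.predErr (R.idealSignal P κ ℓ w (ss w u x).1) t
                  (R.γ (ςs (R.idealSignal P κ ℓ w (ss w u x).1) t))‖ₑ) atTop := by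
  obtain ⟨c, hc, H⟩ := exists_gain_loopErrors hA1 hA2 hA3 hid hψdot hideal
  obtain ⟨Bε, hBε⟩ := exists_norm_optimalError_le hA3 hid
  have hc0 : 0 < c := by linarith
  -- The thresholds are those of `static_gains`. The maxima make them positive for all arguments;
  -- the value `2` yields the strict bounds `1 < κ` and `1 < ℓ` under which the ideal signals belong
  -- to the class.
  refine ⟨(ne + 1) * (17 * c ^ 3), 2 * (c * (1 + c)), fun ρ => max 1 (10 * c ^ 3 * ρ),
    fun g => max 2 (50 * c ^ 4 * g),
    fun g κ => max 2 (g ^ d * (2 * (c * (κ ^ (∑ i, nχ i) * κ * g) *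
      ((c * (κ ^ (∑ i, nχ i) * κ * g) + 1 + 4 * c ^ 2 * g * g ^ (d - 1)) * (19 * c ^ 3) +
        5 * c ^ 2)))),
    by positivity, by positivity, fun ρ => by positivity, fun g => by positivity,
    fun g κ => by positivity, ?_⟩
  intro ρ g κ ℓ hρ hg hκ hℓ w u x η ς ξ1 ξ2 hsol
  obtain ⟨hg1, hg2⟩ := max_le_iff.mp hg
  obtain ⟨hκ1, hκ2⟩ := max_le_iff.mp hκ
  obtain ⟨hℓ1, hℓ2⟩ := max_le_iff.mp hℓ
  have hρ1 : 1 ≤ ρ := by nlinarith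
  have hg0 : 0 < g := by linarith
  have hgd : 0 < g ^ d := by positivity
  have hB : 1 ≤ κ ^ (∑ i, nχ i) * κ * g :=
    one_le_mul_of_one_le_of_one_le (one_le_mul_of_one_le_of_one_le
      (one_le_pow₀ (by linarith)) (by linarith)) hg1
  have hG : 1 ≤ g ^ (d - 1) := one_le_pow₀ hg1
  have hr0 : 0 ≤ (g ^ d)⁻¹ := by positivity
  have hr1 : (g ^ d)⁻¹ ≤ 1 := inv_le_one_of_one_le₀ (one_le_pow₀ hg1)
  have hrG : (g ^ d)⁻¹ * g ^ (d - 1) = g⁻¹ := by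
    rw [← Nat.sub_add_cancel R.d_pos, pow_succ, Nat.add_sub_cancel]
    field_simp
  -- The factor `g ^ d` in the threshold of `ℓ` becomes the factor `r` in the hypothesis on `r * ℓ`.
  have hℓr := (le_inv_mul_iff₀ hgd).mpr hℓ2
  set p := R.idealSignal P κ ℓ w (ss w u x).1 with hp
  have hpH : p ∈ Hcl := (hideal w u x hsol.plant κ ℓ (by linarith) (by linarith)).2
  set F := loopErrors R ςs ρ g κ p (ss w u x).1 x η ς ξ1 ξ2 with hF
  obtain ⟨hFc, hgain, hout⟩ := H ρ g κ ℓ hρ1 hg1 (by linarith) (by linarith) w u x η ς ξ1 ξ2 hsol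
    p hp F hF
  have hF0 : ∀ i t, 0 ≤ F i t := by
    intro i t
    fin_cases i <;> exact norm_nonneg _
  clear_value F
  set B := κ ^ (∑ i, nχ i) * κ * g
  set G := g ^ (d - 1)
  set r := (g ^ d)⁻¹ with hr
  have hne : (0 : ℝ) ≤ ne := ne.cast_nonneg
  have hstat := fun a ha C hC E hE => static_gains (C := C) (E := E) hc hρ hg2 hκ2 hB hr0 hr1 hG
    hrG (by linarith) hℓr a ha hC hE
  have hnet := upperLimit_le_of_network (F := F) (E := fun t => ‖optimalError R ςs p t‖)
    -- The regulation error is read off from the internal model and the chains, the only two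
    -- components whose bound carries no large parameter.
    (o := ![0, 0, ne + 1, ne + 1, 0, 0]) (r := (ne + 1) * (17 * c ^ 3 * r)) (B := Bε)
    (loopGain_nonneg hc0.le (by linarith) hg0.le (by linarith) (by linarith) (by linarith) hr0
      (by linarith))
    (inputGain_nonneg hc0.le (by linarith) hg0.le (by linarith) (by linarith) (by linarith) hr0)
    (fun i => by fin_cases i <;> simp <;> positivity) (by positivity) hF0 hFc
    (fun t => norm_nonneg _) (fun t _ => hBε p hpH t) hgain
    (fun a C ε ha hC hε h => (hstat a ha C hC ε hε h).2)
    -- For upper limits the additive constant is zero, and only the prediction error with weight `r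
    -- = g⁻ᵈ` remains.
    (fun a ε ha hε h => by
      have h1 := (hstat a ha 0 le_rfl ε hε (fun i => by rw [zero_add]; exact h i)).1
      have h2 : ∑ j, (![0, 0, (ne : ℝ) + 1, ne + 1, 0, 0] : Fin 6 → ℝ) j * a j =
          (ne + 1) * (a 2 + a 3) := by
        simp [Fin.sum_univ_six]; ring
      rw [h2, mul_assoc (ne + 1 : ℝ)]
      exact mul_le_mul_of_nonneg_left (by linarith) (by positivity))
  have hfac : (ne + 1) * (17 * c ^ 3) / g ^ d = (ne + 1) * (17 * c ^ 3 * r) := by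
    rw [hr, div_eq_mul_inv]; ring
  rw [hfac]
  refine (limsup_le_limsup (Eventually.of_forall fun t => ?_)).trans (hnet.trans_eq ?_)
  · simp only
    rw [← ofReal_norm]
    refine ENNReal.ofReal_le_ofReal ((hout t).trans ?_)
    have h2 := hF0 2 t
    have h3 := hF0 3 t
    have h4 : ∑ j, (![0, 0, (ne : ℝ) + 1, ne + 1, 0, 0] : Fin 6 → ℝ) j * F j t =
        (ne + 1) * (F 2 t + F 3 t) := by
      simp [Fin.sum_univ_six]; ring
    rw [h4]
    have : 0 ≤ (ne : ℝ) * F 2 t := by positivity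
    linarith
  · rw [upperLimit]
    refine congrArg (fun f : ℝ≥0 → ℝ≥0∞ => _ * limsup f atTop) (funext fun t => ?_)
    rw [ofReal_norm, optimalError, Real.toNNReal_coe]
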